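/- A signed graph is a finite simple graph $G=(V,E)$ in which every edge is labelled positive or negative. It is balanced if $V$ can be partitioned into two (possibly empty) parts such that every positive edge has both endpoints in the same part and every negative edge has its endpoints in different parts. A closed walk or cycle is positive if it has an even number of negative edges. A forest of cliques is a graph in which the vertices of every cycle induce a clique. For $W\subseteq V$, the $W$-switch of $G$ changes the signs of all edges between $W$ and $V\setminus W$. In the problem Signed Max Cut ATLB one is given a connected signed graph $G$ with $n\ge 1$ vertices and $m$ edges and an integer $k\ge 0$ (the parameter), and has to decide whether $G$ has a balanced subgraph with at least $\frac m2+\frac{n-1}4+\frac k4$ edges; if so, $(G,k)$ is a Yes-instance. **Theorem.** (1) Signed Max Cut ATLB can be solved in time $O^*(8^k)$: there are a random access machine program and a constant $c$ such that on every instance $(G,k)$, with $G$ given by its signed adjacency matrix, the program halts with the correct answer after at most $c\cdot 8^k\,(n+k+1)^c$ steps. (The machine has registers and an indirectly addressed memory; each step, of unit cost, is an assignment of a constant, a copy, an increment or decrement by one, a load, a store, or a test of a register for zero.) (2) For every instance $(G,k)$, either $(G,k)$ is a Yes-instance, or there is a set $S\subseteq V$ with $|S|\le 3k$ such that $G-S$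 is a forest of cliques without a positive triangle, and there is $W\subseteq V\setminus S$ such that in the $W$-switch of $G$ all edges of $G-S$ are negative. -/

import Mathlib

/-- A signed graph: a simple graph whose edges are split into positive and negative ones. -/
structure SignedGraph (V : Type*) where
  pos : SimpleGraph V
  neg : SimpleGraph V
  disj : ∀ u v, pos.Adj u v → ¬ neg.Adj u v

namespace SignedGraph

/-- The underlying simple graph. -/
def graph {V : Type*} (G : SignedGraph V) : SimpleGraph V := G.pos ⊔ G.neg

/-- `H` is a subgraph of `G`, with the signs of `G`. Vertices not used by a subgraph count as
isolated vertices; this affects neither balance nor the number of edges. -/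
def IsSubgraph {V : Type*} (H G : SignedGraph V) : Prop := H.pos ≤ G.pos ∧ H.neg ≤ G.neg

/-- Balanced with respect to the partition of the vertices into `A` and its complement. -/
def IsBalancedFor {V : Type*} (G : SignedGraph V) (A : Set V) : Prop :=
  (∀ u v, G.pos.Adj u v → (u ∈ A ↔ v ∈ A)) ∧ (∀ u v, G.neg.Adj u v → ¬ (u ∈ A ↔ v ∈ A))

def IsBalanced {V : Type*} (G : SignedGraph V) : Prop := ∃ A : Set V, G.IsBalancedFor A

/-- The number of edges (used for finite vertex types only). -/
noncomputable def edgeCount {V : Type*} (G : SignedGraph V) : ℕ := G.graph.edgeSet.ncard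

/-- The Poljak–Turzík bound `m / 2 + (n - 1) / 4` of a connected graph. -/
noncomputable def ptBound {V : Type*} (G : SignedGraph V) : ℚ :=
  (G.edgeCount : ℚ) / 2 + ((Nat.card V : ℚ) - 1) / 4

/-- `(G, k)` is a yes-instance of Signed Max Cut Above Tight Lower Bound. -/
def IsYesInstance {V : Type*} (G : SignedGraph V) (k : ℕ) : Prop :=
  ∃ H : SignedGraph V, H.IsSubgraph G ∧ H.IsBalanced ∧
    G.ptBound + (k : ℚ) / 4 ≤ (H.edgeCount : ℚ)

/-- The signed subgraph induced by a vertex set. -/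
def induce {V : Type*} (G : SignedGraph V) (X : Set V) : SignedGraph X where
  pos := G.pos.induce X
  neg := G.neg.induce X
  disj u v := G.disj u v

/-- The `W`-switch: the signs of the edges between `W` and its complement are changed. -/
def switch {V : Type*} (G : SignedGraph V) (W : Set V) : SignedGraph V where
  pos :=
    { Adj := fun u v => (G.pos.Adj u v ∧ (u ∈ W ↔ v ∈ W)) ∨ (G.neg.Adj u v ∧ ¬ (u ∈ W ↔ v ∈ W))
      symm := ⟨fun u v h => by
        rcases h with ⟨h, h'⟩ | ⟨h, h'⟩
        · exact Or.inl ⟨h.symm, h'.symm⟩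
        · exact Or.inr ⟨h.symm, fun e => h' e.symm⟩⟩
      loopless := ⟨fun u h => by
        rcases h with ⟨h, _⟩ | ⟨h, _⟩
        · exact G.pos.irrefl h
        · exact G.neg.irrefl h⟩ }
  neg :=
    { Adj := fun u v => (G.neg.Adj u v ∧ (u ∈ W ↔ v ∈ W)) ∨ (G.pos.Adj u v ∧ ¬ (u ∈ W ↔ v ∈ W))
      symm := ⟨fun u v h => by
        rcases h with ⟨h, h'⟩ | ⟨h, h'⟩
        · exact Or.inl ⟨h.symm, h'.symm⟩
        · exact Or.inr ⟨h.symm, fun e => h' e.symm⟩⟩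
      loopless := ⟨fun u h => by
        rcases h with ⟨h, _⟩ | ⟨h, _⟩
        · exact G.neg.irrefl h
        · exact G.pos.irrefl h⟩ }
  disj u v h h' := by
    have := G.disj u v
    tauto

open Classical in
/-- A closed walk (in particular a cycle) is positive if it has an even number of negative
edges. -/
def IsPositiveWalk {V : Type*} (G : SignedGraph V) {v : V} (p : G.graph.Walk v v) : Prop :=
  Even (p.edges.filter (fun e => e ∈ G.neg.edgeSet)).length

/-- A positive triangle is a positive cycle with three edges. -/
def HasPositiveTriangle {V : Type*} (G : SignedGraph V) : Prop :=
  ∃ (v : V) (p : G.graph.Walk v v), p.IsCycle ∧ p.length = 3 ∧ G.IsPositiveWalk p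

open Classical in
/-- The code of a pair of vertices in the adjacency matrix: `1` for a positive edge, `2` for a
negative edge, `0` for no edge. -/
noncomputable def signCode {V : Type*} (G : SignedGraph V) (u v : V) : ℕ :=
  if G.pos.Adj u v then 1 else if G.neg.Adj u v then 2 else 0

end SignedGraph

/-- A forest of cliques: in every connected component, the vertices of every cycle induce a
clique. (A cycle lies in one component, so the components need not be mentioned.) -/
def SimpleGraph.IsForestOfCliques {V : Type*} (G : SimpleGraph V) : Prop :=
  ∀ (v : V) (p : G.Walk v v), p.IsCycle → G.IsClique {u | u ∈ p.support}

/-! A random access machine: registers, an indirectly addressed memory, and structured programs.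
The only arithmetic is adding and subtracting one, so a run of `t` steps creates no number larger
than `t` plus the largest constant and initial value, and each unit-cost step is an elementary
operation on short words. -/

namespace RAM

/-- The contents of the registers and of the memory cells. -/
structure State where
  reg : ℕ → ℕ
  mem : ℕ → ℕ

inductive Prog where
  /-- `reg i := c` -/
  | const (i c : ℕ)
  /-- `reg i := reg j` -/
  | copy (i j : ℕ)
  /-- `reg i := reg i + 1` -/
  | succ (i : ℕ)
  /-- `reg i := reg i - 1`, with `0 - 1 = 0` -/
  | pred (i : ℕ)
  /-- `reg i := mem (reg j)` -/
  | load (i j : ℕ)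
  /-- `mem (reg i) := reg j` -/
  | store (i j : ℕ)
  /-- first `p`, then `q` -/
  | seq (p q : Prog)
  /-- if `reg i ≠ 0` then `p` else `q` -/
  | ite (i : ℕ) (p q : Prog)
  /-- while `reg i ≠ 0` do `p` -/
  | loop (i : ℕ) (p : Prog)

namespace State

/-- Write `x` into register `i`. -/
def setReg (s : State) (i x : ℕ) : State := ⟨Function.update s.reg i x, s.mem⟩

/-- Write `x` into memory cell `a`. -/
def setMem (s : State) (a x : ℕ) : State := ⟨s.reg, Function.update s.mem a x⟩

end State

/-- `Exec p s s' t`: started in `s`, the program `p` halts in `s'` after exactly `t` steps. Every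
assignment and every test of a register is one step. -/
inductive Exec : Prog → State → State → ℕ → Prop
  | const (s : State) (i c : ℕ) : Exec (.const i c) s (s.setReg i c) 1
  | copy (s : State) (i j : ℕ) : Exec (.copy i j) s (s.setReg i (s.reg j)) 1
  | succ (s : State) (i : ℕ) : Exec (.succ i) s (s.setReg i (s.reg i + 1)) 1
  | pred (s : State) (i : ℕ) : Exec (.pred i) s (s.setReg i (s.reg i - 1)) 1
  | load (s : State) (i j : ℕ) : Exec (.load i j) s (s.setReg i (s.mem (s.reg j))) 1
  | store (s : State) (i j : ℕ) : Exec (.store i j) s (s.setMem (s.reg i) (s.reg j)) 1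
  | seq {p q : Prog} {s s' s'' : State} {t t' : ℕ} :
      Exec p s s' t → Exec q s' s'' t' → Exec (.seq p q) s s'' (t + t')
  | ite_true {i : ℕ} {p q : Prog} {s s' : State} {t : ℕ} :
      s.reg i ≠ 0 → Exec p s s' t → Exec (.ite i p q) s s' (t + 1)
  | ite_false {i : ℕ} {p q : Prog} {s s' : State} {t : ℕ} :
      s.reg i = 0 → Exec q s s' t → Exec (.ite i p q) s s' (t + 1)
  | loop_done {i : ℕ} {p : Prog} {s : State} : s.reg i = 0 → Exec (.loop i p) s s 1
  | loop_step {i : ℕ} {p : Prog} {s s' s'' : State} {t t' : ℕ} :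
      s.reg i ≠ 0 → Exec p s s' t → Exec (.loop i p) s' s'' t' →
        Exec (.loop i p) s s'' (t + t' + 1)

end RAM

/-- The initial state for the instance `(G, k)`: register `0` holds the number `n` of vertices,
register `1` holds `k`, the memory cell `n * i + j` holds the code of the pair `(i, j)` for
`i, j < n`, and all other registers and cells hold `0`. -/
noncomputable def SignedGraph.inputState {n : ℕ} (G : SignedGraph (Fin n)) (k : ℕ) : RAM.State where
  reg := fun r => if r = 0 then n else if r = 1 then k else 0
  mem := fun a => if h : a < n * n then
      G.signCode (Fin.divNat (⟨a, h⟩ : Fin (n * n))) (Fin.modNat (⟨a, h⟩ : Fin (n * n)))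
    else 0

/-- The program `p` decides Signed Max Cut Above Tight Lower Bound (on connected signed graphs),
on every instance `(G, k)` with `n` vertices in at most `T n k` steps. The answer, `1` for yes
and `0` for no, is left in register `0`. -/
def RAM.Prog.SolvesSignedMaxCutATLBInTime (p : RAM.Prog) (T : ℕ → ℕ → ℕ) : Prop :=
  ∀ (n k : ℕ) (G : SignedGraph (Fin n)), G.graph.Connected →
    ∃ (s : RAM.State) (t : ℕ), RAM.Exec p (G.inputState k) s t ∧ t ≤ T n k ∧
      (G.IsYesInstance k → s.reg 0 = 1) ∧ (¬ G.IsYesInstance k → s.reg 0 = 0)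

/-! Code a two-colouring by `x : V → {1, -1}`. With `s` the sign matrix, the form `quad x = ∑ s u v
* x u * x v` over ordered pairs is four times the number of satisfied edges minus `2 m`, so `(G, k)`
is a Yes-instance iff some `x` has `quad x ≥ n - 1 + k` (`isYesInstance_iff`).

Structure. A connected vertex set is shrunk to one vertex by reductions that delete a set `M` of
marked and a set `Q` of unmarked vertices, keep the rest connected and gain at least `|M| / 3` in
the excess `quad - |R|` (`Reduction.gain`). `Q` is a negative clique of even size whose only
remaining neighbour is a hub; split in half it brings exactly `|Q|`. `M` is empty, a path that does
not span a negative triangle, a vertex of odd degree, or a pair of twins in a positive triangle. One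
vertex has excess `-1`, so on a No-instance at most `3 k` vertices are marked or left. A reduction
always exists (`reducible_of_one_lt_card`): by induction, a connected part with connected complement
is a negative clique unless some reduction applies (`reducible_or_negClique`), and a set that is
itself a negative clique is easily reduced. The groups deleted unmarked are negative cliques with
their hubs and meet later groups in the hub only. Hence they form a forest of cliques, and
propagating colours from the hubs gives the switch.

Algorithm. The first phase finds the reductions by trying all choices of five vertices. If more than
`3 k` vertices are marked or left, the answer is yes. Otherwise all of their at most `2 ^ (3 k) = 8
^ k` colourings are enumerated. For each, the groups are removed in the order of their deletion, and
the best value of a group is added to a weight on its hub (`Tables.step`). In a negative clique with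
`m` vertices besides the hub, `z` satisfied spokes give `z * (m + 1 - z)` satisfied edges
(`satCount_fan`), so a knapsack over `z` finds the best value.

Machine. Expressions and array assignments are compiled to machine programs with polynomial running
time (`Exp.run_compile`, `Cmd.run_compile`). Assignments are clipped at a polynomial bound, so that
values cannot grow over exponentially many sweeps; on the values that matter, clipping has no
effect. -/

/-! ### Running times of machine programs: composition rules and basic arithmetic. -/

namespace RAM

/-- Started in `s`, the program `p` halts within `B` steps in a state that satisfies `Q`. -/
def Run (p : Prog) (s : State) (B : ℕ) (Q : State → Prop) : Prop :=
  ∃ s' t, Exec p s s' t ∧ t ≤ B ∧ Q s'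

namespace Run

variable {p q : Prog} {s : State} {B B' : ℕ} {Q Q' : State → Prop}

theorem mono (h : Run p s B Q) (hB : B ≤ B') (hQ : ∀ s', Q s' → Q' s') : Run p s B' Q' := by
  obtain ⟨s', t, h1, h2, h3⟩ := h
  exact ⟨s', t, h1, h2.trans hB, hQ _ h3⟩

theorem seq (h : Run p s B Q) (h' : ∀ s', Q s' → Run q s' B' Q') :
    Run (.seq p q) s (B + B') Q' := by
  obtain ⟨s', t, h1, h2, h3⟩ := h
  obtain ⟨s'', t', h1', h2', h3'⟩ := h' s' h3
  exact ⟨s'', t + t', .seq h1 h1', by omega, h3'⟩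

theorem const {i c : ℕ} (h : Q (s.setReg i c)) : Run (.const i c) s 1 Q :=
  ⟨_, 1, .const s i c, le_rfl, h⟩

theorem copy {i j : ℕ} (h : Q (s.setReg i (s.reg j))) : Run (.copy i j) s 1 Q :=
  ⟨_, 1, .copy s i j, le_rfl, h⟩

theorem succ {i : ℕ} (h : Q (s.setReg i (s.reg i + 1))) : Run (.succ i) s 1 Q :=
  ⟨_, 1, .succ s i, le_rfl, h⟩

theorem pred {i : ℕ} (h : Q (s.setReg i (s.reg i - 1))) : Run (.pred i) s 1 Q :=
  ⟨_, 1, .pred s i, le_rfl, h⟩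

theorem load {i j : ℕ} (h : Q (s.setReg i (s.mem (s.reg j)))) : Run (.load i j) s 1 Q :=
  ⟨_, 1, .load s i j, le_rfl, h⟩

theorem store {i j : ℕ} (h : Q (s.setMem (s.reg i) (s.reg j))) : Run (.store i j) s 1 Q :=
  ⟨_, 1, .store s i j, le_rfl, h⟩

theorem ite {i : ℕ} (h1 : s.reg i ≠ 0 → Run p s B Q) (h0 : s.reg i = 0 → Run q s B Q) :
    Run (.ite i p q) s (B + 1) Q := by
  by_cases h : s.reg i = 0
  · obtain ⟨s', t, h1, h2, h3⟩ := h0 h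
    exact ⟨s', t + 1, .ite_false h h1, by omega, h3⟩
  · obtain ⟨s', t, h1, h2, h3⟩ := h1 h
    exact ⟨s', t + 1, .ite_true h h1, by omega, h3⟩

/-- The invariant is indexed by the value of the counter register, so it also gives the number of
rounds. A round costs `B` and one test, and the last test costs one more. -/
theorem loop {i : ℕ} {I : ℕ → State → Prop} (hI : ∀ m s, I m s → s.reg i = m) {M : ℕ}
    (step : ∀ m s, m < M → I (m + 1) s → Run p s B (I m)) :
    ∀ m ≤ M, ∀ s, I m s → Run (.loop i p) s (m * (B + 1) + 1) (I 0) := by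
  intro m
  induction m with
  | zero => exact fun _ s h => ⟨s, 1, .loop_done (hI _ _ h), by omega, h⟩
  | succ m ih =>
    intro hm s h
    obtain ⟨s', t, h1, h2, h3⟩ := step m s hm h
    obtain ⟨s'', t', h1', h2', h3'⟩ := ih (by omega) s' h3
    refine ⟨s'', t + t' + 1, .loop_step ?_ h1 h1', ?_, h3'⟩
    · rw [hI _ _ h]; omega
    · rw [Nat.succ_mul]; omega

end Run

/-- A function bounded by a polynomial on the arguments `N ≥ 2`. -/
def IsPoly (f : ℕ → ℕ) : Prop := ∃ C, ∀ N, 2 ≤ N → f N ≤ N ^ C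

namespace IsPoly

variable {f g : ℕ → ℕ}

/-- Arguments below `2` are ignored in this class so that one exponent can absorb all constants and
coefficients. -/
theorem const (c : ℕ) : IsPoly fun _ => c := ⟨c, fun _ hN => (Nat.lt_pow_self hN).le⟩

theorem id : IsPoly fun N => N := ⟨1, fun N _ => by simp⟩

theorem add (hf : IsPoly f) (hg : IsPoly g) : IsPoly fun N => f N + g N := by
  obtain ⟨C, hC⟩ := hf
  obtain ⟨D, hD⟩ := hg
  refine ⟨C + D + 1, fun N hN => ?_⟩
  have h1 : N ^ C ≤ N ^ (C + D) := Nat.pow_le_pow_right (by omega) (by omega)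
  have h2 : N ^ D ≤ N ^ (C + D) := Nat.pow_le_pow_right (by omega) (by omega)
  calc f N + g N ≤ N ^ (C + D) * 2 := by linarith [hC N hN, hD N hN]
    _ ≤ N ^ (C + D + 1) := by rw [pow_succ]; gcongr

theorem mul (hf : IsPoly f) (hg : IsPoly g) : IsPoly fun N => f N * g N := by
  obtain ⟨C, hC⟩ := hf
  obtain ⟨D, hD⟩ := hg
  exact ⟨C + D, fun N hN => by rw [pow_add]; exact Nat.mul_le_mul (hC N hN) (hD N hN)⟩

theorem pow (C : ℕ) : IsPoly fun N => N ^ C := ⟨C, fun _ _ => le_rfl⟩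

end IsPoly

/-- Register `j` of the temporaries. -/
def tmp (j : ℕ) : ℕ := 2 * j + 11

/-- The register of the variable `i`. -/
def vr (i : ℕ) : ℕ := 2 * i + 10

/-- Memory and all registers except the temporaries from the `j`-th on are unchanged. -/
def Keeps (j : ℕ) (s s' : State) : Prop :=
  s'.mem = s.mem ∧ ∀ r, (r % 2 = 0 ∨ r < 2 * j + 11) → s'.reg r = s.reg r

theorem Keeps.refl (j : ℕ) (s : State) : Keeps j s s := ⟨rfl, fun _ _ => rfl⟩

theorem Keeps.trans {j : ℕ} {s s' s'' : State} (h : Keeps j s s') (h' : Keeps j s' s'') :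
    Keeps j s s'' :=
  ⟨h'.1.trans h.1, fun r hr => (h'.2 r hr).trans (h.2 r hr)⟩

theorem Keeps.mono {i j : ℕ} {s s' : State} (h : Keeps j s s') (hij : i ≤ j) : Keeps i s s' :=
  ⟨h.1, fun r hr => h.2 r (by omega)⟩

theorem Keeps.setReg {j : ℕ} {s s' : State} (h : Keeps j s s') (i x : ℕ) (hij : j ≤ i) :
    Keeps j s (s'.setReg (tmp i) x) := by
  refine ⟨h.1, fun r hr => ?_⟩
  have : r ≠ tmp i := by unfold tmp; omega
  simpa [State.setReg, Function.update_of_ne this] using h.2 r hr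

@[simp] theorem State.setReg_mem (s : State) (i x : ℕ) : (s.setReg i x).mem = s.mem := rfl
@[simp] theorem State.setReg_reg_self (s : State) (i x : ℕ) : (s.setReg i x).reg i = x := by
  simp [State.setReg]
theorem State.setReg_reg_ne (s : State) {i r : ℕ} (x : ℕ) (h : r ≠ i) :
    (s.setReg i x).reg r = s.reg r := by
  simp [State.setReg, h]

/-- Adds register `j` to register `i` and clears register `j`. -/
def addTo (i j : ℕ) : Prog := .loop j (.seq (.pred j) (.succ i))

/-- Subtracts register `j` from register `i` and clears register `j`. -/
def subFrom (i j : ℕ) : Prog := .loop j (.seq (.pred j) (.pred i))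

/-- Addition takes time proportional to the second summand; bounds on time therefore always need
bounds on values. -/
theorem run_addTo {i j : ℕ} (hij : i ≠ j) (s : State) :
    Run (addTo i j) s (s.reg j * 3 + 1)
      (fun s' => s'.mem = s.mem ∧ s'.reg i = s.reg i + s.reg j ∧ s'.reg j = 0 ∧
        ∀ r, r ≠ i → r ≠ j → s'.reg r = s.reg r) := by
  have := Run.loop (i := j) (p := .seq (.pred j) (.succ i)) (B := 2) (M := s.reg j)
    (I := fun m s' => s'.mem = s.mem ∧ s'.reg i + m = s.reg i + s.reg j ∧ s'.reg j = m ∧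
        ∀ r, r ≠ i → r ≠ j → s'.reg r = s.reg r) (fun m s' h => h.2.2.1) ?_ (s.reg j) le_rfl s ?_
  · exact this.mono le_rfl (fun s' h => by simpa using h)
  · intro m s' hm h
    refine Run.seq (B := 1) (B' := 1)
      (Run.pred (Q := fun s'' => s'' = s'.setReg j (s'.reg j - 1)) rfl) ?_
    rintro _ rfl
    refine Run.succ ⟨h.1, ?_, ?_, ?_⟩
    · have := h.2.1
      rw [State.setReg_reg_self, State.setReg_reg_ne _ _ hij]; omega
    · rw [State.setReg_reg_ne _ _ hij.symm, State.setReg_reg_self, h.2.2.1]; omega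
    · intro r h1 h2
      rw [State.setReg_reg_ne _ _ h1, State.setReg_reg_ne _ _ h2, h.2.2.2 r h1 h2]
  · exact ⟨rfl, rfl, rfl, fun _ _ _ => rfl⟩

theorem run_subFrom {i j : ℕ} (hij : i ≠ j) (s : State) :
    Run (subFrom i j) s (s.reg j * 3 + 1)
      (fun s' => s'.mem = s.mem ∧ s'.reg i = s.reg i - s.reg j ∧ s'.reg j = 0 ∧
        ∀ r, r ≠ i → r ≠ j → s'.reg r = s.reg r) := by
  have := Run.loop (i := j) (p := .seq (.pred j) (.pred i)) (B := 2) (M := s.reg j)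
    (I := fun m s' => s'.mem = s.mem ∧ s'.reg i - m = s.reg i - s.reg j ∧ s'.reg j = m ∧
        ∀ r, r ≠ i → r ≠ j → s'.reg r = s.reg r) (fun m s' h => h.2.2.1) ?_ (s.reg j) le_rfl s ?_
  · exact this.mono le_rfl (fun s' h => by simpa using h)
  · intro m s' hm h
    refine Run.seq (B := 1) (B' := 1)
      (Run.pred (Q := fun s'' => s'' = s'.setReg j (s'.reg j - 1)) rfl) ?_
    rintro _ rfl
    refine Run.pred ⟨h.1, ?_, ?_, ?_⟩
    · have := h.2.1
      rw [State.setReg_reg_self, State.setReg_reg_ne _ _ hij]; omega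
    · rw [State.setReg_reg_ne _ _ hij.symm, State.setReg_reg_self, h.2.2.1]; omega
    · intro r h1 h2
      rw [State.setReg_reg_ne _ _ h1, State.setReg_reg_ne _ _ h2, h.2.2.2 r h1 h2]
  · exact ⟨rfl, rfl, rfl, fun _ _ _ => rfl⟩

/-- Replaces the temporary `j` by `n` times itself plus register `v`. -/
def mulAdd (j v : ℕ) : Prog :=
  .seq (.copy (tmp (j + 1)) v) (.seq
    (.loop (tmp j) (.seq (.pred (tmp j))
      (.seq (.copy (tmp (j + 2)) 0) (addTo (tmp (j + 1)) (tmp (j + 2))))))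
    (.copy (tmp j) (tmp (j + 1))))

/-- Two such Horner steps turn a block number and two indices into an address. The product is a
repeated addition of register `0`, which holds `n`. -/
theorem run_mulAdd {j v : ℕ} (s : State) :
    Run (mulAdd j v) s (s.reg (tmp j) * (s.reg 0 * 3 + 4) + 3)
      (fun s' => Keeps j s s' ∧ s'.reg (tmp j) = s.reg (tmp j) * s.reg 0 + s.reg v) := by
  refine Run.mono (Run.seq (B := 1) (B' := s.reg (tmp j) * (s.reg 0 * 3 + 4) + 2)
    (Run.copy (Q := fun s' => s' = s.setReg (tmp (j + 1)) (s.reg v)) rfl) ?_) (by omega)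
    (fun _ h => h)
  rintro _ rfl
  set s₁ := s.setReg (tmp (j + 1)) (s.reg v)
  have t01 : tmp j ≠ tmp (j + 1) := by unfold tmp; omega
  have t02 : tmp j ≠ tmp (j + 2) := by unfold tmp; omega
  have t12 : tmp (j + 1) ≠ tmp (j + 2) := by unfold tmp; omega
  have e0 : s₁.reg (tmp j) = s.reg (tmp j) := State.setReg_reg_ne _ _ t01
  have k0 : Keeps j s s₁ := (Keeps.refl j s).setReg _ _ (by omega)
  have key := Run.loop (i := tmp j) (p := .seq (.pred (tmp j))
      (.seq (.copy (tmp (j + 2)) 0) (addTo (tmp (j + 1)) (tmp (j + 2))))) (B := s.reg 0 * 3 + 3)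
      (M := s.reg (tmp j))
    (I := fun m s' => Keeps j s s' ∧ s'.reg (tmp j) = m ∧
      s'.reg (tmp (j + 1)) + m * s.reg 0 = s.reg (tmp j) * s.reg 0 + s.reg v)
      (fun m s' h => h.2.1) ?_ (s.reg (tmp j)) le_rfl s₁ ?_
  · refine Run.mono (Run.seq key (Q' := fun s' => Keeps j s s' ∧
        s'.reg (tmp j) = s.reg (tmp j) * s.reg 0 + s.reg v)
      (fun s' h => Run.copy (Q := _) ?_)) (le_of_eq (by ring)) (fun _ h => h)
    refine ⟨h.1.setReg _ _ le_rfl, ?_⟩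
    rw [State.setReg_reg_self]
    simpa using h.2.2
  · intro m s' hm h
    refine Run.mono (Run.seq (Run.pred (Q := fun s'' => s'' = s'.setReg (tmp j) (s'.reg (tmp j) - 1))
      rfl) ?_ (B' := s.reg 0 * 3 + 2)) (by omega) (fun _ h => h)
    rintro _ rfl
    refine Run.mono (Run.seq (Run.copy (Q := fun s'' => s'' =
      (s'.setReg (tmp j) (s'.reg (tmp j) - 1)).setReg (tmp (j + 2)) (s.reg 0)) ?_) ?_
      (B' := s.reg 0 * 3 + 1)) (by omega) (fun _ h => h)
    · congr 1
      rw [State.setReg_reg_ne _ _ (by unfold tmp; omega)]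
      exact h.1.2 0 (by omega)
    rintro _ rfl
    refine (run_addTo t12 _).mono (by simp) ?_
    rintro s'' ⟨hm, h1, h2, h3⟩
    have kk : Keeps j s ((s'.setReg (tmp j) (s'.reg (tmp j) - 1)).setReg (tmp (j + 2)) (s.reg 0)) :=
      (h.1.setReg _ _ le_rfl).setReg _ _ (by omega)
    refine ⟨⟨hm.trans kk.1, fun r hr => ?_⟩, ?_, ?_⟩
    · rw [h3 r (by unfold tmp; omega) (by unfold tmp; omega), kk.2 r hr]
    · rw [h3 _ t01 t02, State.setReg_reg_ne _ _ t02, State.setReg_reg_self, h.2.1]; omega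
    · rw [h1, State.setReg_reg_ne _ _ t12, State.setReg_reg_ne _ _ t01.symm,
        State.setReg_reg_self]
      have := h.2.2
      rw [← this]; ring
  · refine ⟨k0, e0, ?_⟩
    rw [State.setReg_reg_self]; ring

end RAM

/-! ### Compiling arithmetic expressions over arrays. -/

namespace RAM

/-- Expressions over two-dimensional arrays of side `n`. Variables are numbered by binding depth;
`sum` and `sup` bind the next variable, which ranges over `Fin n`. -/
inductive Exp where
  | const (c : ℕ)
  | var (i : ℕ)
  | par
  | rd (a i j : ℕ)
  | add (e f : Exp)
  | sub (e f : Exp)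
  | ite (e f g : Exp)
  | sum (e : Exp)
  | sup (e : Exp)

/-- The contents of the arrays. -/
abbrev Arr (n : ℕ) := ℕ → Fin n → Fin n → ℕ

namespace Exp

/-- The value of an expression in which the variables below `d` are bound. -/
def eval {n : ℕ} (k : ℕ) (σ : Arr n) : Exp → ℕ → (ℕ → Fin n) → ℕ
  | const c, _, _ => c
  | var i, _, ρ => ρ i
  | par, _, _ => k
  | rd a i j, _, ρ => σ a (ρ i) (ρ j)
  | add e f, d, ρ => eval k σ e d ρ + eval k σ f d ρ
  | sub e f, d, ρ => eval k σ e d ρ - eval k σ f d ρ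
  | ite e f g, d, ρ => if eval k σ e d ρ ≠ 0 then eval k σ f d ρ else eval k σ g d ρ
  | sum e, d, ρ => ∑ x, eval k σ e (d + 1) (Function.update ρ d x)
  | sup e, d, ρ => Finset.univ.sup fun x => eval k σ e (d + 1) (Function.update ρ d x)

end Exp

/-- The memory block of an array; block `1` is scratch space. -/
def blk (a : ℕ) : ℕ := if a = 0 then 0 else a + 1

/-- Computes the address of an entry of block `b` into the temporary `j`. -/
def addr (b i i' j : ℕ) : Prog :=
  .seq (.const (tmp j) b) (.seq (mulAdd j (vr i)) (mulAdd j (vr i')))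

/-- Sets the temporary `j` to its maximum with the temporary `j + 1`. -/
def maxTmp (j : ℕ) : Prog :=
  .seq (.copy (tmp (j + 2)) (tmp j)) (.seq (subFrom (tmp (j + 1)) (tmp (j + 2)))
    (addTo (tmp j) (tmp (j + 1))))

/-- Runs `p` with the variable `d` equal to `n - 1, …, 0`. -/
def forVar (d : ℕ) (p : Prog) : Prog :=
  .seq (.copy (vr d) 0) (.loop (vr d) (.seq (.pred (vr d)) p))

/-- The program that computes an expression into the temporary `j`. -/
def Exp.compile : Exp → ℕ → ℕ → Prog
  | const c, _, j => .const (tmp j) c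
  | var i, _, j => .copy (tmp j) (vr i)
  | par, _, j => .copy (tmp j) 1
  | rd a i i', _, j => .seq (addr (blk a) i i' j) (.load (tmp j) (tmp j))
  | add e f, d, j =>
    .seq (compile e d j) (.seq (compile f d (j + 1)) (addTo (tmp j) (tmp (j + 1))))
  | sub e f, d, j =>
    .seq (compile e d j) (.seq (compile f d (j + 1)) (subFrom (tmp j) (tmp (j + 1))))
  | ite e f g, d, j => .seq (compile e d j) (.ite (tmp j) (compile f d j) (compile g d j))
  | sum e, d, j => .seq (.const (tmp j) 0)
      (forVar d (.seq (compile e (d + 1) (j + 1)) (addTo (tmp j) (tmp (j + 1)))))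
  | sup e, d, j => .seq (.const (tmp j) 0)
      (forVar d (.seq (compile e (d + 1) (j + 1)) (maxTmp j)))

/-- The state `s` represents the arrays `σ` and the variables `ρ`. -/
structure Rep {n : ℕ} (k cap : ℕ) (σ : Arr n) (ρ : ℕ → Fin n) (s : State) : Prop where
  reg0 : s.reg 0 = n
  reg1 : s.reg 1 = k
  reg2 : s.reg 2 = cap
  mem : ∀ a (x y : Fin n), s.mem ((blk a * n + (x : ℕ)) * n + (y : ℕ)) = σ a x y
  vars : ∀ i, s.reg (vr i) = ρ i

theorem Rep.keeps {n k cap j : ℕ} {σ : Arr n} {ρ : ℕ → Fin n} {s s' : State}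
    (h : Rep k cap σ ρ s) (h' : Keeps j s s') : Rep k cap σ ρ s' where
  reg0 := (h'.2 0 (by omega)).trans h.reg0
  reg1 := (h'.2 1 (by omega)).trans h.reg1
  reg2 := (h'.2 2 (by omega)).trans h.reg2
  mem a x y := by rw [h'.1]; exact h.mem a x y
  vars i := (h'.2 _ (by unfold vr; omega)).trans (h.vars i)

theorem run_addr {n k cap : ℕ} {σ : Arr n} {ρ : ℕ → Fin n} {s : State} (h : Rep k cap σ ρ s)
    (b i i' j : ℕ) : Run (addr b i i' j) s ((b * n + n + b) * (n * 3 + 4) + 7)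
      (fun s' => Keeps j s s' ∧ s'.reg (tmp j) = (b * n + (ρ i : ℕ)) * n + (ρ i' : ℕ)) := by
  refine Run.mono (Run.seq (Run.const (Q := fun s' => s' = s.setReg (tmp j) b) rfl)
    (B' := (b * n + n + b) * (n * 3 + 4) + 6) ?_) (by omega) (fun _ h => h)
  rintro _ rfl
  have k1 : Keeps j s (s.setReg (tmp j) b) := (Keeps.refl j s).setReg _ _ le_rfl
  have r1 := h.keeps k1
  have m1 := run_mulAdd (j := j) (v := vr i) (s.setReg (tmp j) b)
  rw [State.setReg_reg_self, r1.reg0, r1.vars] at m1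
  refine Run.mono (Run.seq m1 (B' := (b * n + n) * (n * 3 + 4) + 3) ?_) ?_ (fun _ h => h)
  · rintro s' ⟨k2, e2⟩
    have r2 := r1.keeps k2
    have m2 := run_mulAdd (j := j) (v := vr i') s'
    rw [e2, r2.reg0, r2.vars] at m2
    refine m2.mono ?_ fun s'' h'' => ⟨(k1.trans k2).trans h''.1, h''.2⟩
    have := (ρ i).isLt
    gcongr
  · nlinarith [Nat.zero_le (n * 3 + 4)]

/-- Loops count down, so the elements already treated form a set `{x | m ≤ x}`, and one round adds
`m` to it. -/
theorem filter_le_eq_insert {n m : ℕ} (hm : m < n) :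
    (Finset.univ.filter fun x : Fin n => m ≤ x) =
      insert ⟨m, hm⟩ (Finset.univ.filter fun x : Fin n => m + 1 ≤ x) := by
  ext x
  simp only [Finset.mem_filter, Finset.mem_univ, true_and, Finset.mem_insert, Fin.ext_iff]
  omega

theorem filter_le_zero {n : ℕ} :
    (Finset.univ.filter fun x : Fin n => 0 ≤ (x : ℕ)) = Finset.univ := by
  simp

theorem filter_le_self {n : ℕ} : (Finset.univ.filter fun x : Fin n => n ≤ (x : ℕ)) = ∅ := by
  ext x; simp

/-- Accumulating loops over a variable. -/
theorem run_forVar_acc {n : ℕ} [NeZero n] {k cap d j B : ℕ} {σ : Arr n} {ρ : ℕ → Fin n}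
    {s : State} {p : Prog} (h : Rep k cap σ ρ s) (hd : ρ d = 0) (acc : ℕ → ℕ)
    (h0 : s.reg (tmp j) = acc n)
    (step : ∀ (x : Fin n) s', Rep k cap σ (Function.update ρ d x) s' →
      s'.reg (tmp j) = acc (x + 1) →
      Run p s' B (fun s'' => Keeps j s' s'' ∧ s''.reg (tmp j) = acc x)) :
    Run (forVar d p) s (n * (B + 2) + 2)
      (fun s' => Keeps j s s' ∧ s'.reg (tmp j) = acc 0) := by
  have hdj : tmp j ≠ vr d := by unfold tmp vr; omega
  have vinj : ∀ i, i ≠ d → vr i ≠ vr d := by intro i; unfold vr; omega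
  set s₁ := s.setReg (vr d) n
  -- The register of the loop variable is exempt from the frame condition while the loop runs.
  let J (s' : State) : Prop := s'.mem = s.mem ∧
    ∀ r, r ≠ vr d → (r % 2 = 0 ∨ r < 2 * j + 11) → s'.reg r = s.reg r
  have hJ1 : ∀ s' x, J s' → J (s'.setReg (vr d) x) := by
    intro s' x hs
    refine ⟨hs.1, fun r hr hr' => ?_⟩
    rw [State.setReg_reg_ne _ _ hr, hs.2 r hr hr']
  have hvr0 : ∀ r < 10, r ≠ vr d := by intro r hr; unfold vr; omega
  have hJrep : ∀ s' (x : Fin n), J s' → Rep k cap σ (Function.update ρ d x)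
      (s'.setReg (vr d) x) := by
    intro s' x hs
    have hs' := hJ1 s' x hs
    refine ⟨?_, ?_, ?_, ?_, ?_⟩
    · rw [hs'.2 0 (hvr0 0 (by omega)) (by omega), h.reg0]
    · rw [hs'.2 1 (hvr0 1 (by omega)) (by omega), h.reg1]
    · rw [hs'.2 2 (hvr0 2 (by omega)) (by omega), h.reg2]
    · intro a u v; rw [hs'.1, h.mem]
    · intro i
      by_cases hi : i = d
      · subst hi; simp
      · rw [Function.update_of_ne hi, hs'.2 _ (vinj i hi) (by unfold vr; omega), h.vars]
  have key := Run.loop (i := vr d) (p := .seq (.pred (vr d)) p) (B := B + 1) (M := n)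
    (I := fun m s' => J s' ∧ s'.reg (vr d) = m ∧ s'.reg (tmp j) = acc m)
    (fun m s' h => h.2.1) ?_ n le_rfl s₁ ?_
  · refine Run.mono (Run.seq (Run.copy (Q := fun s' => s' = s₁) ?_) (B' := n * (B + 2) + 1)
      ?_) (by omega) (fun _ h => h)
    · rw [h.reg0]
    rintro _ rfl
    refine key.mono le_rfl ?_
    rintro s' ⟨hs, hv, ha⟩
    refine ⟨⟨hs.1, fun r hr => ?_⟩, ha⟩
    by_cases hrd : r = vr d
    -- The loop ends with its variable at `0`, the value of every unbound variable, so `ρ` is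
    -- restored.
    · subst hrd; rw [hv, h.vars, hd]; simp
    · exact hs.2 r hrd hr
  · rintro m s' hm ⟨hs, hv, ha⟩
    refine Run.mono (Run.seq (Run.pred (Q := fun s'' => s'' = s'.setReg (vr d) m) ?_) ?_ (B' := B))
      (by omega) (fun _ h => h)
    · rw [hv]; rfl
    rintro _ rfl
    refine (step ⟨m, hm⟩ _ (hJrep s' ⟨m, hm⟩ hs) ?_).mono le_rfl ?_
    · rw [State.setReg_reg_ne _ _ hdj, ha]
    · rintro s'' ⟨k2, e2⟩
      have hs2 := hJ1 s' m hs
      refine ⟨⟨k2.1.trans hs2.1, fun r hr hr' => (k2.2 r hr').trans (hs2.2 r hr hr')⟩, ?_, e2⟩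
      rw [k2.2 _ (by unfold vr; omega), State.setReg_reg_self]
  · refine ⟨hJ1 s n ⟨rfl, fun _ _ _ => rfl⟩, by simp [s₁], ?_⟩
    rw [State.setReg_reg_ne _ _ hdj, h0]

/-- With truncated subtraction, `max a b = a + (b - a)`. -/
theorem run_maxTmp (j : ℕ) (s : State) :
    Run (maxTmp j) s (s.reg (tmp j) * 3 + s.reg (tmp (j + 1)) * 3 + 3)
      (fun s' => Keeps j s s' ∧ s'.reg (tmp j) = max (s.reg (tmp j)) (s.reg (tmp (j + 1)))) := by
  have t01 : tmp j ≠ tmp (j + 1) := by unfold tmp; omega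
  have t02 : tmp j ≠ tmp (j + 2) := by unfold tmp; omega
  have t12 : tmp (j + 1) ≠ tmp (j + 2) := by unfold tmp; omega
  refine Run.mono (Run.seq (Run.copy (Q := fun s' => s' = s.setReg (tmp (j + 2)) (s.reg (tmp j))) rfl)
    (B' := s.reg (tmp j) * 3 + s.reg (tmp (j + 1)) * 3 + 2) ?_) (by omega) (fun _ h => h)
  rintro _ rfl
  have m1 := run_subFrom t12 (s.setReg (tmp (j + 2)) (s.reg (tmp j)))
  rw [State.setReg_reg_self] at m1
  refine Run.mono (Run.seq m1 (B' := s.reg (tmp (j + 1)) * 3 + 1) ?_) (by omega) (fun _ h => h)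
  rintro s' ⟨hm, h1, h2, h3⟩
  rw [State.setReg_reg_ne _ _ t12] at h1
  have e0 : s'.reg (tmp j) = s.reg (tmp j) := by
    rw [h3 _ t01 t02, State.setReg_reg_ne _ _ t02]
  refine (run_addTo t01 s').mono (by rw [h1]; omega) ?_
  rintro s'' ⟨hm', h1', h2', h3'⟩
  refine ⟨⟨hm'.trans hm, fun r hr => ?_⟩, ?_⟩
  · have a0 : r ≠ tmp j := by unfold tmp; omega
    have a1 : r ≠ tmp (j + 1) := by unfold tmp; omega
    have a2 : r ≠ tmp (j + 2) := by unfold tmp; omega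
    rw [h3' r a0 a1, h3 r a1 a2, State.setReg_reg_ne _ _ a2]
  · rw [h1', e0, h1]; omega

/-- An expression is computed in polynomial time. -/
theorem Exp.run_compile (e : Exp) : ∃ C, ∀ (n : ℕ) [NeZero n] (k cap : ℕ) (σ : Arr n)
    (_ : ∀ a x y, σ a x y ≤ (n + k + 1) ^ 5) (d : ℕ) (ρ : ℕ → Fin n) (_ : ∀ i, d ≤ i → ρ i = 0)
    (j : ℕ) (s : State) (_ : Rep k cap σ ρ s),
    e.eval k σ d ρ ≤ (n + k + 1) ^ C ∧
    Run (e.compile d j) s ((n + k + 1) ^ C)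
      (fun s' => Keeps j s s' ∧ s'.reg (tmp j) = e.eval k σ d ρ) := by
  have two : ∀ n k : ℕ, [NeZero n] → 2 ≤ n + k + 1 := by
    intro n k _
    have := NeZero.pos n
    omega
  have t01 : ∀ j, tmp j ≠ tmp (j + 1) := by intro j; unfold tmp; omega
  -- Value and time are bounded in one induction because the time of an addition depends on the
  -- value added.
  induction e with
  | const c =>
    refine ⟨c, fun n _ k cap σ hσ d ρ hρ j s hs => ?_⟩
    have := (Nat.lt_pow_self (n := c) (two n k))
    exact ⟨this.le, (Run.const ⟨(Keeps.refl _ _).setReg _ _ le_rfl, by simp [eval]⟩).mono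
      (by omega) (fun _ h => h)⟩
  | var i =>
    refine ⟨1, fun n _ k cap σ hσ d ρ hρ j s hs => ?_⟩
    have := (ρ i).isLt
    have := two n k
    rw [pow_one]
    refine ⟨by rw [eval]; omega, (Run.copy ⟨(Keeps.refl _ _).setReg _ _ le_rfl, ?_⟩).mono
      (by omega) (fun _ h => h)⟩
    rw [State.setReg_reg_self, hs.vars, eval]
  | par =>
    refine ⟨1, fun n _ k cap σ hσ d ρ hρ j s hs => ?_⟩
    have := two n k
    rw [pow_one]
    refine ⟨by rw [eval]; omega, (Run.copy ⟨(Keeps.refl _ _).setReg _ _ le_rfl, ?_⟩).mono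
      (by omega) (fun _ h => h)⟩
    rw [State.setReg_reg_self, hs.reg1, eval]
  | rd a i i' =>
    obtain ⟨C, hC⟩ : IsPoly fun N => ((blk a * N + N + blk a) * (N * 3 + 4) + 8) + N ^ 5 :=
      ((((((IsPoly.const _).mul .id).add .id).add (.const _)).mul
        ((IsPoly.id.mul (.const 3)).add (.const 4))).add (.const 8)).add (.pow 5)
    refine ⟨C, fun n _ k cap σ hσ d ρ hρ j s hs => ?_⟩
    have hC := hC _ (two n k)
    beta_reduce at hC
    have hn : n ≤ n + k + 1 := by omega
    have : (blk a * n + n + blk a) * (n * 3 + 4) ≤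
      (blk a * (n + k + 1) + (n + k + 1) + blk a) * ((n + k + 1) * 3 + 4) := by gcongr
    refine ⟨(hσ _ _ _).trans (by omega), ?_⟩
    refine Run.mono (Run.seq (run_addr hs (blk a) i i' j) fun s' h => Run.load (Q := _) ?_)
      (by omega) fun _ h => h
    refine ⟨h.1.setReg _ _ le_rfl, ?_⟩
    rw [State.setReg_reg_self, h.1.1, h.2, hs.mem, eval]
  | add e f ihe ihf =>
    obtain ⟨C, hC⟩ := ihe
    obtain ⟨D, hD⟩ := ihf
    obtain ⟨E, hE⟩ : IsPoly fun N => N ^ C + N ^ D + (N ^ D * 3 + 1) :=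
      ((IsPoly.pow C).add (.pow D)).add (((IsPoly.pow D).mul (.const 3)).add (.const 1))
    refine ⟨E, fun n _ k cap σ hσ d ρ hρ j s hs => ?_⟩
    have hE := hE _ (two n k)
    beta_reduce at hE
    have h1 := hC n k cap σ hσ d ρ hρ j s hs
    have h2 := hD n k cap σ hσ d ρ hρ (j + 1) s hs
    refine ⟨by rw [eval]; omega, ?_⟩
    refine Run.mono (Run.seq h1.2 (B' := (n + k + 1) ^ D + ((n + k + 1) ^ D * 3 + 1)) ?_)
      (by omega) fun _ h => h
    rintro s₁ ⟨k1, e1⟩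
    refine Run.seq (hD n k cap σ hσ d ρ hρ (j + 1) s₁ (hs.keeps k1)).2 ?_
    rintro s₂ ⟨k2, e2⟩
    refine (run_addTo (t01 j) s₂).mono (by rw [e2]; omega) ?_
    rintro s₃ ⟨m3, a3, -, r3⟩
    refine ⟨⟨m3.trans (k2.1.trans k1.1), fun r hr => ?_⟩, ?_⟩
    · rw [r3 r (by unfold tmp; omega) (by unfold tmp; omega), k2.2 r (by omega), k1.2 r hr]
    · rw [a3, e2, k2.2 _ (by unfold tmp; omega), e1, eval]
  | sub e f ihe ihf =>
    obtain ⟨C, hC⟩ := ihe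
    obtain ⟨D, hD⟩ := ihf
    obtain ⟨E, hE⟩ : IsPoly fun N => N ^ C + N ^ D + (N ^ D * 3 + 1) :=
      ((IsPoly.pow C).add (.pow D)).add (((IsPoly.pow D).mul (.const 3)).add (.const 1))
    refine ⟨E, fun n _ k cap σ hσ d ρ hρ j s hs => ?_⟩
    have hE := hE _ (two n k)
    beta_reduce at hE
    have h1 := hC n k cap σ hσ d ρ hρ j s hs
    have h2 := hD n k cap σ hσ d ρ hρ (j + 1) s hs
    refine ⟨by rw [eval]; omega, ?_⟩
    refine Run.mono (Run.seq h1.2 (B' := (n + k + 1) ^ D + ((n + k + 1) ^ D * 3 + 1)) ?_)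
      (by omega) fun _ h => h
    rintro s₁ ⟨k1, e1⟩
    refine Run.seq (hD n k cap σ hσ d ρ hρ (j + 1) s₁ (hs.keeps k1)).2 ?_
    rintro s₂ ⟨k2, e2⟩
    refine (run_subFrom (t01 j) s₂).mono (by rw [e2]; omega) ?_
    rintro s₃ ⟨m3, a3, -, r3⟩
    refine ⟨⟨m3.trans (k2.1.trans k1.1), fun r hr => ?_⟩, ?_⟩
    · rw [r3 r (by unfold tmp; omega) (by unfold tmp; omega), k2.2 r (by omega), k1.2 r hr]
    · rw [a3, e2, k2.2 _ (by unfold tmp; omega), e1, eval]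
  | ite e f g ihe ihf ihg =>
    obtain ⟨C, hC⟩ := ihe
    obtain ⟨D, hD⟩ := ihf
    obtain ⟨E, hE⟩ := ihg
    obtain ⟨F, hF⟩ : IsPoly fun N => N ^ C + N ^ D + N ^ E + 1 :=
      (((IsPoly.pow C).add (.pow D)).add (.pow E)).add (.const 1)
    refine ⟨F, fun n _ k cap σ hσ d ρ hρ j s hs => ?_⟩
    have hF := hF _ (two n k)
    beta_reduce at hF
    have h1 := hC n k cap σ hσ d ρ hρ j s hs
    have h2 := hD n k cap σ hσ d ρ hρ j s hs
    have h3 := hE n k cap σ hσ d ρ hρ j s hs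
    refine ⟨by rw [eval]; split_ifs <;> omega, ?_⟩
    refine Run.mono (Run.seq h1.2 (B' := (n + k + 1) ^ D + (n + k + 1) ^ E + 1) ?_)
      (by omega) fun _ h => h
    rintro s₁ ⟨k1, e1⟩
    refine Run.ite (fun h0 => ?_) (fun h0 => ?_)
    · refine (hD n k cap σ hσ d ρ hρ j s₁ (hs.keeps k1)).2.mono (by omega) ?_
      rintro s₂ ⟨k2, e2⟩
      rw [e1] at h0
      exact ⟨k1.trans k2, by rw [e2, eval, if_pos h0]⟩
    · refine (hE n k cap σ hσ d ρ hρ j s₁ (hs.keeps k1)).2.mono (by omega) ?_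
      rintro s₂ ⟨k2, e2⟩
      rw [e1] at h0
      exact ⟨k1.trans k2, by rw [e2, eval, if_neg (by simpa using h0)]⟩
  | sum e ihe =>
    obtain ⟨C, hC⟩ := ihe
    obtain ⟨E, hE⟩ : IsPoly fun N => N * (N ^ C + (N ^ C * 3 + 1) + 2) + 3 :=
      (IsPoly.id.mul (((IsPoly.pow C).add (((IsPoly.pow C).mul (.const 3)).add (.const 1))).add
        (.const 2))).add (.const 3)
    refine ⟨E, fun n _ k cap σ hσ d ρ hρ j s hs => ?_⟩
    have hE := hE _ (two n k)
    beta_reduce at hE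
    set N := n + k + 1 with hN
    set f : Fin n → ℕ := fun x => e.eval k σ (d + 1) (Function.update ρ d x) with hf
    have hup : ∀ (x : Fin n) i, d + 1 ≤ i → Function.update ρ d x i = 0 := fun x i hi => by
      rw [Function.update_of_ne (by omega)]; exact hρ i (by omega)
    have hnN : n * (N ^ C + (N ^ C * 3 + 1) + 2) ≤ N * (N ^ C + (N ^ C * 3 + 1) + 2) := by
      gcongr; omega
    have run : Run ((Exp.sum e).compile d j) s (N ^ E) (fun s' => (Keeps j s s' ∧
        s'.reg (tmp j) = ∑ x ∈ Finset.univ.filter (fun x : Fin n => 0 ≤ (x : ℕ)), f x) ∧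
          ∀ x, f x ≤ N ^ C) := by
      rw [Exp.compile]
      refine Run.mono (Run.seq (Run.const (Q := fun s' => s' = s.setReg (tmp j) 0) rfl)
        (B' := n * (N ^ C + (N ^ C * 3 + 1) + 2) + 2) ?_) (by omega) fun _ h => h
      rintro _ rfl
      have k0 : Keeps j s (s.setReg (tmp j) 0) := (Keeps.refl _ _).setReg _ _ le_rfl
      -- The induction hypothesis bounds values only in environments represented by a state; writing
      -- `x` into the variable register provides such a state.
      have hfx : ∀ x, f x ≤ N ^ C := fun x => by
        have hs' : Rep k cap σ (Function.update ρ d x) (s.setReg (vr d) x) := by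
          refine ⟨?_, ?_, ?_, hs.mem, fun i => ?_⟩
          · rw [State.setReg_reg_ne _ _ (by unfold vr; omega), hs.reg0]
          · rw [State.setReg_reg_ne _ _ (by unfold vr; omega), hs.reg1]
          · rw [State.setReg_reg_ne _ _ (by unfold vr; omega), hs.reg2]
          · by_cases hi : i = d
            · subst hi; simp
            · rw [Function.update_of_ne hi, State.setReg_reg_ne _ _ (by unfold vr; omega), hs.vars]
        exact (hC n k cap σ hσ (d + 1) _ (hup x) j _ hs').1
      refine (run_forVar_acc (hs.keeps k0) (hρ d le_rfl)
        (fun m => ∑ x ∈ Finset.univ.filter (fun x : Fin n => m ≤ (x : ℕ)), f x) ?_ ?_).mono le_rfl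
        fun s' h => ⟨⟨k0.trans h.1, h.2⟩, hfx⟩
      · simp [filter_le_self]
      · intro x s₁ hs₁ e₁
        have h1 := hC n k cap σ hσ (d + 1) _ (hup x) (j + 1) s₁ hs₁
        refine Run.seq h1.2 ?_
        rintro s₂ ⟨k2, e2⟩
        have hb := hfx x
        simp only [hf] at hb
        refine (run_addTo (t01 j) s₂).mono (by rw [e2]; omega) ?_
        rintro s₃ ⟨m3, a3, -, r3⟩
        refine ⟨⟨m3.trans k2.1, fun r hr => ?_⟩, ?_⟩
        · rw [r3 r (by unfold tmp; omega) (by unfold tmp; omega), k2.2 r (by omega)]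
        · rw [a3, e2, k2.2 _ (by unfold tmp; omega), e₁, filter_le_eq_insert x.isLt,
            Finset.sum_insert (by simp), add_comm]
    have hb := run
    obtain ⟨_, _, _, _, _, hb⟩ := hb
    refine ⟨?_, run.mono le_rfl fun s' h => ⟨h.1.1, by rw [h.1.2, filter_le_zero, eval]⟩⟩
    rw [eval]
    calc ∑ x, f x ≤ ∑ x : Fin n, N ^ C := Finset.sum_le_sum fun x _ => hb x
      _ = n * N ^ C := by simp
      _ ≤ N * (N ^ C + (N ^ C * 3 + 1) + 2) + 3 := by
        refine le_trans ?_ (Nat.le_add_right _ _)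
        refine Nat.mul_le_mul (by omega) (by omega)
      _ ≤ _ := hE
  | sup e ihe =>
    obtain ⟨C, hC⟩ := ihe
    obtain ⟨E, hE⟩ : IsPoly fun N => N * (N ^ C + (N ^ C * 3 + N ^ C * 3 + 3) + 2) + 3 :=
      (IsPoly.id.mul (((IsPoly.pow C).add ((((IsPoly.pow C).mul (.const 3)).add
        ((IsPoly.pow C).mul (.const 3))).add (.const 3))).add (.const 2))).add (.const 3)
    refine ⟨E, fun n _ k cap σ hσ d ρ hρ j s hs => ?_⟩
    have hE := hE _ (two n k)
    beta_reduce at hE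
    set N := n + k + 1 with hN
    set f : Fin n → ℕ := fun x => e.eval k σ (d + 1) (Function.update ρ d x) with hf
    have hup : ∀ (x : Fin n) i, d + 1 ≤ i → Function.update ρ d x i = 0 := fun x i hi => by
      rw [Function.update_of_ne (by omega)]; exact hρ i (by omega)
    have hfx : ∀ x, f x ≤ N ^ C := fun x => by
      have hs' : Rep k cap σ (Function.update ρ d x) (s.setReg (vr d) x) := by
        refine ⟨?_, ?_, ?_, hs.mem, fun i => ?_⟩
        · rw [State.setReg_reg_ne _ _ (by unfold vr; omega), hs.reg0]
        · rw [State.setReg_reg_ne _ _ (by unfold vr; omega), hs.reg1]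
        · rw [State.setReg_reg_ne _ _ (by unfold vr; omega), hs.reg2]
        · by_cases hi : i = d
          · subst hi; simp
          · rw [Function.update_of_ne hi, State.setReg_reg_ne _ _ (by unfold vr; omega), hs.vars]
      exact (hC n k cap σ hσ (d + 1) _ (hup x) j _ hs').1
    have hsup : ∀ t : Finset (Fin n), t.sup f ≤ N ^ C := fun t => Finset.sup_le fun x _ => hfx x
    have hnN : n * (N ^ C + (N ^ C * 3 + N ^ C * 3 + 3) + 2) ≤
        N * (N ^ C + (N ^ C * 3 + N ^ C * 3 + 3) + 2) := by
      gcongr; omega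
    have hN1 : N ^ C ≤ N * (N ^ C + (N ^ C * 3 + N ^ C * 3 + 3) + 2) := by
      calc N ^ C = 1 * N ^ C := by ring
        _ ≤ _ := Nat.mul_le_mul (by omega) (by omega)
    refine ⟨(hsup _).trans (by omega), ?_⟩
    rw [Exp.compile]
    refine Run.mono (Run.seq (Run.const (Q := fun s' => s' = s.setReg (tmp j) 0) rfl)
      (B' := n * (N ^ C + (N ^ C * 3 + N ^ C * 3 + 3) + 2) + 2) ?_) (by omega) fun _ h => h
    rintro _ rfl
    have k0 : Keeps j s (s.setReg (tmp j) 0) := (Keeps.refl _ _).setReg _ _ le_rfl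
    refine (run_forVar_acc (hs.keeps k0) (hρ d le_rfl)
      (fun m => (Finset.univ.filter (fun x : Fin n => m ≤ (x : ℕ))).sup f) ?_ ?_).mono le_rfl
      fun s' h => ⟨k0.trans h.1, ?_⟩
    · simp [filter_le_self]
    · intro x s₁ hs₁ e₁
      have h1 := hC n k cap σ hσ (d + 1) _ (hup x) (j + 1) s₁ hs₁
      refine Run.seq h1.2 ?_
      rintro s₂ ⟨k2, e2⟩
      have e3 := k2.2 (tmp j) (by unfold tmp; omega)
      have := hsup (Finset.univ.filter (fun y : Fin n => (x : ℕ) + 1 ≤ (y : ℕ)))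
      have hb := hfx x
      simp only [hf] at hb
      simp only [hf] at this e₁
      refine (run_maxTmp j s₂).mono (by rw [e2, e3, e₁]; omega) ?_
      rintro s₃ ⟨k3, e4⟩
      refine ⟨(k2.mono (by omega)).trans k3, ?_⟩
      rw [e4, e2, e3, e₁, filter_le_eq_insert x.isLt, Finset.sup_insert, max_comm]
    · rw [h.2, filter_le_zero, eval]

end RAM

/-! ### Commands that assign arrays, and their compilation. -/

namespace RAM

/-- Applies `f (m - 1)`, …, `f 0`. -/
def forDown {α : Type*} {n : ℕ} (f : Fin n → α → α) : (m : ℕ) → m ≤ n → α → α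
  | 0, _, a => a
  | m + 1, h, a => forDown f m (Nat.le_of_succ_le h) (f ⟨m, h⟩ a)

theorem forDown_induction {α : Type*} {n : ℕ} {f : Fin n → α → α} (I : ℕ → α → Prop)
    (step : ∀ (x : Fin n) a, I (x + 1) a → I x (f x a)) :
    ∀ (m : ℕ) (h : m ≤ n) (a : α), I m a → I 0 (forDown f m h a)
  | 0, _, _, ha => ha
  | m + 1, h, a, ha => forDown_induction I step m _ _ (step ⟨m, h⟩ a ha)

/-- Commands that assign arrays. -/
inductive Cmd where
  /-- `a[x, y] := e` for all `x, y` simultaneously, capped -/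
  | asg (a : ℕ) (e : Exp)
  | seq (c c' : Cmd)
  /-- run `c` with the next variable equal to `n - 1, …, 0` -/
  | for_ (c : Cmd)

namespace Cmd

/-- The effect of a command on the arrays. -/
def denote {n : ℕ} (k cap : ℕ) : Cmd → ℕ → (ℕ → Fin n) → Arr n → Arr n
  | asg a e, d, ρ, σ => Function.update σ a fun x y =>
      min (e.eval k σ (d + 2) (Function.update (Function.update ρ d x) (d + 1) y)) cap
  | seq c c', d, ρ, σ => denote k cap c' d ρ (denote k cap c d ρ σ)
  | for_ c, d, ρ, σ => forDown (fun x => denote k cap c (d + 1) (Function.update ρ d x)) n le_rfl σ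

/-- Lowers the temporary `0` to register `2`. -/
def clip : Prog :=
  .seq (.copy (tmp 1) (tmp 0)) (.seq (.copy (tmp 2) 2) (.seq (subFrom (tmp 1) (tmp 2))
    (subFrom (tmp 0) (tmp 1))))

/-- The program of a command. -/
def compile : Cmd → ℕ → Prog
  | asg a e, d => .seq
      (forVar d (forVar (d + 1) (.seq (e.compile (d + 2) 0) (.seq clip
        (.seq (addr 1 d (d + 1) 1) (.store (tmp 1) (tmp 0)))))))
      (forVar d (forVar (d + 1) (.seq (addr 1 d (d + 1) 0) (.seq (.load (tmp 0) (tmp 0))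
        (.seq (addr (blk a) d (d + 1) 1) (.store (tmp 1) (tmp 0)))))))
  | seq c c', d => .seq (compile c d) (compile c' d)
  | for_ c, d => forVar d (compile c (d + 1))

end Cmd

/-- The register contents during the execution of commands. -/
structure Regs {n : ℕ} (k cap c : ℕ) (ρ : ℕ → Fin n) (s : State) : Prop where
  reg0 : s.reg 0 = n
  reg1 : s.reg 1 = k
  reg2 : s.reg 2 = cap
  reg3 : s.reg 3 = c
  vars : ∀ i, s.reg (vr i) = ρ i

/-- The memory represents the arrays. -/
def MemRep {n : ℕ} (σ : Arr n) (μ : ℕ → ℕ) : Prop :=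
  ∀ a (x y : Fin n), μ ((blk a * n + (x : ℕ)) * n + (y : ℕ)) = σ a x y

theorem Regs.rep {n k cap c : ℕ} {ρ : ℕ → Fin n} {s : State} {σ : Arr n}
    (h : Regs k cap c ρ s) (h' : MemRep σ s.mem) : Rep k cap σ ρ s :=
  ⟨h.reg0, h.reg1, h.reg2, h', h.vars⟩

theorem Regs.keeps {n k cap c j : ℕ} {ρ : ℕ → Fin n} {s s' : State}
    (h : Regs k cap c ρ s) (h' : Keeps j s s') : Regs k cap c ρ s' where
  reg0 := (h'.2 0 (by omega)).trans h.reg0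
  reg1 := (h'.2 1 (by omega)).trans h.reg1
  reg2 := (h'.2 2 (by omega)).trans h.reg2
  reg3 := (h'.2 3 (by omega)).trans h.reg3
  vars i := (h'.2 _ (by unfold vr; omega)).trans (h.vars i)

/-- The hypothesis means that `s` is right except possibly in the register of the variable `d`,
which is about to be overwritten. -/
theorem Regs.setVar {n k cap c d y : ℕ} {ρ : ℕ → Fin n} {s : State} {x : Fin n}
    (h : Regs k cap c ρ (s.setReg (vr d) y)) :
    Regs k cap c (Function.update ρ d x) (s.setReg (vr d) x) := by
  have key : ∀ r, r ≠ vr d → (s.setReg (vr d) x).reg r = (s.setReg (vr d) y).reg r := by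
    intro r hr
    rw [State.setReg_reg_ne _ _ hr, State.setReg_reg_ne _ _ hr]
  refine ⟨(key 0 ?_).trans h.reg0, (key 1 ?_).trans h.reg1, (key 2 ?_).trans h.reg2,
    (key 3 ?_).trans h.reg3, fun i => ?_⟩
  any_goals unfold vr; omega
  by_cases hi : i = d
  · subst hi; simp
  · rw [Function.update_of_ne hi, key _ (by unfold vr; omega), h.vars]

theorem State.setReg_eq_self {s : State} {i x : ℕ} (h : s.reg i = x) : s.setReg i x = s := by
  subst h; simp [State.setReg]

theorem State.setReg_setReg (s : State) (i x y : ℕ) : (s.setReg i x).setReg i y = s.setReg i y := by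
  simp [State.setReg]

/-- This is for bodies that write to memory. The invariant `J` speaks of the memory only, as the
relevant registers are restored by every round. -/
theorem run_forVar {n k cap c d B : ℕ} [NeZero n] {ρ : ℕ → Fin n} {s : State} {p : Prog}
    (J : ℕ → (ℕ → ℕ) → Prop) (h : Regs k cap c ρ s) (hd : ρ d = 0) (h0 : J n s.mem)
    (step : ∀ (x : Fin n) s', Regs k cap c (Function.update ρ d x) s' → J (x + 1) s'.mem →
      Run p s' B (fun s'' => Regs k cap c (Function.update ρ d x) s'' ∧ J x s''.mem)) :
    Run (forVar d p) s (n * (B + 2) + 2) (fun s' => Regs k cap c ρ s' ∧ J 0 s'.mem) := by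
  have hz : ∀ s' : State, Regs k cap c (Function.update ρ d 0) s' → Regs k cap c ρ s' := by
    intro s' hs
    rwa [← hd, Function.update_eq_self] at hs
  have hz0 : s.reg (vr d) = 0 := by rw [h.vars, hd]; simp
  have key := Run.loop (i := vr d) (p := .seq (.pred (vr d)) p) (B := B + 1) (M := n)
    (I := fun m s' => s'.reg (vr d) = m ∧ Regs k cap c ρ (s'.setReg (vr d) 0) ∧ J m s'.mem)
    (fun m s' h => h.1) ?_ n le_rfl (s.setReg (vr d) n) ?_
  · refine Run.mono (Run.seq (Run.copy (Q := fun s' => s' = s.setReg (vr d) n) ?_)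
      (B' := n * (B + 2) + 1) ?_) (by omega) (fun _ h => h)
    · rw [h.reg0]
    rintro _ rfl
    refine key.mono le_rfl ?_
    rintro s' ⟨hs, hr, hJ⟩
    rw [State.setReg_eq_self hs] at hr
    exact ⟨hr, hJ⟩
  · rintro m s' hm ⟨hs, hr, hJ⟩
    refine Run.mono (Run.seq (Run.pred (Q := fun s'' => s'' = s'.setReg (vr d) m) ?_) ?_ (B' := B))
      (by omega) (fun _ h => h)
    · rw [hs]; rfl
    rintro _ rfl
    refine (step ⟨m, hm⟩ _ hr.setVar hJ).mono le_rfl ?_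
    rintro s'' ⟨hr', hJ'⟩
    have hv := hr'.vars d
    rw [Function.update_self] at hv
    refine ⟨hv, hz _ ?_, hJ'⟩
    have h1 : Regs k cap c (Function.update ρ d ⟨m, hm⟩) (s''.setReg (vr d) m) := by
      rwa [State.setReg_eq_self hv]
    have h2 := h1.setVar (x := 0)
    rw [Function.update_idem] at h2
    simpa using h2
  · refine ⟨by simp, ?_, h0⟩
    rwa [State.setReg_setReg, State.setReg_eq_self hz0]

/-- Two nested loops over variables, with an invariant on the memory. -/
theorem run_forVar_forVar {n k cap c d B : ℕ} [NeZero n] {ρ : ℕ → Fin n} {s : State} {p : Prog}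
    (J : Set (Fin n × Fin n) → (ℕ → ℕ) → Prop) (h : Regs k cap c ρ s)
    (hd : ∀ i, d ≤ i → ρ i = 0) (h0 : J ∅ s.mem)
    (step : ∀ (x y : Fin n) D s', Regs k cap c
        (Function.update (Function.update ρ d x) (d + 1) y) s' → J D s'.mem →
      Run p s' B (fun s'' => Regs k cap c (Function.update (Function.update ρ d x) (d + 1) y) s'' ∧
        J (insert (x, y) D) s''.mem)) :
    Run (forVar d (forVar (d + 1) p)) s (n * (n * (B + 2) + 2 + 2) + 2)
      (fun s' => Regs k cap c ρ s' ∧ J Set.univ s'.mem) := by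
  refine (run_forVar (fun m => J {z | m ≤ (z.1 : ℕ)}) h (hd d le_rfl) ?_ ?_).mono le_rfl ?_
  · convert h0
    ext z; simp
  · intro x s₁ h₁ hJ₁
    refine (run_forVar (fun m => J {z | (x : ℕ) + 1 ≤ z.1 ∨ (x : ℕ) = z.1 ∧ m ≤ (z.2 : ℕ)})
      h₁ ?_ ?_ ?_).mono le_rfl ?_
    · rw [Function.update_of_ne (by omega)]; exact hd _ (by omega)
    · convert hJ₁ using 1
      ext z; have := z.2.isLt; simp only [Set.mem_ofPred_eq]; omega
    · intro y s₂ h₂ hJ₂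
      refine (step x y _ s₂ h₂ hJ₂).mono le_rfl ?_
      rintro s₃ ⟨h₃, hJ₃⟩
      refine ⟨h₃, ?_⟩
      convert hJ₃ using 1
      ext ⟨u, v⟩
      simp only [Set.mem_ofPred_eq, Set.mem_insert_iff, Prod.mk.injEq, Fin.ext_iff]
      omega
    · rintro s₂ ⟨h₂, hJ₂⟩
      refine ⟨h₂, ?_⟩
      convert hJ₂ using 1
      ext z; simp only [Set.mem_ofPred_eq]; omega
  · rintro s' ⟨h1, h2⟩
    refine ⟨h1, ?_⟩
    convert h2 using 1
    ext z; simp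

/-- In base `n` the last two digits of an address are the indices and the rest is the block, so
different entries never share a cell. -/
theorem address_inj {n b b' : ℕ} {x x' y y' : Fin n}
    (h : (b * n + (x : ℕ)) * n + (y : ℕ) = (b' * n + (x' : ℕ)) * n + (y' : ℕ)) :
    b = b' ∧ x = x' ∧ y = y' := by
  have hn : 0 < n := x.pos
  have key : ∀ (a : ℕ) (z : Fin n), (a * n + (z : ℕ)) / n = a ∧ (a * n + (z : ℕ)) % n = z := by
    intro a z
    constructor
    · rw [mul_comm, Nat.mul_add_div hn, Nat.div_eq_of_lt z.isLt, add_zero]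
    · rw [mul_comm, Nat.mul_add_mod, Nat.mod_eq_of_lt z.isLt]
  have h1 : b * n + (x : ℕ) = b' * n + (x' : ℕ) := by
    have := (key (b * n + x) y).1
    rw [h, (key _ y').1] at this
    exact this.symm
  have h2 : (y : ℕ) = y' := by
    rw [← (key (b * n + x) y).2, h, (key _ y').2]
  have h3 : b = b' := by
    have := (key b x).1
    rw [h1, (key _ x').1] at this
    exact this.symm
  have h4 : (x : ℕ) = x' := by
    rw [← (key b x).2, h1, (key _ x').2]
  exact ⟨h3, Fin.ext h4, Fin.ext h2⟩

theorem blk_ne_one (a : ℕ) : blk a ≠ 1 := by unfold blk; split_ifs <;> omega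

theorem blk_inj {a b : ℕ} (h : blk a = blk b) : a = b := by
  unfold blk at h; split_ifs at h <;> omega

/-- With truncated subtraction, `min a c = a - (a - c)`. -/
theorem Cmd.run_clip (s : State) :
    Run Cmd.clip s (s.reg (tmp 0) * 3 + s.reg 2 * 3 + 5)
      (fun s' => Keeps 0 s s' ∧ s'.reg (tmp 0) = min (s.reg (tmp 0)) (s.reg 2)) := by
  have t01 : tmp 0 ≠ tmp 1 := by decide
  have t02 : tmp 0 ≠ tmp 2 := by decide
  have t12 : tmp 1 ≠ tmp 2 := by decide
  refine Run.mono (Run.seq (Run.copy (Q := fun s' => s' = s.setReg (tmp 1) (s.reg (tmp 0))) rfl)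
    (B' := s.reg (tmp 0) * 3 + s.reg 2 * 3 + 4) ?_) (by omega) (fun _ h => h)
  rintro _ rfl
  refine Run.mono (Run.seq (Run.copy (Q := fun s' => s' =
    (s.setReg (tmp 1) (s.reg (tmp 0))).setReg (tmp 2) (s.reg 2)) ?_)
    (B' := s.reg (tmp 0) * 3 + s.reg 2 * 3 + 3) ?_) (by omega) (fun _ h => h)
  · rw [State.setReg_reg_ne _ _ (by decide)]
  rintro _ rfl
  have m1 := run_subFrom t12 ((s.setReg (tmp 1) (s.reg (tmp 0))).setReg (tmp 2) (s.reg 2))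
  rw [State.setReg_reg_self, State.setReg_reg_ne _ _ t12, State.setReg_reg_self] at m1
  refine Run.mono (Run.seq m1 (B' := s.reg (tmp 0) * 3 + 1) ?_) (by omega) (fun _ h => h)
  rintro s' ⟨hm, h1, h2, h3⟩
  have e0 : s'.reg (tmp 0) = s.reg (tmp 0) := by
    rw [h3 _ t01 t02, State.setReg_reg_ne _ _ t02, State.setReg_reg_ne _ _ t01]
  refine (run_subFrom t01 s').mono (by rw [h1]; omega) ?_
  rintro s'' ⟨hm', h1', h2', h3'⟩
  refine ⟨⟨hm'.trans hm, fun r hr => ?_⟩, ?_⟩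
  · have a0 : r ≠ tmp 0 := by unfold tmp; omega
    have a1 : r ≠ tmp 1 := by unfold tmp; omega
    have a2 : r ≠ tmp 2 := by unfold tmp; omega
    rw [h3' r a0 a1, h3 r a1 a2, State.setReg_reg_ne _ _ a2, State.setReg_reg_ne _ _ a1]
  · rw [h1', e0, h1]; omega

/-- A command runs in polynomial time. -/
theorem Cmd.run_compile (c : Cmd) : ∃ C, ∀ (n : ℕ) [NeZero n] (k cap r : ℕ)
    (_ : cap ≤ (n + k + 1) ^ 5) (σ : Arr n)
    (_ : ∀ a x y, σ a x y ≤ (n + k + 1) ^ 5) (d : ℕ) (ρ : ℕ → Fin n) (_ : ∀ i, d ≤ i → ρ i = 0)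
    (s : State) (_ : Regs k cap r ρ s) (_ : MemRep σ s.mem),
    (∀ a x y, c.denote k cap d ρ σ a x y ≤ (n + k + 1) ^ 5) ∧
    Run (c.compile d) s ((n + k + 1) ^ C)
      (fun s' => Regs k cap r ρ s' ∧ MemRep (c.denote k cap d ρ σ) s'.mem) := by
  have two : ∀ n k : ℕ, [NeZero n] → 2 ≤ n + k + 1 := by
    intro n k _
    have := NeZero.pos n
    omega
  induction c with
  | asg a e =>
    obtain ⟨C, hC⟩ := e.run_compile
    obtain ⟨D, hD⟩ : IsPoly fun N =>
        ((1 * N + N + 1) * (N * 3 + 4) + 7) + ((blk a * N + N + blk a) * (N * 3 + 4) + 7) :=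
      (((((IsPoly.const _).mul .id).add .id).add (.const _)).mul
        ((IsPoly.id.mul (.const 3)).add (.const 4)) |>.add (.const 7)).add
      ((((((IsPoly.const _).mul .id).add .id).add (.const _)).mul
        ((IsPoly.id.mul (.const 3)).add (.const 4))).add (.const 7))
    obtain ⟨E, hE⟩ : IsPoly fun N => N * (N * ((N ^ C + (N ^ C * 3 + N ^ 5 * 3 + 5) + N ^ D + N ^ D + 3)
        + 2) + 2 + 2) + 2 :=
      (IsPoly.id.mul (((IsPoly.id.mul ((((((IsPoly.pow C).add ((((IsPoly.pow C).mul (.const 3)).add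
        ((IsPoly.pow 5).mul (.const 3))).add (.const 5))).add (.pow D)).add (.pow D)).add (.const 3)).add
        (.const 2))).add (.const 2)).add (.const 2))).add (.const 2)
    obtain ⟨F, hF⟩ := (IsPoly.pow E).add (.pow E)
    refine ⟨F, fun n _ k cap r hcap σ hσ d ρ hρ s hs hm => ?_⟩
    have hE := hE _ (two n k)
    have hF := hF _ (two n k)
    have hD := hD _ (two n k)
    beta_reduce at hE hF hD
    set N := n + k + 1 with hN
    have hnN : n ≤ N := by omega
    have ha : ∀ b, (b * n + n + b) * (n * 3 + 4) + 7 ≤ (b * N + N + b) * (N * 3 + 4) + 7 := by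
      intro b; gcongr
    have ha1 := ha 1
    have ha2 := ha (blk a)
    refine ⟨fun b x y => ?_, ?_⟩
    · rw [denote]
      by_cases hb : b = a
      · subst hb
        rw [Function.update_self]
        exact (min_le_right _ _).trans hcap
      · rw [Function.update_of_ne hb]; exact hσ b x y
    set val : Fin n → Fin n → ℕ := fun x y =>
      min (e.eval k σ (d + 2) (Function.update (Function.update ρ d x) (d + 1) y)) cap with hval
    have hup : ∀ (x y : Fin n) i, d + 2 ≤ i →
        Function.update (Function.update ρ d x) (d + 1) y i = 0 := fun x y i hi => by
      rw [Function.update_of_ne (by omega), Function.update_of_ne (by omega)]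
      exact hρ i (by omega)
    have hB : ∀ B, B ≤ N ^ C + (N ^ C * 3 + N ^ 5 * 3 + 5) + N ^ D + N ^ D + 3 →
        n * (n * (B + 2) + 2 + 2) + 2 ≤ N ^ E := by
      intro B hB
      refine le_trans ?_ hE
      gcongr
    -- The expression may read the array that is being assigned. All new values therefore go to the
    -- scratch block `1` first, and a second sweep copies them to their place.
    have first := run_forVar_forVar (d := d) (p := .seq (e.compile (d + 2) 0) (.seq clip
        (.seq (addr 1 d (d + 1) 1) (.store (tmp 1) (tmp 0)))))
      (B := N ^ C + ((N ^ C * 3 + N ^ 5 * 3 + 5) + (N ^ D + 1)))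
      (fun D μ => MemRep σ μ ∧ ∀ z ∈ D, μ ((1 * n + (z.1 : ℕ)) * n + (z.2 : ℕ)) = val z.1 z.2)
      hs hρ ⟨hm, by simp⟩ ?_
    · refine Run.mono (Run.seq (B := N ^ E) (B' := N ^ E) (first.mono (hB _ (by omega))
        fun s' h => h) ?_) hF (fun _ h => h)
      rintro s₁ ⟨hr₁, hm₁, hv₁⟩
      refine (run_forVar_forVar (d := d) (B := N ^ D + (1 + (N ^ D + 1)))
        (fun D μ => (∀ x y : Fin n, μ ((1 * n + (x : ℕ)) * n + (y : ℕ)) = val x y) ∧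
          (∀ b (x y : Fin n), b ≠ a → μ ((blk b * n + (x : ℕ)) * n + (y : ℕ)) = σ b x y) ∧
          ∀ z ∈ D, μ ((blk a * n + (z.1 : ℕ)) * n + (z.2 : ℕ)) = val z.1 z.2)
        hr₁ hρ ⟨fun x y => hv₁ (x, y) trivial, fun b x y _ => hm₁ b x y, by simp⟩ ?_).mono
          (hB _ ?_) ?_
      · rintro x y Dn s₂ hr₂ ⟨hj1, hj2, hj3⟩
        have hx : Function.update (Function.update ρ d x) (d + 1) y d = x := by simp
        have hy : Function.update (Function.update ρ d x) (d + 1) y (d + 1) = y := by simp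
        -- During the copying the memory represents neither the old nor the new arrays. Address
        -- computation only needs that it represents some arrays, so these are read off the memory.
        set σ' : Arr n := fun b x y => s₂.mem ((blk b * n + (x : ℕ)) * n + (y : ℕ)) with hσ'
        have hrep : Rep k cap σ' _ s₂ := hr₂.rep fun b x y => rfl
        refine Run.seq ((run_addr hrep 1 d (d + 1) 0).mono (by omega) fun s' h => h) ?_
        rintro s₃ ⟨k3, e3⟩
        rw [hx, hy] at e3
        refine Run.seq (Run.load (Q := fun s' => Keeps 0 s₂ s' ∧ s'.reg (tmp 0) = val x y)
          ⟨k3.setReg _ _ le_rfl, ?_⟩) ?_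
        · rw [State.setReg_reg_self, e3, k3.1, hj1]
        rintro s₄ ⟨k4, e4⟩
        refine Run.seq ((run_addr (hrep.keeps k4) (blk a) d (d + 1) 1).mono (by omega)
          fun s' h => h) ?_
        rintro s₅ ⟨k5, e5⟩
        rw [hx, hy] at e5
        have e50 : s₅.reg (tmp 0) = val x y := by rw [k5.2 _ (by unfold tmp; omega), e4]
        have m5 : s₅.mem = s₂.mem := k5.1.trans k4.1
        have h5 := (hr₂.keeps k4).keeps k5
        refine Run.store ⟨⟨h5.reg0, h5.reg1, h5.reg2, h5.reg3, h5.vars⟩, ?_⟩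
        rw [e5, e50]
        simp only [State.setMem, m5]
        refine ⟨fun x' y' => ?_, fun b x' y' hb => ?_, ?_⟩
        · rw [Function.update_of_ne, hj1]
          exact fun h => blk_ne_one a (address_inj h).1.symm
        · rw [Function.update_of_ne, hj2 b x' y' hb]
          exact fun h => hb (blk_inj (address_inj h).1)
        · rintro ⟨x', y'⟩ hz
          by_cases hxy : (x', y') = (x, y)
          · obtain ⟨rfl, rfl⟩ := Prod.mk.injEq _ _ _ _ ▸ hxy
            rw [Function.update_self]
          · rw [Function.update_of_ne, hj3 _ (hz.resolve_left hxy)]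
            intro h
            obtain ⟨-, h1, h2⟩ := address_inj h
            exact hxy (Prod.ext h1 h2)
      · omega
      · rintro s₂ ⟨hr₂, hj1, hj2, hj3⟩
        refine ⟨hr₂, fun b x y => ?_⟩
        rw [denote]
        by_cases hb : b = a
        · subst hb
          rw [Function.update_self]
          exact hj3 (x, y) trivial
        · rw [Function.update_of_ne hb]
          exact hj2 b x y hb
    · rintro x y Dn s₂ hr₂ ⟨hm₂, hv₂⟩
      have hx : Function.update (Function.update ρ d x) (d + 1) y d = x := by simp
      have hy : Function.update (Function.update ρ d x) (d + 1) y (d + 1) = y := by simp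
      have he := hC n k cap σ hσ (d + 2) _ (hup x y) 0 s₂ (hr₂.rep hm₂)
      refine Run.seq he.2 ?_
      rintro s₃ ⟨k3, e3⟩
      have hr3 := hr₂.keeps k3
      refine Run.seq ((run_clip s₃).mono ?_ fun s' h => h) ?_
      · rw [e3, hr3.reg2]
        have := he.1
        rw [← hN] at this
        omega
      rintro s₄ ⟨k4, e4⟩
      rw [e3, hr3.reg2] at e4
      have m4 : MemRep σ s₄.mem := by rw [k4.1, k3.1]; exact hm₂
      refine Run.seq ((run_addr ((hr3.keeps k4).rep m4) 1 d (d + 1) 1).mono (by omega)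
        fun s' h => h) ?_
      rintro s₅ ⟨k5, e5⟩
      rw [hx, hy] at e5
      have e50 : s₅.reg (tmp 0) = val x y := by rw [k5.2 _ (by unfold tmp; omega), e4]
      have m5 : s₅.mem = s₂.mem := k5.1.trans (k4.1.trans k3.1)
      have h5 := (hr3.keeps k4).keeps k5
      refine Run.store ⟨⟨h5.reg0, h5.reg1, h5.reg2, h5.reg3, h5.vars⟩, ?_⟩
      rw [e5, e50]
      simp only [State.setMem, m5]
      refine ⟨fun b x' y' => ?_, ?_⟩
      · rw [Function.update_of_ne, hm₂]
        exact fun h => blk_ne_one b (address_inj h).1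
      · rintro ⟨x', y'⟩ hz
        by_cases hxy : (x', y') = (x, y)
        · obtain ⟨rfl, rfl⟩ := Prod.mk.injEq _ _ _ _ ▸ hxy
          rw [Function.update_self]
        · rw [Function.update_of_ne, hv₂ _ (hz.resolve_left hxy)]
          intro h
          obtain ⟨-, h1, h2⟩ := address_inj h
          exact hxy (Prod.ext h1 h2)
  | seq c c' ih ih' =>
    obtain ⟨C, hC⟩ := ih
    obtain ⟨D, hD⟩ := ih'
    obtain ⟨E, hE⟩ := (IsPoly.pow C).add (.pow D)
    refine ⟨E, fun n _ k cap r hcap σ hσ d ρ hρ s hs hm => ?_⟩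
    obtain ⟨b1, r1⟩ := hC n k cap r hcap σ hσ d ρ hρ s hs hm
    have r2 := fun s' (h : Regs k cap r ρ s' ∧ MemRep (c.denote k cap d ρ σ) s'.mem) =>
      (hD n k cap r hcap _ b1 d ρ hρ s' h.1 h.2)
    refine ⟨?_, (Run.seq r1 fun s' h => (r2 s' h).2).mono (hE _ (two n k)) fun _ h => h⟩
    obtain ⟨s', -, -, -, h⟩ := r1
    exact (r2 s' h).1
  | for_ c ih =>
    obtain ⟨C, hC⟩ := ih
    obtain ⟨E, hE⟩ : IsPoly fun N => N * (N ^ C + 2) + 2 :=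
      (IsPoly.id.mul ((IsPoly.pow C).add (.const 2))).add (.const 2)
    refine ⟨E, fun n _ k cap r hcap σ hσ d ρ hρ s hs hm => ?_⟩
    have hE := hE _ (two n k)
    beta_reduce at hE
    have hn : n * ((n + k + 1) ^ C + 2) ≤ (n + k + 1) * ((n + k + 1) ^ C + 2) := by
      gcongr; omega
    set f : Fin n → Arr n → Arr n := fun x => denote k cap c (d + 1) (Function.update ρ d x)
    have hup : ∀ (x : Fin n) i, d + 1 ≤ i → Function.update ρ d x i = 0 := fun x i hi => by
      rw [Function.update_of_ne (by omega)]; exact hρ i (by omega)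
    -- The invariant: the rounds still to come, applied to the arrays now in memory, yield the final
    -- arrays.
    have run := run_forVar (d := d) (p := c.compile (d + 1)) (B := (n + k + 1) ^ C)
      (fun m μ => ∃ (hm : m ≤ n) (σ' : Arr n), MemRep σ' μ ∧
        (∀ a x y, σ' a x y ≤ (n + k + 1) ^ 5) ∧ forDown f m hm σ' = forDown f n le_rfl σ)
      hs (hρ d le_rfl) ⟨le_rfl, σ, hm, hσ, rfl⟩ ?_
    · have run' : Run ((for_ c).compile d) s ((n + k + 1) ^ E) (fun s' =>
          (∀ a x y, (for_ c).denote k cap d ρ σ a x y ≤ (n + k + 1) ^ 5) ∧ Regs k cap r ρ s' ∧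
            MemRep ((for_ c).denote k cap d ρ σ) s'.mem) := by
        refine run.mono (by omega) ?_
        rintro s' ⟨h1, h2, σ', h3, h4, h5⟩
        rw [denote]
        change (∀ a x y, forDown f n le_rfl σ a x y ≤ _) ∧ _ ∧ MemRep (forDown f n le_rfl σ) _
        rw [← h5]
        exact ⟨h4, h1, h3⟩
      refine ⟨?_, run'.mono le_rfl fun _ h => h.2⟩
      obtain ⟨_, _, _, _, h, _⟩ := run'
      exact h
    · rintro x s₁ hr₁ ⟨hx, σ', h3, h4, h5⟩
      obtain ⟨b1, r1⟩ := hC n k cap r hcap σ' h4 (d + 1) _ (hup x) s₁ hr₁ h3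
      refine r1.mono le_rfl ?_
      rintro s₂ ⟨h6, h7⟩
      exact ⟨h6, x.isLt.le, _, h7, b1, h5⟩

end RAM

/-! ### The assembled program and its running time. -/

namespace RAM

/-- Computes `8 ^ k` into register `3`. -/
def powEight : Prog :=
  .seq (.const 3 1) (.seq (.copy 4 1) (.loop 4 (.seq (.pred 4) (.seq (.const 5 0)
    (.seq (.loop 3 (.seq (.pred 3) (.seq (.succ 5) (.seq (.succ 5) (.seq (.succ 5) (.seq (.succ 5)
      (.seq (.succ 5) (.seq (.succ 5) (.seq (.succ 5) (.succ 5)))))))))) (.copy 3 5))))))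

/-- All registers except `3`, `4` and `5`, and the memory, are unchanged. -/
def KeepsBig (s s' : State) : Prop :=
  s'.mem = s.mem ∧ ∀ r, r < 3 ∨ 5 < r → s'.reg r = s.reg r

theorem KeepsBig.setReg {s s' : State} (h : KeepsBig s s') (i x : ℕ) (h1 : 3 ≤ i) (h2 : i ≤ 5) :
    KeepsBig s (s'.setReg i x) := by
  refine ⟨h.1, fun r hr => ?_⟩
  rw [State.setReg_reg_ne _ _ (by omega), h.2 r hr]

/-- Each of the `k` multiplications by eight is done with increments, in time linear in a number
that is at most `8 ^ k`; this stays within `8 ^ k` times a polynomial. -/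
theorem run_powEight (s : State) :
    Run powEight s (s.reg 1 * (8 ^ s.reg 1 * 10 + 5) + 3)
      (fun s' => KeepsBig s s' ∧ s'.reg 3 = 8 ^ s.reg 1) := by
  set k := s.reg 1 with hk
  have k0 : KeepsBig s s := ⟨rfl, fun _ _ => rfl⟩
  refine Run.mono (Run.seq (Run.const (Q := fun s' => s' = s.setReg 3 1) rfl)
    (B' := k * (8 ^ k * 10 + 5) + 2) ?_) (by omega) (fun _ h => h)
  rintro _ rfl
  refine Run.mono (Run.seq (Run.copy (Q := fun s' => s' = (s.setReg 3 1).setReg 4 k) ?_)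
    (B' := k * (8 ^ k * 10 + 5) + 1) ?_) (by omega) (fun _ h => h)
  · rw [State.setReg_reg_ne _ _ (by omega)]
  rintro _ rfl
  have key := Run.loop (i := 4) (M := k) (B := 8 ^ k * 10 + 4)
    (p := .seq (.pred 4) (.seq (.const 5 0)
    (.seq (.loop 3 (.seq (.pred 3) (.seq (.succ 5) (.seq (.succ 5) (.seq (.succ 5) (.seq (.succ 5)
      (.seq (.succ 5) (.seq (.succ 5) (.seq (.succ 5) (.succ 5)))))))))) (.copy 3 5))))
    (I := fun m s' => KeepsBig s s' ∧ s'.reg 4 = m ∧ s'.reg 3 * 8 ^ m = 8 ^ k)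
    (fun m s' h => h.2.1) ?_ k le_rfl ((s.setReg 3 1).setReg 4 k) ?_
  · refine key.mono le_rfl ?_
    rintro s' ⟨h1, -, h2⟩
    exact ⟨h1, by simpa using h2⟩
  · rintro m s₁ hm ⟨h1, h2, h3⟩
    have hle : s₁.reg 3 ≤ 8 ^ k := by
      rw [← h3]; exact Nat.le_mul_of_pos_right _ (by positivity)
    refine Run.mono (Run.seq (Run.pred (Q := fun s' => s' = s₁.setReg 4 m) (by rw [h2]; rfl))
      (B' := 8 ^ k * 10 + 3) ?_) (by omega) (fun _ h => h)
    rintro _ rfl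
    refine Run.mono (Run.seq (Run.const (Q := fun s' => s' = (s₁.setReg 4 m).setReg 5 0) rfl)
      (B' := 8 ^ k * 10 + 2) ?_) (by omega) (fun _ h => h)
    rintro _ rfl
    have inner := Run.loop (i := 3) (M := s₁.reg 3) (B := 9)
      (p := .seq (.pred 3) (.seq (.succ 5) (.seq (.succ 5) (.seq (.succ 5) (.seq (.succ 5)
        (.seq (.succ 5) (.seq (.succ 5) (.seq (.succ 5) (.succ 5)))))))))
      (I := fun j s' => KeepsBig s s' ∧ s'.reg 4 = m ∧ s'.reg 3 = j ∧
        s'.reg 5 + 8 * j = 8 * s₁.reg 3) (fun m s' h => h.2.2.1) ?_ (s₁.reg 3) le_rfl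
      ((s₁.setReg 4 m).setReg 5 0) ?_
    · refine Run.mono (Run.seq (B := 8 ^ k * 10 + 1) (B' := 1)
        (inner.mono (by omega) fun _ h => h) ?_) (by omega) fun _ h => h
      rintro s₂ ⟨i1, i2, i3, i4⟩
      refine Run.copy ⟨i1.setReg _ _ (by omega) (by omega), ?_, ?_⟩
      · rw [State.setReg_reg_ne _ _ (by omega), i2]
      · rw [State.setReg_reg_self, ← h3, pow_succ]
        have : s₂.reg 5 = 8 * s₁.reg 3 := by omega
        rw [this]; ring
    · rintro j s₂ hj ⟨i1, i2, i3, i4⟩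
      have add8 : ∀ s₃ : State, Run (.seq (.succ 5) (.seq (.succ 5) (.seq (.succ 5) (.seq (.succ 5)
        (.seq (.succ 5) (.seq (.succ 5) (.seq (.succ 5) (.succ 5)))))))) s₃ 8
        (fun s' => s' = s₃.setReg 5 (s₃.reg 5 + 8)) := by
        intro s₃
        have one : ∀ a, Run (.succ 5) (s₃.setReg 5 (s₃.reg 5 + a)) 1
            (fun s' => s' = s₃.setReg 5 (s₃.reg 5 + (a + 1))) := by
          intro a
          refine Run.succ ?_
          rw [State.setReg_reg_self, State.setReg_setReg, add_assoc]
        have zero := one 0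
        rw [State.setReg_eq_self (by simp)] at zero
        refine (zero.seq (B' := 7) ?_).mono le_rfl fun _ h => h
        rintro _ rfl
        refine ((one _).seq (B' := 6) ?_).mono le_rfl fun _ h => h
        rintro _ rfl
        refine ((one _).seq (B' := 5) ?_).mono le_rfl fun _ h => h
        rintro _ rfl
        refine ((one _).seq (B' := 4) ?_).mono le_rfl fun _ h => h
        rintro _ rfl
        refine ((one _).seq (B' := 3) ?_).mono le_rfl fun _ h => h
        rintro _ rfl
        refine ((one _).seq (B' := 2) ?_).mono le_rfl fun _ h => h
        rintro _ rfl
        refine ((one _).seq (B' := 1) ?_).mono le_rfl fun _ h => h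
        rintro _ rfl
        exact one _
      refine Run.mono (Run.seq (Run.pred (Q := fun s' => s' = s₂.setReg 3 j) (by rw [i3]; rfl))
        (B' := 8) ?_) (by omega) (fun _ h => h)
      rintro _ rfl
      refine (add8 _).mono le_rfl ?_
      rintro _ rfl
      refine ⟨(i1.setReg _ _ (by omega) (by omega)).setReg _ _ (by omega) (by omega), ?_, ?_, ?_⟩
      · rw [State.setReg_reg_ne _ _ (by omega), State.setReg_reg_ne _ _ (by omega), i2]
      · rw [State.setReg_reg_ne _ _ (by omega), State.setReg_reg_self]
      · rw [State.setReg_reg_self, State.setReg_reg_ne _ _ (by omega)]; omega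
    · refine ⟨(h1.setReg _ _ (by omega) (by omega)).setReg _ _ (by omega) (by omega), ?_, ?_, ?_⟩
      · rw [State.setReg_reg_ne _ _ (by omega), State.setReg_reg_self]
      · rw [State.setReg_reg_ne _ _ (by omega), State.setReg_reg_ne _ _ (by omega)]
      · rw [State.setReg_reg_self]; omega
  · refine ⟨(k0.setReg _ _ (by omega) (by omega)).setReg _ _ (by omega) (by omega), ?_, ?_⟩
    · rw [State.setReg_reg_self]
    · rw [State.setReg_reg_ne _ _ (by omega), State.setReg_reg_self, one_mul]

/-- The program that runs `c` once, then `c'` as often as `8 ^ k` times, and returns `e`. -/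
def assemble (c c' : Cmd) (e : Exp) : Prog :=
  .seq ((Exp.sum (.sum (.const 8))).compile 0 0) (.seq (.copy 2 (tmp 0)) (.seq powEight
    (.seq (c.compile 0) (.seq (.loop 3 (.seq (.pred 3) (c'.compile 0)))
      (.seq (e.compile 0 0) (.copy 0 (tmp 0)))))))

/-- The `8 ^ k` runs of `c'` are each polynomial, with the same exponent, because clipping at `n *
(n * 8)` keeps the arrays bounded throughout. -/
theorem run_assemble (c c' : Cmd) (e : Exp) : ∃ C, ∀ (n : ℕ) [NeZero n] (k : ℕ) (σ : Arr n)
    (_ : ∀ a x y, σ a x y ≤ 2) (s : State) (_ : s.reg 0 = n) (_ : s.reg 1 = k)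
    (_ : ∀ r, 1 < r → s.reg r = 0) (_ : MemRep σ s.mem),
    Run (assemble c c' e) s (C * 8 ^ k * (n + k + 1) ^ C) (fun s' => s'.reg 0 =
      e.eval k ((c'.denote k (n * (n * 8)) 0 fun _ => 0)^[8 ^ k]
        (c.denote k (n * (n * 8)) 0 (fun _ => 0) σ)) 0 fun _ => 0) := by
  obtain ⟨C₀, h₀⟩ := (Exp.sum (.sum (.const 8))).run_compile
  obtain ⟨C₁, h₁⟩ := c.run_compile
  obtain ⟨C₂, h₂⟩ := c'.run_compile
  obtain ⟨C₃, h₃⟩ := e.run_compile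
  obtain ⟨D, hD⟩ : IsPoly fun N => N ^ C₀ + (1 + ((N * 15 + 3) + (N ^ C₁ + ((N ^ C₂ + 3) +
      (N ^ C₃ + 1))))) :=
    (IsPoly.pow _).add ((IsPoly.const 1).add (((IsPoly.id.mul (.const 15)).add (.const 3)).add
      ((IsPoly.pow _).add (((IsPoly.pow _).add (.const 3)).add ((IsPoly.pow _).add (.const 1))))))
  refine ⟨D + 1, fun n _ k σ hσ s hn hk hr hm => ?_⟩
  have hnpos := NeZero.pos n
  have hN2 : 2 ≤ n + k + 1 := by omega
  have hD := hD _ hN2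
  beta_reduce at hD
  set N := n + k + 1 with hN
  have h2N : 2 ≤ N ^ 5 := hN2.trans (Nat.le_self_pow (by omega) N)
  -- The exponent `5` comes from here: two factors `n`, and `8 = 2 ^ 3 ≤ N ^ 3`.
  have hcap : n * (n * 8) ≤ N ^ 5 := by
    calc n * (n * 8) ≤ N * (N * (2 * 2 * 2)) := by gcongr <;> omega
      _ ≤ N * (N * (N * N * N)) := by gcongr
      _ = N ^ 5 := by ring
  set cap := n * (n * 8) with hcapdef
  set ρ : ℕ → Fin n := fun _ => 0 with hρ
  have hρ0 : ∀ i, 0 ≤ i → ρ i = 0 := fun _ _ => rfl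
  have hE : 1 ≤ 8 ^ k := Nat.one_le_pow _ _ (by omega)
  set E := 8 ^ k with hEdef
  have hvr : ∀ i, s.reg (vr i) = ρ i := fun i => by
    rw [hr _ (by unfold vr; omega)]; simp [hρ]
  have rep0 : Rep k 0 σ ρ s := ⟨hn, hk, hr 2 (by omega), hm, hvr⟩
  have hσ5 : ∀ a x y, σ a x y ≤ N ^ 5 := fun a x y => (hσ a x y).trans h2N
  have bound : N ^ C₀ + (1 + ((k * (E * 10 + 5) + 3) + (N ^ C₁ + ((E * (N ^ C₂ + 1 + 1) + 1) +
      (N ^ C₃ + 1))))) ≤ (D + 1) * E * N ^ (D + 1) := by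
    have e1 : k * (E * 10 + 5) ≤ E * (N * 15) := by
      calc k * (E * 10 + 5) ≤ N * (E * 10 + E * 5) := by gcongr <;> omega
        _ = E * (N * 15) := by ring
    have e2 : N ^ D ≤ N ^ (D + 1) := Nat.pow_le_pow_right (by omega) (by omega)
    have e3 : ∀ x, x ≤ E * x := fun x => Nat.le_mul_of_pos_left x hE
    calc _ ≤ E * N ^ C₀ + (E * 1 + ((E * (N * 15) + E * 3) + (E * N ^ C₁ +
          ((E * (N ^ C₂ + 1 + 1) + E * 1) + (E * N ^ C₃ + E * 1))))) := by gcongr <;> exact e3 _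
      _ = E * (N ^ C₀ + (1 + ((N * 15 + 3) + (N ^ C₁ + ((N ^ C₂ + 3) + (N ^ C₃ + 1)))))) := by ring
      _ ≤ E * N ^ (D + 1) := by gcongr; exact hD.trans e2
      _ = 1 * E * N ^ (D + 1) := by ring
      _ ≤ _ := by gcongr; omega
  refine Run.mono (Run.seq (h₀ n k 0 σ hσ5 0 ρ hρ0 0 s rep0).2 ?_) bound fun _ h => h
  rintro s₀ ⟨k0, e0⟩
  have e0' : s₀.reg (tmp 0) = cap := by rw [e0]; simp [Exp.eval, hcapdef]
  have rep1 := rep0.keeps k0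
  refine Run.seq (Run.copy (Q := fun s' => s' = s₀.setReg 2 cap) (by rw [e0'])) ?_
  rintro _ rfl
  have hk1 : (s₀.setReg 2 cap).reg 1 = k := by
    rw [State.setReg_reg_ne _ _ (by omega), rep1.reg1]
  have hp := run_powEight (s₀.setReg 2 cap)
  rw [hk1] at hp
  refine Run.seq hp ?_
  rintro s₁ ⟨⟨m1, r1⟩, e1⟩
  have regs1 : Regs k cap E ρ s₁ := by
    refine ⟨?_, ?_, ?_, e1, fun i => ?_⟩
    · rw [r1 0 (by omega), State.setReg_reg_ne _ _ (by omega), rep1.reg0]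
    · rw [r1 1 (by omega), hk1]
    · rw [r1 2 (by omega), State.setReg_reg_self]
    · rw [r1 _ (by unfold vr; omega), State.setReg_reg_ne _ _ (by unfold vr; omega), rep1.vars]
  have hm1 : MemRep σ s₁.mem := by rw [m1, State.setReg_mem, k0.1]; exact hm
  obtain ⟨b2, run2⟩ := h₁ n k cap E hcap σ hσ5 0 ρ hρ0 s₁ regs1 hm1
  refine Run.seq run2 ?_
  rintro s₂ ⟨regs2, hm2⟩
  set σ₁ := c.denote k cap 0 ρ σ with hσ₁
  have big := Run.loop (i := 3) (M := E) (B := N ^ C₂ + 1)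
    (p := .seq (.pred 3) (c'.compile 0))
    (I := fun m s' => Regs k cap m ρ s' ∧ ∃ σ' : Arr n, MemRep σ' s'.mem ∧
      (∀ a x y, σ' a x y ≤ N ^ 5) ∧
      (c'.denote k cap 0 ρ)^[m] σ' = (c'.denote k cap 0 ρ)^[E] σ₁)
    (fun m s' h => h.1.reg3) ?_ E le_rfl s₂ ⟨regs2, σ₁, hm2, b2, rfl⟩
  · refine Run.seq big ?_
    rintro s₃ ⟨regs3, σ', hm3, b3, e3⟩
    rw [Function.iterate_zero, id] at e3
    refine Run.seq (h₃ n k cap σ' b3 0 ρ hρ0 0 s₃ (regs3.rep hm3)).2 ?_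
    rintro s₄ ⟨-, e4⟩
    refine Run.copy ?_
    rw [State.setReg_reg_self, e4, e3]
  · rintro m s' hm ⟨regs', σ', hm', b', e'⟩
    refine Run.mono (Run.seq (Run.pred (Q := fun s'' => s'' = s'.setReg 3 m) ?_)
      (B' := N ^ C₂) ?_) (by omega) fun _ h => h
    · rw [regs'.reg3]; rfl
    rintro _ rfl
    have regs'' : Regs k cap m ρ (s'.setReg 3 m) := by
      refine ⟨?_, ?_, ?_, by simp, fun i => ?_⟩
      · rw [State.setReg_reg_ne _ _ (by omega), regs'.reg0]
      · rw [State.setReg_reg_ne _ _ (by omega), regs'.reg1]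
      · rw [State.setReg_reg_ne _ _ (by omega), regs'.reg2]
      · rw [State.setReg_reg_ne _ _ (by unfold vr; omega), regs'.vars]
    obtain ⟨b3, run3⟩ := h₂ n k cap m hcap σ' b' 0 ρ hρ0 _ regs'' hm'
    refine run3.mono le_rfl fun s'' h => ⟨h.1, _, h.2, b3, ?_⟩
    rw [← e', Function.iterate_succ_apply]

end RAM

/-! ### Sign matrices, reductions and their gain. -/

/-- The matrix of signs of a signed graph: symmetric, zero on the diagonal, entries `0`, `1`,
`-1`. -/
structure IsSignMatrix {V : Type*} (s : V → V → ℤ) : Prop where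
  symm : ∀ u v, s u v = s v u
  diag : ∀ v, s v v = 0
  vals : ∀ u v, s u v = 0 ∨ s u v = 1 ∨ s u v = -1

/-- All values are `1` or `-1`. -/
def IsPM {V : Type*} (x : V → ℤ) : Prop := ∀ v, x v = 1 ∨ x v = -1

theorem IsPM.sq {V : Type*} {x : V → ℤ} (h : IsPM x) (v : V) : x v * x v = 1 := by
  rcases h v with h | h <;> rw [h] <;> rfl

theorem IsSignMatrix.sq {V : Type*} {s : V → V → ℤ} (h : IsSignMatrix s) {u v : V}
    (huv : s u v ≠ 0) : s u v * s u v = 1 := by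
  rcases h.vals u v with h | h | h
  · exact absurd h huv
  all_goals rw [h]; rfl

namespace SignMatrix

variable {V : Type*} [DecidableEq V]

/-- The quadratic form of a sign matrix on a set of vertices. -/
def quad (s : V → V → ℤ) (X : Finset V) (x : V → ℤ) : ℤ :=
  ∑ u ∈ X, ∑ v ∈ X, s u v * x u * x v

/-- Connectedness of the set `X`: every proper nonempty part has an edge to the rest. -/
def Conn (s : V → V → ℤ) (X : Finset V) : Prop :=
  ∀ A ⊆ X, A.Nonempty → A ≠ X → ∃ a ∈ A, ∃ b ∈ X, b ∉ A ∧ s a b ≠ 0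

/-- `c` is adjacent to all of `Q`, and together with any two vertices of `Q` it spans a negative
triangle. -/
def Fan (s : V → V → ℤ) (c : V) (Q : Finset V) : Prop :=
  (∀ u ∈ Q, s c u ≠ 0) ∧ ∀ u ∈ Q, ∀ v ∈ Q, u ≠ v → s c u * s u v * s c v = -1

/-- The ways to choose the set `M` of vertices that are deleted for a gain. -/
inductive MarkRule (s : V → V → ℤ) (R M Q : Finset V) (a b c : V) : Prop
  | none : M = ∅ → MarkRule s R M Q a b c
  | triple : M = {a, b, c} → s a c ≠ 0 → s b c ≠ 0 → a ≠ b → s a c * s a b * s b c ≠ -1 →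
      MarkRule s R M Q a b c
  | odd : M = {a} → Q = ∅ → Odd (R.filter fun v => s a v ≠ 0).card → MarkRule s R M Q a b c
  | twins : M = {a, b} → Q = ∅ → s a c * s a b * s b c = 1 →
      (∀ w ∈ R, w ≠ a → w ≠ b → w ≠ c →
        (s a w = 0 ∧ s b w = 0) ∨ s a w * s a b * s b w = -1) → MarkRule s R M Q a b c

/-- A reduction of the connected vertex set `R`: the vertices of `M` are marked and deleted, the
vertices of `Q` are deleted. -/
structure Reduction (s : V → V → ℤ) (R M Q : Finset V) (a b c : V) : Prop where
  mark_sub : M ⊆ R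
  sub : Q ⊆ R
  disj : Disjoint M Q
  hub_mem : c ∈ R
  hub_not_mem : c ∉ Q
  fan : Fan s c Q
  even : Even Q.card
  closed : ∀ u ∈ Q, ∀ v ∈ R, v ∉ M → v ∉ Q → s u v ≠ 0 → v = c
  nonempty : ((R \ M) \ Q).Nonempty
  conn : Conn s ((R \ M) \ Q)
  rule : MarkRule s R M Q a b c

theorem quad_union {s : V → V → ℤ} (hs : IsSignMatrix s) {A B : Finset V} (h : Disjoint A B)
    (x : V → ℤ) : quad s (A ∪ B) x = quad s A x + quad s B x +
      2 * ∑ a ∈ A, ∑ b ∈ B, s a b * x a * x b := by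
  have h1 : ∑ b ∈ B, ∑ a ∈ A, s b a * x b * x a = ∑ a ∈ A, ∑ b ∈ B, s a b * x a * x b := by
    rw [Finset.sum_comm]
    refine Finset.sum_congr rfl fun a _ => Finset.sum_congr rfl fun b _ => ?_
    rw [hs.symm b a]; ring
  unfold quad
  simp only [Finset.sum_union h, Finset.sum_add_distrib]
  rw [h1]; ring

omit [DecidableEq V] in
theorem quad_congr {s : V → V → ℤ} {A : Finset V} {x y : V → ℤ} (h : ∀ v ∈ A, x v = y v) :
    quad s A x = quad s A y := by
  refine Finset.sum_congr rfl fun u hu => Finset.sum_congr rfl fun v hv => ?_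
  rw [h u hu, h v hv]

/-- Assignments on two disjoint sets can be combined, up to a global change of sign of one. -/
theorem exists_combine {s : V → V → ℤ} (hs : IsSignMatrix s) {A B : Finset V} (h : Disjoint A B)
    {x y : V → ℤ} (hx : IsPM x) (hy : IsPM y) : ∃ z, IsPM z ∧ quad s (A ∪ B) z =
      quad s A x + quad s B y + 2 * |∑ a ∈ A, ∑ b ∈ B, s a b * x a * y b| := by
  set S := ∑ a ∈ A, ∑ b ∈ B, s a b * x a * y b with hS
  -- A change of all signs on `B` preserves both forms and negates the cross term, which can thus be
  -- made nonnegative.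
  obtain ⟨ε, hε, hεS⟩ : ∃ ε : ℤ, (ε = 1 ∨ ε = -1) ∧ ε * S = |S| := by
    rcases abs_choice S with h | h
    · exact ⟨1, Or.inl rfl, by rw [h]; ring⟩
    · exact ⟨-1, Or.inr rfl, by rw [h]; ring⟩
  have hε2 : ε * ε = 1 := by rcases hε with h | h <;> rw [h] <;> rfl
  refine ⟨fun v => if v ∈ A then x v else ε * y v, fun v => ?_, ?_⟩
  · dsimp only
    split_ifs
    · exact hx v
    · rcases hε with h | h <;> rcases hy v with h' | h' <;> rw [h, h'] <;> simp
  · have hB : ∀ v ∈ B, (if v ∈ A then x v else ε * y v) = ε * y v := fun v hv =>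
      if_neg (Finset.disjoint_right.1 h hv)
    have hq : quad s B (fun v => ε * y v) = quad s B y := by
      refine Finset.sum_congr rfl fun u _ => Finset.sum_congr rfl fun v _ => ?_
      linear_combination (s u v * y u * y v) * hε2
    have hc : ∑ a ∈ A, ∑ b ∈ B, s a b * (if a ∈ A then x a else ε * y a) *
        (if b ∈ A then x b else ε * y b) = ε * S := by
      rw [hS, Finset.mul_sum]
      refine Finset.sum_congr rfl fun u hu => ?_
      rw [Finset.mul_sum]
      refine Finset.sum_congr rfl fun v hv => ?_
      rw [if_pos hu, hB v hv]; ring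
    rw [quad_union hs h, hc, quad_congr (s := s) (A := A) (y := x) fun v hv => if_pos hv,
      quad_congr hB, hq, hεS]

/-- A negative clique of even size has a balanced subgraph with half of its vertices on either
side. -/
theorem Fan.exists_quad {s : V → V → ℤ} (hs : IsSignMatrix s) {c : V} {Q : Finset V}
    (h : Fan s c Q) (hQ : Even Q.card) : ∃ x, IsPM x ∧ quad s Q x = Q.card := by
  obtain ⟨r, hr⟩ := hQ
  obtain ⟨A, hA, hAc⟩ := Finset.exists_subset_card_eq (s := Q) (n := r) (by omega)
  -- The switch by the signs `s c v` makes all edges of `Q` negative. A balanced `z` then has the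
  -- value `|Q| - (∑ z) ^ 2 = |Q|`.
  set z : V → ℤ := fun v => if v ∈ A then 1 else -1 with hz
  set y : V → ℤ := fun v => if s c v = 0 then 1 else s c v with hy
  have hzz : ∀ v, z v * z v = 1 := fun v => by simp only [hz]; split_ifs <;> rfl
  have hyQ : ∀ v ∈ Q, y v = s c v := fun v hv => if_neg (h.1 v hv)
  have hsum : ∑ v ∈ Q, z v = 0 := by
    rw [← Finset.sum_sdiff hA]
    have h1 : ∑ v ∈ A, z v = r := by
      rw [Finset.sum_congr rfl fun v hv => (if_pos hv : z v = 1)]; simp [hAc]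
    have h2 : ∑ v ∈ Q \ A, z v = -r := by
      rw [Finset.sum_congr rfl fun v hv => (if_neg (Finset.mem_sdiff.1 hv).2 : z v = -1)]
      simp [Finset.card_sdiff_of_subset hA, hAc, hr]
    rw [h1, h2]; ring
  refine ⟨fun v => y v * z v, fun v => ?_, ?_⟩
  · have h1 : y v = 1 ∨ y v = -1 := by
      simp only [hy]
      split_ifs with h0
      · exact Or.inl rfl
      · exact (hs.vals c v).resolve_left h0
    have h2 : z v = 1 ∨ z v = -1 := by simp only [hz]; split_ifs <;> simp
    rcases h1 with h1 | h1 <;> rcases h2 with h2 | h2 <;> simp [h1, h2]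
  · have key : ∀ u ∈ Q, ∀ v ∈ Q, s u v * (y u * z u) * (y v * z v) =
        (if u = v then 1 else 0) - z u * z v := by
      intro u hu v hv
      rw [hyQ u hu, hyQ v hv]
      by_cases huv : u = v
      · subst huv
        rw [hs.diag, if_pos rfl, hzz]; ring
      · rw [if_neg huv]
        linear_combination (z u * z v) * h.2 u hu v hv huv
    unfold quad
    rw [Finset.sum_congr rfl fun u hu => Finset.sum_congr rfl fun v hv => key u hu v hv]
    simp only [Finset.sum_sub_distrib, Finset.sum_ite_eq]
    rw [← Finset.sum_mul_sum, hsum]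
    simp

-- Modulo `2` each nonzero term is `1`, so the sum is odd.
omit [DecidableEq V] in
theorem abs_sum_pos_of_odd {A : Finset V} {f : V → ℤ} (hf : ∀ v, f v = 0 ∨ f v = 1 ∨ f v = -1)
    (h : Odd (A.filter fun v => f v ≠ 0).card) : 1 ≤ |∑ v ∈ A, f v| := by
  have h1 : (∑ v ∈ A, f v) ≡ ((A.filter fun v => f v ≠ 0).card : ℤ) [ZMOD 2] := by
    rw [Finset.card_filter]
    push_cast
    refine Int.ModEq.sum fun v _ => ?_
    rcases hf v with h | h | h <;> rw [h] <;> decide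
  refine Int.one_le_abs fun h0 => ?_
  rw [h0] at h1
  obtain ⟨r, hr⟩ := h
  rw [hr] at h1
  have := h1.eq
  push_cast at this
  omega

/-- A reduction loses at most the gain accounted for by the marked vertices. -/
theorem Reduction.gain {s : V → V → ℤ} (hs : IsSignMatrix s) {R M Q : Finset V} {a b c : V}
    (h : Reduction s R M Q a b c) {x : V → ℤ} (hx : IsPM x) : ∃ x', IsPM x' ∧
      3 * (quad s ((R \ M) \ Q) x - ((R \ M) \ Q).card) + M.card ≤
        3 * (quad s R x' - R.card) := by
  have hc : R.card = ((R \ M) \ Q).card + Q.card + M.card := by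
    have h1 : Q ⊆ R \ M := Finset.subset_sdiff.2 ⟨h.sub, h.disj.symm⟩
    have := Finset.card_sdiff_add_card_eq_card h1
    have := Finset.card_sdiff_add_card_eq_card h.mark_sub
    omega
  have hRM : (R \ M) \ Q ∪ Q = R \ M :=
    Finset.sdiff_union_of_subset (Finset.subset_sdiff.2 ⟨h.sub, h.disj.symm⟩)
  have hR : R \ M ∪ M = R := Finset.sdiff_union_of_subset h.mark_sub
  obtain ⟨y, hy, hyq⟩ := h.fan.exists_quad hs h.even
  obtain ⟨z, hz, hzq⟩ := exists_combine hs (A := (R \ M) \ Q) (B := Q) Finset.sdiff_disjoint hx hy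
  -- `Q` brings at least as much as it has vertices, so it costs no excess.
  have hz1 : quad s ((R \ M) \ Q) x + Q.card ≤ quad s (R \ M) z := by
    rw [hRM] at hzq
    have := abs_nonneg (∑ a ∈ (R \ M) \ Q, ∑ b ∈ Q, s a b * x a * y b)
    omega
  cases h.rule with
  | none hM =>
    rw [hM, Finset.sdiff_empty] at hz1 ⊢
    rw [hM] at hc
    simp only [Finset.sdiff_empty, Finset.card_empty] at hc ⊢
    refine ⟨z, hz, ?_⟩
    push_cast
    omega
  | triple hM hac hbc hab hbad =>
    have hne1 : a ≠ c := fun h => hac (by rw [h, hs.diag])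
    have hne2 : b ≠ c := fun h => hbc (by rw [h, hs.diag])
    set w : V → ℤ := fun v => if v = a then s a c else if v = b then s b c else 1 with hw
    have hwpm : IsPM w := by
      intro v
      simp only [hw]
      split_ifs
      · exact (hs.vals a c).resolve_left hac
      · exact (hs.vals b c).resolve_left hbc
      · exact Or.inl rfl
    -- The colouring satisfies `ac` and `bc`, each worth `2`, and the pair `ab` does no harm. Three
    -- vertices bring `4`: an excess of one, which pays for three marks.
    have hwq : 4 ≤ quad s M w := by
      have wa : w a = s a c := by simp [hw]
      have wb : w b = s b c := by simp [hw, hab.symm]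
      have wc : w c = 1 := by simp [hw, hne1.symm, hne2.symm]
      rw [hM, quad]
      have ha : a ∉ ({b, c} : Finset V) := by simp [hab, hne1]
      have hb : b ∉ ({c} : Finset V) := by simp [hne2]
      simp only [Finset.sum_insert ha, Finset.sum_insert hb, Finset.sum_singleton,
        hs.diag, wa, wb, wc, hs.symm b a, hs.symm c a, hs.symm c b]
      have e1 := hs.sq hac
      have e2 := hs.sq hbc
      have e3 : 0 ≤ s a c * s a b * s b c := by
        rcases hs.vals a c with h1 | h1 | h1 <;> rcases hs.vals b c with h2 | h2 | h2 <;>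
          rcases hs.vals a b with h3 | h3 | h3 <;> simp_all
      nlinarith
    obtain ⟨z', hz', hzq'⟩ := exists_combine hs (A := R \ M) (B := M) Finset.sdiff_disjoint hz hwpm
    rw [hR] at hzq'
    have := abs_nonneg (∑ a ∈ R \ M, ∑ b ∈ M, s a b * z a * w b)
    have hM3 : M.card = 3 := by
      rw [hM]; exact Finset.card_eq_three.2 ⟨a, b, c, hab, hne1, hne2, rfl⟩
    refine ⟨z', hz', ?_⟩
    rw [hM3] at hc ⊢
    push_cast [hc]
    omega
  | odd hM hQ hodd =>
    subst hQ
    simp only [Finset.sdiff_empty] at hc hz1 ⊢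
    have h1 : IsPM fun _ : V => (1 : ℤ) := fun _ => Or.inl rfl
    obtain ⟨z', hz', hzq'⟩ := exists_combine hs (A := R \ M) (B := M) Finset.sdiff_disjoint hx h1
    rw [hR] at hzq'
    have hquad : quad s M (fun _ => 1) = 0 := by rw [hM]; simp [quad, hs.diag]
    -- The cross term of a vertex of odd degree is odd, hence not zero; it counts twice, so the
    -- single vertex brings at least `2`.
    have habs : 1 ≤ |∑ u ∈ R \ M, ∑ v ∈ M, s u v * x u * (fun _ : V => (1 : ℤ)) v| := by
      rw [hM]
      simp only [Finset.sum_singleton, mul_one]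
      refine abs_sum_pos_of_odd (fun v => ?_) ?_
      · rcases hs.vals v a with h | h | h <;> rcases hx v with h' | h' <;> simp [h, h']
      · convert hodd using 2
        ext v
        simp only [Finset.mem_filter, Finset.mem_sdiff, Finset.mem_singleton, hs.symm v a]
        have hxv : x v ≠ 0 := by rcases hx v with h' | h' <;> simp [h']
        constructor
        · rintro ⟨⟨h1, -⟩, h2⟩
          exact ⟨h1, left_ne_zero_of_mul h2⟩
        · rintro ⟨h1, h2⟩
          refine ⟨⟨h1, fun h => h2 (by rw [h, hs.diag])⟩, mul_ne_zero h2 hxv⟩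
    beta_reduce at habs hzq'
    have hM1 : M.card = 1 := by rw [hM]; simp
    refine ⟨z', hz', ?_⟩
    rw [hM1] at hc ⊢
    simp only [Finset.card_empty] at hc
    push_cast [hc]
    omega
  | twins hM hQ hpos htw =>
    subst hQ
    simp only [Finset.sdiff_empty] at hc hz1 ⊢
    have hac : s a c ≠ 0 := fun h => by rw [h] at hpos; simp at hpos
    have hbc : s b c ≠ 0 := fun h => by rw [h] at hpos; simp at hpos
    have hab0 : s a b ≠ 0 := fun h => by rw [h] at hpos; simp at hpos
    have hne1 : c ≠ a := fun h => hac (by rw [h, hs.diag])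
    have hne2 : c ≠ b := fun h => hbc (by rw [h, hs.diag])
    have hab : a ≠ b := fun h => hab0 (by rw [h, hs.diag])
    have hcM : c ∈ R \ M := by
      rw [hM]; simp [h.hub_mem, hne1, hne2]
    -- The colours of `a` and `b` are chosen to satisfy the edges to `c`; then `ab` is satisfied
    -- too, because the triangle is positive. The form on `M` is `2` and the cross term is `2`, so
    -- two vertices bring `2 + 2 * 2`.
    set w : V → ℤ := fun v => if v = a then s a c * x c else if v = b then s b c * x c else 1
      with hw
    have hwpm : IsPM w := by
      intro v
      simp only [hw]
      have hxc := hx c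
      split_ifs
      · rcases (hs.vals a c).resolve_left hac with h | h <;> rcases hxc with h' | h' <;>
          simp [h, h']
      · rcases (hs.vals b c).resolve_left hbc with h | h <;> rcases hxc with h' | h' <;>
          simp [h, h']
      · exact Or.inl rfl
    have wa : w a = s a c * x c := by simp [hw]
    have wb : w b = s b c * x c := by simp [hw, hab.symm]
    have hxc := hx.sq c
    have hwq : quad s M w = 2 := by
      rw [hM, quad]
      rw [Finset.sum_pair hab, Finset.sum_pair hab, Finset.sum_pair hab]
      simp only [hs.diag, wa, wb, hs.symm b a]
      linear_combination 2 * (x c * x c) * hpos + 2 * hxc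
    have hcross : ∑ u ∈ R \ M, ∑ v ∈ M, s u v * x u * w v = 2 := by
      rw [Finset.sum_eq_single_of_mem c hcM]
      · rw [hM, Finset.sum_pair hab, wa, wb, hs.symm c a, hs.symm c b]
        have e1 := hs.sq hac
        have e2 := hs.sq hbc
        linear_combination (x c * x c) * e1 + (x c * x c) * e2 + 2 * hxc
      · intro v hv hvc
        rw [hM] at hv
        simp only [Finset.mem_sdiff, Finset.mem_insert, Finset.mem_singleton, not_or] at hv
        rw [hM, Finset.sum_pair hab, wa, wb, hs.symm v a, hs.symm v b]
        rcases htw v hv.1 hv.2.1 hv.2.2 hvc with ⟨h1, h2⟩ | h1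
        · rw [h1, h2]; ring
        -- As `abc` is a positive and `abv` a negative triangle, exactly one of the edges from `v`
        -- to `a` and `b` is satisfied, and the two contributions cancel.
        · have key : s a v * s a c + s b v * s b c = 0 := by
            rcases hs.vals a c with h2 | h2 | h2 <;> rcases hs.vals b c with h3 | h3 | h3 <;>
              rcases hs.vals a b with h4 | h4 | h4 <;> rcases hs.vals a v with h5 | h5 | h5 <;>
              rcases hs.vals b v with h6 | h6 | h6 <;> rw [h2, h3, h4] at hpos <;>
              rw [h4, h5, h6] at h1 <;> rw [h2, h3, h5, h6] <;> revert hpos h1 <;> decide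
          linear_combination (x v * x c) * key
    obtain ⟨z', hz', hzq'⟩ := exists_combine hs (A := R \ M) (B := M) Finset.sdiff_disjoint hx hwpm
    rw [hR, hcross, hwq] at hzq'
    norm_num at hzq'
    have hM2 : M.card = 2 := by rw [hM]; exact Finset.card_pair hab
    refine ⟨z', hz', ?_⟩
    rw [hM2] at hc ⊢
    simp only [Finset.card_empty] at hc
    push_cast [hc]
    omega

end SignMatrix

/-! ### Connectivity, and negative cliques behind a single vertex. -/

namespace SignMatrix

variable {V : Type*} [DecidableEq V] {s : V → V → ℤ}

/-- Some reduction applies to `R`. -/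
def Reducible (s : V → V → ℤ) (R : Finset V) : Prop :=
  ∃ M Q a b c, (M ∪ Q).Nonempty ∧ Reduction s R M Q a b c

/-- A clique whose edges are all negative after a switch. -/
def NegClique (s : V → V → ℤ) (X : Finset V) : Prop :=
  ∃ y, IsPM y ∧ ∀ u ∈ X, ∀ v ∈ X, u ≠ v → s u v = -(y u * y v)

omit [DecidableEq V] in
theorem NegClique.ne_zero {X : Finset V} (h : NegClique s X) {u v : V} (hu : u ∈ X) (hv : v ∈ X)
    (huv : u ≠ v) : s u v ≠ 0 := by
  obtain ⟨y, hy, h⟩ := h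
  rw [h u hu v hv huv]
  rcases hy u with h1 | h1 <;> rcases hy v with h2 | h2 <;> simp [h1, h2]

omit [DecidableEq V] in
theorem NegClique.fan {X : Finset V} (h : NegClique s X) {c : V} (hc : c ∈ X) {Q : Finset V}
    (hQ : Q ⊆ X) (hcQ : c ∉ Q) : Fan s c Q := by
  have hne : ∀ u ∈ Q, c ≠ u := fun u hu huc => hcQ (huc ▸ hu)
  refine ⟨fun u hu => h.ne_zero hc (hQ hu) (hne u hu), fun u hu v hv huv => ?_⟩
  obtain ⟨y, hy, h⟩ := h
  rw [h c hc u (hQ hu) (hne u hu), h c hc v (hQ hv) (hne v hv), h u (hQ hu) v (hQ hv) huv]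
  linear_combination -(y u * y u) * (y v * y v) * hy.sq c - (y v * y v) * hy.sq u - hy.sq v

omit [DecidableEq V] in
theorem conn_singleton (v : V) : Conn s {v} := by
  intro A hA hn hne
  exact absurd ((Finset.subset_singleton_iff.1 hA).resolve_left hn.ne_empty) hne

omit [DecidableEq V] in
theorem conn_of_clique {X : Finset V} (h : ∀ u ∈ X, ∀ v ∈ X, u ≠ v → s u v ≠ 0) : Conn s X := by
  intro A hA hn hne
  obtain ⟨a, ha⟩ := hn
  obtain ⟨b, hb, hbA⟩ := Finset.exists_of_ssubset (hA.ssubset_of_ne hne)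
  exact ⟨a, ha, b, hb, hbA, h a (hA ha) b hb fun hab => hbA (hab ▸ ha)⟩

/-- A set is connected if it is covered by connected subsets that meet a connected subset. -/
theorem conn_of_cover {X Z : Finset V} (hZX : Z ⊆ X) (hZ : Conn s Z)
    (h : ∀ v ∈ X, ∃ K ⊆ X, Conn s K ∧ v ∈ K ∧ (K ∩ Z).Nonempty) : Conn s X := by
  have cut : ∀ A K : Finset V, K ⊆ X → Conn s K → (A ∩ K).Nonempty → (∃ v ∈ K, v ∉ A) →
      ∃ a ∈ A, ∃ b ∈ X, b ∉ A ∧ s a b ≠ 0 := by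
    rintro A K hK hc hn ⟨v, hv, hvA⟩
    obtain ⟨a, ha, b, hb, hbA, hab⟩ := hc (A ∩ K) Finset.inter_subset_right hn
      fun h => hvA (Finset.mem_inter.1 (h ▸ hv)).1
    exact ⟨a, (Finset.mem_inter.1 ha).1, b, hK hb,
      fun h => hbA (Finset.mem_inter.2 ⟨h, hb⟩), hab⟩
  intro A hA hn hne
  by_cases hAZ : (A ∩ Z).Nonempty
  · by_cases hZA : Z ⊆ A
    · obtain ⟨v, hv, hvA⟩ := Finset.exists_of_ssubset (hA.ssubset_of_ne hne)
      obtain ⟨K, hK, hKc, hvK, hKZ⟩ := h v hv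
      exact cut A K hK hKc (hKZ.mono fun u hu => Finset.mem_inter.2
        ⟨hZA (Finset.mem_inter.1 hu).2, (Finset.mem_inter.1 hu).1⟩) ⟨v, hvK, hvA⟩
    · obtain ⟨v, hv, hvA⟩ := Finset.not_subset.1 hZA
      exact cut A Z hZX hZ hAZ ⟨v, hv, hvA⟩
  · obtain ⟨v, hv⟩ := hn
    obtain ⟨K, hK, hKc, hvK, z, hz⟩ := h v (hA hv)
    obtain ⟨hz1, hz2⟩ := Finset.mem_inter.1 hz
    exact cut A K hK hKc ⟨v, Finset.mem_inter.2 ⟨hv, hvK⟩⟩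
      ⟨z, hz1, fun hzA => hAZ ⟨z, Finset.mem_inter.2 ⟨hzA, hz2⟩⟩⟩

theorem conn_union (hs : IsSignMatrix s) {A B : Finset V} (hA : Conn s A) (hB : Conn s B) {a b : V}
    (ha : a ∈ A) (hb : b ∈ B) (hab : s a b ≠ 0) : Conn s (A ∪ B) := by
  have hpair : Conn s {a, b} := by
    refine conn_of_clique fun u hu v hv huv => ?_
    simp only [Finset.mem_insert, Finset.mem_singleton] at hu hv
    rcases hu with rfl | rfl <;> rcases hv with rfl | rfl
    · exact absurd rfl huv
    · exact hab
    · rwa [hs.symm]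
    · exact absurd rfl huv
  have hp : {a, b} ⊆ A ∪ B := by
    intro u hu
    simp only [Finset.mem_insert, Finset.mem_singleton] at hu
    rcases hu with rfl | rfl
    · exact Finset.mem_union_left _ ha
    · exact Finset.mem_union_right _ hb
  refine conn_of_cover hp hpair fun v hv => ?_
  rcases Finset.mem_union.1 hv with hv | hv
  · exact ⟨A, Finset.subset_union_left, hA, hv, a, by simp [ha]⟩
  · exact ⟨B, Finset.subset_union_right, hB, hv, b, by simp [hb]⟩

theorem conn_insert (hs : IsSignMatrix s) {A : Finset V} (hA : Conn s A) {a v : V}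
    (ha : a ∈ A) (hab : s v a ≠ 0) : Conn s (insert v A) :=
  conn_union hs (conn_singleton v) hA (Finset.mem_singleton_self v) ha hab

/-- `C` has no edges to the rest of `Y`. -/
def ClosedIn (s : V → V → ℤ) (C Y : Finset V) : Prop := ∀ u ∈ C, ∀ v ∈ Y, v ∉ C → s u v = 0

/-- A largest connected subset that contains `v` has no further neighbours in `Y`, since a neighbour
could be added. -/
theorem exists_component (hs : IsSignMatrix s) {Y : Finset V} {v : V} (hv : v ∈ Y) :
    ∃ C ⊆ Y, v ∈ C ∧ Conn s C ∧ ClosedIn s C Y := by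
  classical
  obtain ⟨C, hC, hmax⟩ := Finset.exists_max_image
    (Y.powerset.filter fun C => v ∈ C ∧ Conn s C) Finset.card
    ⟨{v}, by simp [hv, conn_singleton]⟩
  simp only [Finset.mem_filter, Finset.mem_powerset] at hC hmax
  refine ⟨C, hC.1, hC.2.1, hC.2.2, fun u hu w hw hwC => ?_⟩
  by_contra huw
  have := hmax (insert w C) ⟨Finset.insert_subset hw hC.1, Finset.mem_insert_of_mem hC.2.1,
    conn_insert hs hC.2.2 hu (by rwa [hs.symm])⟩
  rw [Finset.card_insert_of_notMem hwC] at this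
  omega

theorem Conn.subset_of_closedIn {C D Y : Finset V} (hD : Conn s D) (hDY : D ⊆ Y)
    (hC : ClosedIn s C Y) (h : (C ∩ D).Nonempty) : D ⊆ C := by
  by_contra hDC
  obtain ⟨v, hv, hvC⟩ := Finset.not_subset.1 hDC
  obtain ⟨a, ha, b, hb, hbA, hab⟩ := hD (C ∩ D) Finset.inter_subset_right h
    fun h => hvC (Finset.mem_inter.1 (h ▸ hv)).1
  exact hab (hC a (Finset.mem_inter.1 ha).1 b (hDY hb)
    fun h => hbA (Finset.mem_inter.2 ⟨h, hb⟩))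

/-- The rule uses one vertex only; `a` also fills the places of `b` and of the hub. -/
theorem reducible_of_odd {R : Finset V} {a : V} (ha : a ∈ R) (hn : (R \ {a}).Nonempty)
    (hc : Conn s (R \ {a})) (hodd : Odd (R.filter fun v => s a v ≠ 0).card) : Reducible s R :=
  ⟨{a}, ∅, a, a, a, by simp, {
    mark_sub := by simpa using ha
    sub := by simp
    disj := by simp
    hub_mem := ha
    hub_not_mem := by simp
    fan := ⟨by simp, by simp⟩
    even := by simp
    closed := by simp
    nonempty := by simpa using hn
    conn := by simpa using hc
    rule := .odd rfl rfl hodd }⟩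

/-- A negative clique hanging at one vertex can be removed. -/
theorem reducible_of_hanging (hs : IsSignMatrix s) {R C : Finset V} {x : V} (hx : x ∈ R)
    (hxC : x ∉ C) (hCR : C ⊆ R) (hn : C.Nonempty) (hneg : NegClique s (insert x C))
    (hcl : ∀ u ∈ C, ∀ v ∈ R, v ∉ C → s u v ≠ 0 → v = x) (hconn : Conn s (R \ C)) :
    Reducible s R := by
  have hxR : x ∈ R \ C := Finset.mem_sdiff.2 ⟨hx, hxC⟩
  -- An even `C` is deleted unmarked, with hub `x`. If `C` is odd, any `a` in it is adjacent exactly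
  -- to `x` and the rest of `C`, so its degree `|C|` is odd, and the others stay joined to `x`
  -- without it.
  rcases Nat.even_or_odd C.card with he | ho
  · refine ⟨∅, C, x, x, x, by simpa using hn, {
      mark_sub := by simp
      sub := hCR
      disj := by simp
      hub_mem := hx
      hub_not_mem := hxC
      fan := hneg.fan (Finset.mem_insert_self _ _) (Finset.subset_insert _ _) hxC
      even := he
      closed := fun u hu v hv _ hvC => hcl u hu v hv hvC
      nonempty := by simpa using ⟨x, hxR⟩
      conn := by simpa using hconn
      rule := .none rfl }⟩
  · obtain ⟨a, ha⟩ := hn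
    have hxa : x ≠ a := fun h => hxC (h ▸ ha)
    refine reducible_of_odd (hCR ha) ⟨x, by simp [hx, hxa]⟩ ?_ ?_
    · refine conn_of_cover (Z := R \ C) ?_ hconn fun v hv => ?_
      · exact Finset.sdiff_subset_sdiff le_rfl (by simpa using ha)
      · by_cases hvC : v ∈ C
        · refine ⟨insert v (R \ C), ?_, conn_insert hs hconn hxR
            (hneg.ne_zero (Finset.mem_insert_of_mem hvC) (Finset.mem_insert_self _ _)
              fun h => hxC (h ▸ hvC)), Finset.mem_insert_self _ _, x, by simp [hx, hxC]⟩
          exact Finset.insert_subset hv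
            (Finset.sdiff_subset_sdiff le_rfl (by simpa using ha))
        · have : v ∈ R \ C := Finset.mem_sdiff.2 ⟨(Finset.mem_sdiff.1 hv).1, hvC⟩
          exact ⟨R \ C, Finset.sdiff_subset_sdiff le_rfl (by simpa using ha), hconn, this,
            v, by simpa using this⟩
    · have : R.filter (fun v => s a v ≠ 0) = insert x (C.erase a) := by
        ext v
        simp only [Finset.mem_filter, Finset.mem_insert, Finset.mem_erase]
        constructor
        · rintro ⟨hv, hav⟩
          by_cases hvC : v ∈ C
          · exact Or.inr ⟨fun h => hav (by rw [h, hs.diag]), hvC⟩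
          · exact Or.inl (hcl a ha v hv hvC hav)
        · rintro (rfl | ⟨h1, h2⟩)
          · exact ⟨hx, hneg.ne_zero (Finset.mem_insert_of_mem ha) (Finset.mem_insert_self _ _)
              hxa.symm⟩
          · exact ⟨hCR h2, hneg.ne_zero (Finset.mem_insert_of_mem ha)
              (Finset.mem_insert_of_mem h2) h1.symm⟩
      rw [this, Finset.card_insert_of_notMem (by simp [hxC]), Finset.card_erase_of_mem ha]
      rwa [Nat.sub_add_cancel (Finset.card_pos.2 ⟨a, ha⟩)]

/-- If all triangles at `q` over the negative clique `C` are of the same type, then `q` extends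
the clique. -/
theorem negClique_insert (hs : IsSignMatrix s) {C : Finset V} {q : V} {y : V → ℤ}
    (hqC : q ∉ C) (hy : IsPM y) (hC : ∀ u ∈ C, ∀ v ∈ C, u ≠ v → s u v = -(y u * y v))
    (ht : ∀ u ∈ C, ∀ v ∈ C, s q u * y u = s q v * y v) (hadj : ∃ c ∈ C, s q c ≠ 0) :
    NegClique s (insert q C) := by
  obtain ⟨c, hc, hqc⟩ := hadj
  have hpm : s q c = 1 ∨ s q c = -1 := (hs.vals q c).resolve_left hqc
  -- This dictates the colour `-(s q c * y c)` for `q`; equality of types makes it right for all of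
  -- `C`.
  have hq : ∀ u ∈ C, s q u = -(-(s q c * y c) * y u) := fun u hu => by
    linear_combination y u * ht u hu c hc - s q u * hy.sq u
  have hne : ∀ u ∈ C, u ≠ q := fun u hu h => hqC (h ▸ hu)
  refine ⟨Function.update y q (-(s q c * y c)), fun v => ?_, fun u hu v hv huv => ?_⟩
  · by_cases hv : v = q
    · rw [hv, Function.update_self]
      rcases hpm with h | h <;> rcases hy c with h' | h' <;> simp [h, h']
    · rw [Function.update_of_ne hv]; exact hy v
  · rcases Finset.mem_insert.1 hu with rfl | hu'
    · have hv' := (Finset.mem_insert.1 hv).resolve_left huv.symm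
      rw [Function.update_self, Function.update_of_ne (hne v hv')]
      exact hq v hv'
    · rcases Finset.mem_insert.1 hv with rfl | hv'
      · rw [Function.update_self, Function.update_of_ne huv, hs.symm, hq u hu']; ring
      · rw [Function.update_of_ne (hne u hu'), Function.update_of_ne (hne v hv')]
        exact hC u hu' v hv' huv

/-- A negative clique that is separated from the rest by one vertex allows a reduction. -/
theorem reducible_of_separated (hs : IsSignMatrix s) {R C : Finset V} {q : V} (hq : q ∈ R)
    (hqC : q ∉ C) (hCR : C ⊆ R) (hneg : NegClique s C)
    (hcl : ∀ u ∈ C, ∀ v ∈ R, v ∉ C → s u v ≠ 0 → v = q) (hconn : Conn s (R \ C))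
    (hadj : ∃ c ∈ C, s q c ≠ 0) : Reducible s R := by
  obtain ⟨c, hc, hqc⟩ := hadj
  have hqRC : q ∈ R \ C := Finset.mem_sdiff.2 ⟨hq, hqC⟩
  obtain ⟨y, hy, hCy⟩ := id hneg
  -- The type `s q u * y u` is `0` for a missing edge. If all types agree, `C` hangs at `q`.
  by_cases ht : ∀ u ∈ C, ∀ v ∈ C, s q u * y u = s q v * y v
  · exact reducible_of_hanging hs hq hqC hCR ⟨c, hc⟩
      (negClique_insert hs hqC hy hCy ht ⟨c, hc, hqc⟩) hcl hconn
  push Not at ht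
  obtain ⟨a, ha, b, hb, hab⟩ := ht
  have hne : a ≠ b := fun h => hab (by rw [h])
  -- If `c` is the only neighbour of `q` in `C`, the rest of `C` hangs at `c`.
  by_cases huniq : ∀ z ∈ C, s q z ≠ 0 → z = c
  · have hsd : R \ C.erase c = insert c (R \ C) := by
      ext v
      simp only [Finset.mem_sdiff, Finset.mem_erase, Finset.mem_insert, not_and_or, not_not]
      constructor
      · rintro ⟨h1, h2 | h2⟩
        · exact Or.inl h2
        · exact Or.inr ⟨h1, h2⟩
      · rintro (rfl | ⟨h1, h2⟩)
        · exact ⟨hCR hc, Or.inl rfl⟩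
        · exact ⟨h1, Or.inr h2⟩
    refine reducible_of_hanging hs (hCR hc) (Finset.notMem_erase c C)
      ((Finset.erase_subset _ _).trans hCR) ?_ (by rwa [Finset.insert_erase hc]) ?_ ?_
    · by_cases hac : a = c
      · exact ⟨b, Finset.mem_erase.2 ⟨fun h => hne (hac.trans h.symm), hb⟩⟩
      · exact ⟨a, Finset.mem_erase.2 ⟨hac, ha⟩⟩
    · intro u hu v hv hvC huv
      obtain ⟨hu1, hu2⟩ := Finset.mem_erase.1 hu
      by_contra hvc
      have hvC' : v ∉ C := fun h => hvC (Finset.mem_erase.2 ⟨hvc, h⟩)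
      have := hcl u hu2 v hv hvC' huv
      subst this
      exact hu1 (huniq u hu2 (by rwa [hs.symm]))
    · rw [hsd]
      exact conn_insert hs hconn hqRC (by rwa [hs.symm])
  push Not at huniq
  obtain ⟨c', hc', hqc', hcc'⟩ := huniq
  by_contra hred
  -- As `q` has two neighbours in `C`, deleting one vertex of `C` never disconnects the rest, so an
  -- odd degree would allow a reduction.
  have heven : ∀ v ∈ C, ¬ Odd (R.filter fun w => s v w ≠ 0).card := by
    intro v hv hodd
    refine hred (reducible_of_odd (hCR hv) ⟨q, ?_⟩ ?_ hodd)
    · simp only [Finset.mem_sdiff, Finset.mem_singleton]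
      exact ⟨hq, fun h => hqC (h ▸ hv)⟩
    obtain ⟨x, hx, hxv, hqx⟩ : ∃ x ∈ C, x ≠ v ∧ s q x ≠ 0 := by
      by_cases h : c = v
      · exact ⟨c', hc', fun h' => hcc' (h'.trans h.symm), hqc'⟩
      · exact ⟨c, hc, h, hqc⟩
    have hRv : R \ {v} = (R \ C) ∪ C.erase v := by
      ext w
      simp only [Finset.mem_sdiff, Finset.mem_singleton, Finset.mem_union, Finset.mem_erase]
      constructor
      · rintro ⟨h1, h2⟩
        by_cases hw : w ∈ C
        · exact Or.inr ⟨h2, hw⟩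
        · exact Or.inl ⟨h1, hw⟩
      · rintro (⟨h1, h2⟩ | ⟨h1, h2⟩)
        · exact ⟨h1, fun h => h2 (h ▸ hv)⟩
        · exact ⟨hCR h2, h1⟩
    rw [hRv]
    refine conn_union hs hconn (conn_of_clique fun u hu w hw huw => ?_) hqRC
      (Finset.mem_erase.2 ⟨hxv, hx⟩) hqx
    exact hneg.ne_zero (Finset.mem_of_mem_erase hu) (Finset.mem_of_mem_erase hw) huw
  have hdeg : ∀ v ∈ C, (R.filter fun w => s v w ≠ 0).card =
      if s q v ≠ 0 then C.card else C.card - 1 := by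
    intro v hv
    have hqv : q ≠ v := fun h => hqC (h ▸ hv)
    have hpos := Finset.card_pos.2 ⟨v, hv⟩
    split_ifs with h
    · have : R.filter (fun w => s v w ≠ 0) = insert q (C.erase v) := by
        ext w
        simp only [Finset.mem_filter, Finset.mem_insert, Finset.mem_erase]
        constructor
        · rintro ⟨h1, h2⟩
          by_cases hw : w ∈ C
          · exact Or.inr ⟨fun h => h2 (by rw [h, hs.diag]), hw⟩
          · exact Or.inl (hcl v hv w h1 hw h2)
        · rintro (rfl | ⟨h1, h2⟩)
          · exact ⟨hq, by rwa [hs.symm]⟩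
          · exact ⟨hCR h2, hneg.ne_zero hv h2 h1.symm⟩
      rw [this, Finset.card_insert_of_notMem (by simp [hqC]), Finset.card_erase_of_mem hv]
      omega
    · have : R.filter (fun w => s v w ≠ 0) = C.erase v := by
        ext w
        simp only [Finset.mem_filter, Finset.mem_erase]
        constructor
        · rintro ⟨h1, h2⟩
          by_cases hw : w ∈ C
          · exact ⟨fun h => h2 (by rw [h, hs.diag]), hw⟩
          · have := hcl v hv w h1 hw h2
            subst this
            exact absurd (by rwa [hs.symm]) h
        · rintro ⟨h1, h2⟩
          exact ⟨hCR h2, hneg.ne_zero hv h2 h1.symm⟩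
      rw [this, Finset.card_erase_of_mem hv]
  -- The degrees `|C|` of the neighbours of `q` and `|C| - 1` of the other vertices cannot both be
  -- even.
  have hall : ∀ v ∈ C, s q v ≠ 0 := by
    intro v hv h0
    have h1 := heven c hc
    have h2 := heven v hv
    rw [hdeg c hc, if_pos hqc] at h1
    rw [hdeg v hv, if_neg (by simpa using h0)] at h2
    have hpos := Finset.card_pos.2 ⟨v, hv⟩
    rw [Nat.not_odd_iff_even] at h1 h2
    obtain ⟨i, hi⟩ := h1
    obtain ⟨j, hj⟩ := h2
    omega
  have haq : q ≠ a := fun h => hqC (h ▸ ha)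
  have hbq : q ≠ b := fun h => hqC (h ▸ hb)
  have hsub : R \ C ⊆ R \ {a, b} := by
    refine Finset.sdiff_subset_sdiff le_rfl ?_
    intro v hv
    simp only [Finset.mem_insert, Finset.mem_singleton] at hv
    rcases hv with rfl | rfl
    · exact ha
    · exact hb
  -- Vertices `a` and `b` of different nonzero types span a positive triangle with `q` and a
  -- negative one with every other vertex of `C`, and they have no further neighbours: the twins
  -- rule applies with `q` as the third vertex.
  refine hred ⟨{a, b}, ∅, a, b, q, by simp, {
    mark_sub := by
      intro v hv
      simp only [Finset.mem_insert, Finset.mem_singleton] at hv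
      rcases hv with rfl | rfl
      · exact hCR ha
      · exact hCR hb
    sub := by simp
    disj := by simp
    hub_mem := hq
    hub_not_mem := by simp
    fan := ⟨by simp, by simp⟩
    even := by simp
    closed := by simp
    nonempty := ⟨q, by simp [hq, haq, hbq]⟩
    conn := ?_
    rule := .twins rfl rfl ?_ ?_ }⟩
  · rw [Finset.sdiff_empty]
    refine conn_of_cover hsub hconn fun v hv => ?_
    by_cases hvC : v ∈ C
    · exact ⟨insert v (R \ C), Finset.insert_subset hv hsub,
        conn_insert hs hconn hqRC (by rw [hs.symm]; exact hall v hvC),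
        Finset.mem_insert_self _ _, q, by simp [hq, hqC]⟩
    · have : v ∈ R \ C := Finset.mem_sdiff.2 ⟨(Finset.mem_sdiff.1 hv).1, hvC⟩
      exact ⟨R \ C, hsub, hconn, this, v, by simpa using this⟩
  · rw [hs.symm a q, hs.symm b q, hCy a ha b hb hne]
    rcases (hs.vals q a).resolve_left (hall a ha) with h1 | h1 <;>
      rcases (hs.vals q b).resolve_left (hall b hb) with h2 | h2 <;>
      rcases hy a with h3 | h3 <;> rcases hy b with h4 | h4 <;>
      rw [h1, h2, h3, h4] at hab <;> rw [h1, h2, h3, h4] <;> revert hab <;> decide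
  · intro w hw hwa hwb hwq
    by_cases hwC : w ∈ C
    · right
      rw [hCy a ha w hwC hwa.symm, hCy b hb w hwC hwb.symm, hCy a ha b hb hne]
      linear_combination -(y a * y a) * (y b * y b) * hy.sq w - (y b * y b) * hy.sq a - hy.sq b
    · left
      constructor
      · by_contra h
        exact hwq (hcl a ha w hw hwC h)
      · by_contra h
        exact hwq (hcl b hb w hw hwC h)

end SignMatrix

/-! ### Negative cliques attached to the rest and to one further vertex. -/

namespace SignMatrix

variable {V : Type*} [DecidableEq V] {s : V → V → ℤ}

/-- A negative clique `C` attached to `Z` and to one further vertex `q`. -/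
theorem reducible_or_exists_end (hs : IsSignMatrix s) {R C Z : Finset V} {q : V}
    (hq : q ∈ R) (hqC : q ∉ C) (hCR : C ⊆ R) (hneg : NegClique s C)
    (hcl : ∀ u ∈ C, ∀ v ∈ R, v ∉ C → s u v ≠ 0 → v = q ∨ v ∈ Z) (hconn : Conn s (R \ C))
    (hadj : ∃ c ∈ C, s q c ≠ 0) (hZ : ∃ u ∈ C, ∃ z ∈ Z, s u z ≠ 0) :
    Reducible s R ∨ ∃ y ∈ C, s q y ≠ 0 ∧ (C = {y} ∨ ∃ u ∈ C, u ≠ y ∧ ∃ z ∈ Z, s u z ≠ 0) := by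
  by_contra! ⟨hred, hno⟩
  obtain ⟨c, hc, hqc⟩ := hadj
  -- Hence one vertex `u₀` is the only neighbour of `q` in `C` and also the only vertex of `C`
  -- attached to `Z`, and the rest of `C` hangs at it.
  have hA : ∀ y ∈ C, s q y ≠ 0 → ∀ u ∈ C, (∃ z ∈ Z, s u z ≠ 0) → u = y := by
    intro y hy hqy u hu hz
    by_contra huy
    obtain ⟨z, hz, huz⟩ := hz
    exact huz ((hno y hy hqy).2 u hu huy z hz)
  obtain ⟨u₀, hu₀, hz₀⟩ := hZ
  have hu₀c := hA c hc hqc u₀ hu₀ hz₀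
  subst hu₀c
  have huniq : ∀ y ∈ C, s q y ≠ 0 → y = u₀ := fun y hy hqy => (hA y hy hqy u₀ hu₀ hz₀).symm
  have hsd : R \ C.erase u₀ = insert u₀ (R \ C) := by
    ext v
    simp only [Finset.mem_sdiff, Finset.mem_erase, Finset.mem_insert, not_and_or, not_not]
    constructor
    · rintro ⟨h1, h2 | h2⟩
      · exact Or.inl h2
      · exact Or.inr ⟨h1, h2⟩
    · rintro (rfl | ⟨h1, h2⟩)
      · exact ⟨hCR hc, Or.inl rfl⟩
      · exact ⟨h1, Or.inr h2⟩
  refine hred (reducible_of_hanging hs (hCR hc) (Finset.notMem_erase u₀ C)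
    ((Finset.erase_subset _ _).trans hCR) ?_ (by rwa [Finset.insert_erase hc]) ?_ ?_)
  · rw [Finset.nonempty_iff_ne_empty]
    intro h0
    refine (hno u₀ hc hqc).1 ?_
    rw [← Finset.insert_erase hc, h0, insert_empty_eq]
  · intro u hu v hv hvC huv
    obtain ⟨hu1, hu2⟩ := Finset.mem_erase.1 hu
    by_contra hvc
    have hvC' : v ∉ C := fun h => hvC (Finset.mem_erase.2 ⟨hvc, h⟩)
    rcases hcl u hu2 v hv hvC' huv with rfl | hvZ
    · exact hu1 (huniq u hu2 (by rwa [hs.symm]))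
    · exact hu1 (hA u₀ hc hqc u hu2 ⟨v, hvZ, huv⟩)
  · rw [hsd]
    exact conn_insert hs hconn (Finset.mem_sdiff.2 ⟨hq, hqC⟩) (by rwa [hs.symm])

/-- A negative clique that together with one vertex `q` hangs at the connected set `Z`. -/
theorem reducible_or_negClique_insert (hs : IsSignMatrix s) {R C Z : Finset V} {q : V}
    (hqC : q ∉ C) (hqZ : q ∉ Z) (hCZ : Disjoint C Z) (hR : R = insert q (C ∪ Z))
    (hneg : NegClique s C) (hZc : Conn s Z) (hconn : Conn s (R \ C))
    (hadj : ∃ c ∈ C, s q c ≠ 0) (hZ : ∃ u ∈ C, ∃ z ∈ Z, s u z ≠ 0) :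
    Reducible s R ∨ NegClique s (insert q C) := by
  have hq : q ∈ R := by rw [hR]; exact Finset.mem_insert_self _ _
  have hCR : C ⊆ R := by
    rw [hR]; exact Finset.subset_union_left.trans (Finset.subset_insert _ _)
  have hZR : Z ⊆ R := by
    rw [hR]; exact Finset.subset_union_right.trans (Finset.subset_insert _ _)
  have hmem : ∀ v ∈ R, v = q ∨ v ∈ C ∨ v ∈ Z := fun v hv => by
    rw [hR] at hv; simpa using hv
  have hCZ' : ∀ v ∈ C, v ∉ Z := fun v hv => Finset.disjoint_left.1 hCZ hv
  have hneC : ∀ v ∈ C, v ≠ q := fun v hv h => hqC (h ▸ hv)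
  by_contra! ⟨hred, hnot⟩
  obtain ⟨y, hy, hCy⟩ := id hneg
  have ht : ¬ ∀ u ∈ C, ∀ v ∈ C, s q u * y u = s q v * y v :=
    fun ht => hnot (negClique_insert hs hqC hy hCy ht hadj)
  push Not at ht
  obtain ⟨a, ha, b, hb, hab⟩ := ht
  -- Vertices of different types never span a negative triangle with `q`; this includes the case
  -- that one of the edges to `q` is missing.
  have hbad : ∀ u v, u ∈ C → v ∈ C → s q u * y u ≠ s q v * y v →
      s q u * s q v * s u v ≠ -1 := by
    intro u v hu hv huv h
    have hne : u ≠ v := fun h => huv (by rw [h])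
    rw [hCy u hu v hv hne] at h
    rcases hs.vals q u with h1 | h1 | h1 <;> rcases hs.vals q v with h2 | h2 | h2 <;>
      rcases hy u with h3 | h3 <;> rcases hy v with h4 | h4 <;>
      rw [h1, h2, h3, h4] at h huv <;> revert h huv <;> decide
  -- The triple rule for `q`, `u`, `v` fails only if it cuts the rest of `C` off from `Z`: then `C`
  -- has further vertices, but none of them is attached to `Z`.
  have hpair : ∀ u ∈ C, ∀ v ∈ C, s q u * y u ≠ s q v * y v → C ≠ {u, v} ∧
      ∀ w ∈ C, (∃ z ∈ Z, s w z ≠ 0) → w = u ∨ w = v := by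
    -- The middle vertex of the path must be a neighbour of `q`. One of `u`, `v` is, since two zero
    -- types would agree.
    suffices H : ∀ u ∈ C, ∀ v ∈ C, s q u * y u ≠ s q v * y v → s q u ≠ 0 → C ≠ {u, v} ∧
        ∀ w ∈ C, (∃ z ∈ Z, s w z ≠ 0) → w = u ∨ w = v by
      intro u hu v hv huv
      by_cases hqu : s q u = 0
      · have hqv : s q v ≠ 0 := fun h => huv (by rw [hqu, h]; ring)
        obtain ⟨h1, h2⟩ := H v hv u hu huv.symm hqv
        exact ⟨by rwa [Finset.pair_comm], fun w hw hz => (h2 w hw hz).symm⟩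
      · exact H u hu v hv huv hqu
    intro u hu v hv huv hqu
    have hne : u ≠ v := fun h => huv (by rw [h])
    by_contra hcon
    have hex : C = {u, v} ∨ ∃ w ∈ C, w ≠ u ∧ w ≠ v ∧ ∃ z ∈ Z, s w z ≠ 0 := by
      by_cases hC : C = {u, v}
      · exact Or.inl hC
      · right
        by_contra hno
        push Not at hno
        refine hcon ⟨hC, fun w hw hz => ?_⟩
        by_contra hw'
        push Not at hw'
        obtain ⟨z, hz, hwz⟩ := hz
        exact hwz (hno w hw hw'.1 hw'.2 z hz)
    obtain ⟨u₁, hu₁, z₁, hz₁, -⟩ := hZ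
    have hZsub : Z ⊆ R \ {q, v, u} := by
      intro z hz
      simp only [Finset.mem_sdiff, Finset.mem_insert, Finset.mem_singleton, not_or]
      exact ⟨hZR hz, fun h => hqZ (h ▸ hz), fun h => hCZ' v hv (h ▸ hz),
        fun h => hCZ' u hu (h ▸ hz)⟩
    refine hred ⟨{q, v, u}, ∅, q, v, u, by simp, {
      mark_sub := by
        intro w hw
        simp only [Finset.mem_insert, Finset.mem_singleton] at hw
        rcases hw with rfl | rfl | rfl
        · exact hq
        · exact hCR hv
        · exact hCR hu
      sub := by simp
      disj := by simp
      hub_mem := hCR hu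
      hub_not_mem := by simp
      fan := ⟨by simp, by simp⟩
      even := by simp
      closed := by simp
      nonempty := by simpa only [Finset.sdiff_empty] using ⟨z₁, hZsub hz₁⟩
      conn := ?_
      rule := .triple rfl hqu (hneg.ne_zero hv hu hne.symm) (hneC v hv).symm ?_ }⟩
    · rw [Finset.sdiff_empty]
      refine conn_of_cover hZsub hZc fun w hw => ?_
      simp only [Finset.mem_sdiff, Finset.mem_insert, Finset.mem_singleton, not_or] at hw
      rcases hmem w hw.1 with h | hwC | hwZ
      · exact absurd h hw.2.1
      · rcases hex with hC | ⟨x, hx, hxu, hxv, z, hz, hxz⟩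
        · rw [hC] at hwC
          simp only [Finset.mem_insert, Finset.mem_singleton] at hwC
          rcases hwC with h | h
          · exact absurd h hw.2.2.2
          · exact absurd h hw.2.2.1
        · have hsub : C \ {u, v} ⊆ R \ {q, v, u} := by
            intro x hx
            simp only [Finset.mem_sdiff, Finset.mem_insert, Finset.mem_singleton, not_or] at hx ⊢
            exact ⟨hCR hx.1, hneC x hx.1, hx.2.2, hx.2.1⟩
          refine ⟨C \ {u, v} ∪ Z, Finset.union_subset hsub hZsub,
            conn_union hs (conn_of_clique fun i hi j hj hij => ?_) hZc (a := x) ?_ hz hxz,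
            Finset.mem_union_left _ ?_, z, by simp [hz]⟩
          · exact hneg.ne_zero (Finset.mem_sdiff.1 hi).1 (Finset.mem_sdiff.1 hj).1 hij
          · simp [hx, hxu, hxv]
          · simp [hwC, hw.2.2.1, hw.2.2.2]
      · exact ⟨Z, hZsub, hZc, hwZ, w, by simp [hwZ]⟩
    · rw [hs.symm v u]
      exact hbad u v hu hv huv
  have hne : a ≠ b := fun h => hab (by rw [h])
  obtain ⟨u₀, hu₀, hz₀⟩ := hZ
  obtain ⟨hCab, hAab⟩ := hpair a ha b hb hab
  -- the only vertex of `C` with a neighbour in `Z` has its own type, all others agree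
  obtain ⟨x, b', hx, hb', hxb, hAx⟩ : ∃ x b', x ∈ C ∧ b' ∈ C ∧ s q x * y x ≠ s q b' * y b' ∧
      ∀ w ∈ C, (∃ z ∈ Z, s w z ≠ 0) → w = x := by
    obtain ⟨w, hw, hwa, hwb⟩ : ∃ w ∈ C, w ≠ a ∧ w ≠ b := by
      by_contra! hno
      refine hCab (Finset.Subset.antisymm (fun w hw => ?_) ?_)
      · by_cases h : w = a
        · simp [h]
        · simp [hno w hw h]
      · intro w hw
        simp only [Finset.mem_insert, Finset.mem_singleton] at hw
        rcases hw with rfl | rfl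
        · exact ha
        · exact hb
    by_cases hwt : s q w * y w = s q a * y a
    · refine ⟨b, a, hb, ha, hab.symm, fun v hv hz => ?_⟩
      have h2 := (hpair w hw b hb (by rw [hwt]; exact hab)).2 v hv hz
      rcases hAab v hv hz with h | h
      · rcases h2 with h' | h'
        · exact absurd (h'.symm.trans h) hwa
        · exact h'
      · exact h
    · refine ⟨a, b, ha, hb, hab, fun v hv hz => ?_⟩
      have h2 := (hpair w hw a ha hwt).2 v hv hz
      rcases hAab v hv hz with h | h
      · exact h
      · rcases h2 with h' | h'
        · exact absurd (h'.symm.trans h) hwb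
        · exact h'
  have hu₀x := hAx u₀ hu₀ hz₀
  subst hu₀x
  have hsame : ∀ u ∈ C, ∀ v ∈ C, u ≠ u₀ → v ≠ u₀ → s q u * y u = s q v * y v := by
    intro u hu v hv hux hvx
    by_contra huv
    rcases (hpair u hu v hv huv).2 u₀ hx hz₀ with h | h
    · exact hux h.symm
    · exact hvx h.symm
  have hb'x : b' ≠ u₀ := fun h => hxb (by rw [h])
  have hcard : 3 ≤ C.card := by
    have h1 : ({a, b} : Finset V) ⊂ C := by
      refine Finset.ssubset_iff_subset_ne.2 ⟨?_, fun h => hCab h.symm⟩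
      intro w hw
      simp only [Finset.mem_insert, Finset.mem_singleton] at hw
      rcases hw with rfl | rfl
      · exact ha
      · exact hb
    have := Finset.card_lt_card h1
    rw [Finset.card_pair hne] at this
    omega
  have hsd : R \ C.erase u₀ = insert u₀ (R \ C) := by
    ext v
    simp only [Finset.mem_sdiff, Finset.mem_erase, Finset.mem_insert, not_and_or, not_not]
    constructor
    · rintro ⟨h1, h2 | h2⟩
      · exact Or.inl h2
      · exact Or.inr ⟨h1, h2⟩
    · rintro (rfl | ⟨h1, h2⟩)
      · exact ⟨hCR hx, Or.inl rfl⟩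
      · exact ⟨h1, Or.inr h2⟩
  -- If the common type of the vertices other than `u₀` is zero, then `u₀` is the only neighbour of
  -- `q` and the rest of `C` hangs at it. Otherwise `q` is adjacent to all of them.
  by_cases hqb : s q b' = 0
  · have hzero : ∀ u ∈ C, u ≠ u₀ → s q u = 0 := by
      intro u hu hux
      have h := hsame u hu b' hb' hux hb'x
      rw [hqb, zero_mul] at h
      rcases hy u with h' | h' <;> rw [h'] at h <;> omega
    have hqx : s q u₀ ≠ 0 := by
      obtain ⟨c, hc, hqc⟩ := hadj
      by_cases h : c = u₀
      · rwa [← h]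
      · exact absurd (hzero c hc h) hqc
    refine hred (reducible_of_hanging hs (hCR hx) (Finset.notMem_erase u₀ C)
      ((Finset.erase_subset _ _).trans hCR) ⟨b', Finset.mem_erase.2 ⟨hb'x, hb'⟩⟩
      (by rwa [Finset.insert_erase hx]) ?_ ?_)
    · intro u hu v hv hvC huv
      obtain ⟨hu1, hu2⟩ := Finset.mem_erase.1 hu
      by_contra hvc
      have hvC' : v ∉ C := fun h => hvC (Finset.mem_erase.2 ⟨hvc, h⟩)
      rcases hmem v hv with rfl | h | h
      · exact huv (by rw [hs.symm]; exact hzero u hu2 hu1)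
      · exact hvC' h
      · exact hu1 (hAx u hu2 ⟨v, h, huv⟩)
    · rw [hsd]
      exact conn_insert hs hconn (Finset.mem_sdiff.2 ⟨hq, hqC⟩) (by rwa [hs.symm])
  · have hnz : ∀ u ∈ C, u ≠ u₀ → s q u ≠ 0 := by
      intro u hu hux h0
      have h := hsame u hu b' hb' hux hb'x
      rw [h0, zero_mul] at h
      rcases hy b' with h' | h' <;> rw [h'] at h <;> omega
    -- The neighbours of `b'` are `q` and the rest of `C`, so its degree is `|C|`; deleting it
    -- disconnects nothing, because `u₀` is still attached to `Z`.
    have heven : Even C.card := by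
      rw [← Nat.not_odd_iff_even]
      intro hodd
      obtain ⟨z, hz, hxz⟩ := hz₀
      have hRb : R \ {b'} = (R \ C) ∪ C.erase b' := by
        ext w
        simp only [Finset.mem_sdiff, Finset.mem_singleton, Finset.mem_union, Finset.mem_erase]
        constructor
        · rintro ⟨h1, h2⟩
          by_cases hw : w ∈ C
          · exact Or.inr ⟨h2, hw⟩
          · exact Or.inl ⟨h1, hw⟩
        · rintro (⟨h1, h2⟩ | ⟨h1, h2⟩)
          · exact ⟨h1, fun h => h2 (h ▸ hb')⟩
          · exact ⟨hCR h2, h1⟩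
      refine hred (reducible_of_odd (hCR hb') ⟨q, by simp [hq, (hneC b' hb').symm]⟩ ?_ ?_)
      · rw [hRb]
        refine conn_union hs hconn (conn_of_clique fun u hu w hw huw => ?_) (a := z) (b := u₀)
          ?_ (Finset.mem_erase.2 ⟨hb'x.symm, hx⟩) (by rwa [hs.symm])
        · exact hneg.ne_zero (Finset.mem_of_mem_erase hu) (Finset.mem_of_mem_erase hw) huw
        · exact Finset.mem_sdiff.2 ⟨hZR hz, fun h => hCZ' z h hz⟩
      · have : R.filter (fun w => s b' w ≠ 0) = insert q (C.erase b') := by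
          ext w
          simp only [Finset.mem_filter, Finset.mem_insert, Finset.mem_erase]
          constructor
          · rintro ⟨h1, h2⟩
            rcases hmem w h1 with h | h | h
            · exact Or.inl h
            · exact Or.inr ⟨fun h => h2 (by rw [h, hs.diag]), h⟩
            · exact absurd (hAx b' hb' ⟨w, h, h2⟩) hb'x
          · rintro (rfl | ⟨h1, h2⟩)
            · exact ⟨hq, by rw [hs.symm]; exact hnz b' hb' hb'x⟩
            · exact ⟨hCR h2, hneg.ne_zero hb' h2 h1.symm⟩
        rw [this, Finset.card_insert_of_notMem (by simp [hqC]), Finset.card_erase_of_mem hb']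
        rwa [Nat.sub_add_cancel (Finset.card_pos.2 ⟨b', hb'⟩)]
    obtain ⟨z, hz, hxz⟩ := hz₀
    have hrest : (R \ {q, u₀, b'}) \ (C.erase u₀).erase b' = Z := by
      ext w
      simp only [Finset.mem_sdiff, Finset.mem_insert, Finset.mem_singleton, not_or,
        Finset.mem_erase]
      constructor
      · rintro ⟨⟨h1, h2, h3, h4⟩, h5⟩
        rcases hmem w h1 with h | h | h
        · exact absurd h h2
        · exact absurd ⟨h4, h3, h⟩ h5
        · exact h
      · intro h
        refine ⟨⟨hZR h, fun h' => hqZ (h' ▸ h), fun h' => hCZ' _ hx (h' ▸ h),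
          fun h' => hCZ' _ hb' (h' ▸ h)⟩, fun h' => hCZ' w h'.2.2 h⟩
    -- The triple rule cuts off the rest of `C`, but this rest is an even negative clique with hub
    -- `b'` and no edges to `Z`. It is deleted unmarked in the same reduction, which leaves exactly
    -- `Z`.
    refine hred ⟨{q, u₀, b'}, (C.erase u₀).erase b', q, u₀, b', by simp, {
      mark_sub := by
        intro w hw
        simp only [Finset.mem_insert, Finset.mem_singleton] at hw
        rcases hw with rfl | rfl | rfl
        · exact hq
        · exact hCR hx
        · exact hCR hb'
      sub := ((Finset.erase_subset _ _).trans (Finset.erase_subset _ _)).trans hCR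
      disj := by
        rw [Finset.disjoint_left]
        intro w hw
        simp only [Finset.mem_insert, Finset.mem_singleton] at hw
        rcases hw with rfl | rfl | rfl <;> simp [hqC]
      hub_mem := hCR hb'
      hub_not_mem := by simp
      fan := hneg.fan hb' ((Finset.erase_subset _ _).trans (Finset.erase_subset _ _)) (by simp)
      even := by
        rw [Finset.card_erase_of_mem (Finset.mem_erase.2 ⟨hb'x, hb'⟩),
          Finset.card_erase_of_mem hx]
        obtain ⟨r, hr⟩ := heven
        exact ⟨r - 1, by omega⟩
      closed := by
        intro u hu v hv hvM hvQ huv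
        have hvZ : v ∈ Z := by
          rw [← hrest]
          exact Finset.mem_sdiff.2 ⟨Finset.mem_sdiff.2 ⟨hv, hvM⟩, hvQ⟩
        simp only [Finset.mem_erase] at hu
        exact absurd (hAx u hu.2.2 ⟨v, hvZ, huv⟩) hu.2.1
      nonempty := by rw [hrest]; exact ⟨z, hz⟩
      conn := by rw [hrest]; exact hZc
      rule := .triple rfl hqb (hneg.ne_zero hx hb' hb'x.symm) (hneC u₀ hx).symm ?_ }⟩
    have := hbad u₀ b' hx hb' hxb
    intro h
    exact this (by rw [← h]; ring)

end SignMatrix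

/-! ### Every connected set with two vertices admits a reduction. -/

namespace SignMatrix

variable {V : Type*} [DecidableEq V] {s : V → V → ℤ}

/-- A connected part with connected complement is a negative clique, or a reduction applies. -/
theorem reducible_or_negClique (hs : IsSignMatrix s) {R : Finset V} (hRc : Conn s R)
    (H : Finset V) (hHR : H ⊆ R) (hHn : H.Nonempty) (hHc : Conn s H) (hZc : Conn s (R \ H)) :
    Reducible s R ∨ NegClique s H := by
  by_contra! ⟨hred, hnot⟩
  induction hN : H.card using Nat.strong_induction_on generalizing H with
  | _ N ih =>
  set Z := R \ H with hZdef
  -- With `q` attached to `Z`, deleting a component of `H \ {q}` leaves a connected set. If `H = R`,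
  -- any `q` will do.
  obtain ⟨q, hqH, hqZ⟩ : ∃ q ∈ H, Z.Nonempty → ∃ z ∈ Z, s q z ≠ 0 := by
    by_cases h : H = R
    · obtain ⟨q, hq⟩ := hHn
      exact ⟨q, hq, by simp [hZdef, h]⟩
    · obtain ⟨a, ha, b, hb, hbH, hab⟩ := hRc H hHR hHn h
      exact ⟨a, ha, fun _ => ⟨b, Finset.mem_sdiff.2 ⟨hb, hbH⟩, hab⟩⟩
  have hqR := hHR hqH
  have hqZ' : q ∉ Z := fun h => (Finset.mem_sdiff.1 h).2 hqH
  set Y := H.erase q with hY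
  have hYH : Y ⊆ H := Finset.erase_subset _ _
  have hqY : q ∉ Y := Finset.notMem_erase _ _
  have hmem : ∀ v ∈ R, v = q ∨ v ∈ Y ∨ v ∈ Z := by
    intro v hv
    by_cases h : v ∈ H
    · by_cases hvq : v = q
      · exact Or.inl hvq
      · exact Or.inr (Or.inl (Finset.mem_erase.2 ⟨hvq, h⟩))
    · exact Or.inr (Or.inr (Finset.mem_sdiff.2 ⟨hv, h⟩))
  have hYZ : Disjoint Y Z := Finset.disjoint_left.2 fun v h1 h2 =>
    (Finset.mem_sdiff.1 h2).2 (hYH h1)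
  -- components of `Y` are adjacent to `q`
  have hadj : ∀ C ⊆ Y, C.Nonempty → ClosedIn s C Y → ∃ c ∈ C, s q c ≠ 0 := by
    intro C hCY hCn hcl
    obtain ⟨a, ha, b, hb, hbC, hab⟩ := hHc C (hCY.trans hYH) hCn
      fun h => hqY (hCY (by rw [h]; exact hqH))
    by_cases hbq : b = q
    · subst hbq
      exact ⟨a, ha, by rwa [hs.symm]⟩
    · exact absurd (hcl a ha b (Finset.mem_erase.2 ⟨hbq, hb⟩) hbC) hab
  have hdisj : ∀ C D, ClosedIn s C Y → D ⊆ Y → Conn s D → ∀ v ∈ D, v ∉ C → Disjoint D C := by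
    intro C D hcl hDY hDc v hvD hvC
    by_contra h
    rw [Finset.disjoint_left] at h
    push Not at h
    obtain ⟨w, hw1, hw2⟩ := h
    exact hvC (hDc.subset_of_closedIn hDY hcl ⟨w, Finset.mem_inter.2 ⟨hw2, hw1⟩⟩ hvD)
  have hHC : ∀ C ⊆ Y, ClosedIn s C Y → Conn s (H \ C) := by
    intro C hCY hcl
    have hqC : q ∈ H \ C := Finset.mem_sdiff.2 ⟨hqH, fun h => hqY (hCY h)⟩
    refine conn_of_cover (Z := {q}) (by simpa using hqC) (conn_singleton q) fun v hv => ?_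
    obtain ⟨hvH, hvC⟩ := Finset.mem_sdiff.1 hv
    by_cases hvq : v = q
    · exact ⟨{q}, by simpa using hqC, conn_singleton q, by simp [hvq], by simp⟩
    · obtain ⟨D, hDY, hvD, hDc, hDcl⟩ := exists_component hs
        (show v ∈ Y from Finset.mem_erase.2 ⟨hvq, hvH⟩)
      obtain ⟨c, hc, hqc⟩ := hadj D hDY ⟨v, hvD⟩ hDcl
      have hDC := hdisj C D hcl hDY hDc v hvD hvC
      refine ⟨insert q D, Finset.insert_subset hqC fun w hw => ?_, conn_insert hs hDc hc hqc,
        Finset.mem_insert_of_mem hvD, q, by simp⟩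
      exact Finset.mem_sdiff.2 ⟨hYH (hDY hw), Finset.disjoint_left.1 hDC hw⟩
  have hRC : ∀ C ⊆ Y, ClosedIn s C Y → Conn s (R \ C) := by
    intro C hCY hcl
    have hunion : R \ C = (H \ C) ∪ Z := by
      ext v
      simp only [Finset.mem_sdiff, Finset.mem_union, hZdef]
      constructor
      · rintro ⟨h1, h2⟩
        by_cases h : v ∈ H
        · exact Or.inl ⟨h, h2⟩
        · exact Or.inr ⟨h1, h⟩
      · rintro (⟨h1, h2⟩ | ⟨h1, h2⟩)
        · exact ⟨hHR h1, h2⟩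
        · exact ⟨h1, fun h => h2 (hYH (hCY h))⟩
    rw [hunion]
    by_cases hZn : Z.Nonempty
    · obtain ⟨z, hz, hqz⟩ := hqZ hZn
      exact conn_union hs (hHC C hCY hcl) hZc
        (Finset.mem_sdiff.2 ⟨hqH, fun h => hqY (hCY h)⟩) hz hqz
    · rw [Finset.not_nonempty_iff_eq_empty.1 hZn, Finset.union_empty]
      exact hHC C hCY hcl
  -- A component is a smaller connected set with connected complement, so the induction hypothesis
  -- applies to it.
  have hnegC : ∀ C ⊆ Y, C.Nonempty → Conn s C → ClosedIn s C Y → NegClique s C := by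
    intro C hCY hCn hCc hcl
    by_contra hneg
    refine ih C.card ?_ C (hCY.trans (hYH.trans hHR)) hCn hCc (hRC C hCY hcl) hneg rfl
    rw [← hN]
    exact Finset.card_lt_card ((Finset.ssubset_iff_of_subset (hCY.trans hYH)).2
      ⟨q, hqH, fun h => hqY (hCY h)⟩)
  have hout : ∀ C ⊆ Y, ClosedIn s C Y → ∀ u ∈ C, ∀ v ∈ R, v ∉ C → s u v ≠ 0 → v = q ∨ v ∈ Z := by
    intro C _ hcl u hu v hv hvC huv
    rcases hmem v hv with h | h | h
    · exact Or.inl h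
    · exact absurd (hcl u hu v h hvC) huv
    · exact Or.inr h
  -- A component without edges to `Z` is separated from the rest by `q`. In particular, nothing
  -- remains to be shown when `Z` is empty and `H` has more than one vertex.
  have hattach : ∀ C ⊆ Y, C.Nonempty → Conn s C → ClosedIn s C Y →
      ∃ u ∈ C, ∃ z ∈ Z, s u z ≠ 0 := by
    intro C hCY hCn hCc hcl
    by_contra! hno
    refine hred (reducible_of_separated hs hqR (fun h => hqY (hCY h))
      (hCY.trans (hYH.trans hHR)) (hnegC C hCY hCn hCc hcl) ?_ (hRC C hCY hcl)
      (hadj C hCY hCn hcl))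
    intro u hu v hv hvC huv
    exact (hout C hCY hcl u hu v hv hvC huv).resolve_right fun h => huv (hno u hu v h)
  by_cases hYn : Y.Nonempty
  · obtain ⟨v₁, hv₁⟩ := hYn
    obtain ⟨C, hCY, hvC, hCc, hCcl⟩ := exists_component hs hv₁
    have hCn : C.Nonempty := ⟨v₁, hvC⟩
    -- A single component makes up `H` together with `q`. Given two components, neighbours `y₁` and
    -- `y₂` of `q` in them are not adjacent, so `y₁`, `y₂`, `q` fit the triple rule; they are chosen
    -- so that what is left of each component remains attached to `Z`.
    by_cases hCeq : C = Y
    · subst hCeq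
      have hR : R = insert q (Y ∪ Z) := by
        ext v
        simp only [Finset.mem_insert, Finset.mem_union]
        refine ⟨hmem v, ?_⟩
        rintro (rfl | h | h)
        · exact hqR
        · exact hHR (hYH h)
        · exact (Finset.mem_sdiff.1 h).1
      rcases reducible_or_negClique_insert hs hqY hqZ' hYZ hR (hnegC Y hCY hCn hCc hCcl) hZc
        (hRC Y hCY hCcl) (hadj Y hCY hCn hCcl) (hattach Y hCY hCn hCc hCcl) with h | h
      · exact hred h
      · rw [hY, Finset.insert_erase hqH] at h
        exact hnot h
    · obtain ⟨v₂, hv₂, hv₂C⟩ := Finset.exists_of_ssubset (hCY.ssubset_of_ne hCeq)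
      obtain ⟨D, hDY, hvD, hDc, hDcl⟩ := exists_component hs hv₂
      have hDn : D.Nonempty := ⟨v₂, hvD⟩
      have hDC : Disjoint D C := hdisj C D hCcl hDY hDc v₂ hvD hv₂C
      have hend : ∀ C ⊆ Y, C.Nonempty → Conn s C → ClosedIn s C Y → ∃ y ∈ C, s q y ≠ 0 ∧
          (C = {y} ∨ ∃ u ∈ C, u ≠ y ∧ ∃ z ∈ Z, s u z ≠ 0) := by
        intro C hCY hCn hCc hCcl
        exact (reducible_or_exists_end hs hqR (fun h => hqY (hCY h))
          (hCY.trans (hYH.trans hHR)) (hnegC C hCY hCn hCc hCcl) (hout C hCY hCcl)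
          (hRC C hCY hCcl) (hadj C hCY hCn hCcl) (hattach C hCY hCn hCc hCcl)).resolve_left hred
      obtain ⟨y₁, hy₁, hqy₁, hend₁⟩ := hend C hCY hCn hCc hCcl
      obtain ⟨y₂, hy₂, hqy₂, hend₂⟩ := hend D hDY hDn hDc hDcl
      have hy₂C : y₂ ∉ C := Finset.disjoint_left.1 hDC hy₂
      have hy₁D : y₁ ∉ D := fun h => Finset.disjoint_left.1 hDC h hy₁
      have hne : y₁ ≠ y₂ := fun h => hy₂C (h ▸ hy₁)
      have hYR : ∀ v ∈ Y, v ∈ R := fun v hv => hHR (hYH hv)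
      have hZM : Z ⊆ R \ {y₁, y₂, q} := by
        intro z hz
        have hzY := Finset.disjoint_right.1 hYZ hz
        simp only [Finset.mem_sdiff, Finset.mem_insert, Finset.mem_singleton, not_or]
        exact ⟨(Finset.mem_sdiff.1 hz).1, fun h => hzY (h ▸ hCY hy₁),
          fun h => hzY (h ▸ hDY hy₂), fun h => hqZ' (h ▸ hz)⟩
      obtain ⟨u₀, hu₀, z₀, hz₀, -⟩ := hattach C hCY hCn hCc hCcl
      -- what is left of a component is still attached to `Z`
      have hleft : ∀ E ⊆ Y, E.Nonempty → Conn s E → ClosedIn s E Y → ∀ y ∈ E,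
          (E = {y} ∨ ∃ u ∈ E, u ≠ y ∧ ∃ z ∈ Z, s u z ≠ 0) → (∀ w ∈ E, w ≠ y → w ∈ R \ {y₁, y₂, q}) →
          ∀ w ∈ E, w ≠ y → ∃ K ⊆ R \ {y₁, y₂, q}, Conn s K ∧ w ∈ K ∧ (K ∩ Z).Nonempty := by
        intro E hEY hEn hEc hEcl y hy hend hsub w hw hwy
        rcases hend with h | ⟨u, hu, huy, z, hz, huz⟩
        · rw [h, Finset.mem_singleton] at hw
          exact absurd hw hwy
        · have hneg := hnegC E hEY hEn hEc hEcl
          refine ⟨E.erase y ∪ Z, Finset.union_subset ?_ hZM, conn_union hs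
            (conn_of_clique fun i hi j hj hij => hneg.ne_zero (Finset.mem_of_mem_erase hi)
              (Finset.mem_of_mem_erase hj) hij) hZc (Finset.mem_erase.2 ⟨huy, hu⟩) hz huz,
            Finset.mem_union_left _ (Finset.mem_erase.2 ⟨hwy, hw⟩), z, by simp [hz]⟩
          intro i hi
          exact hsub i (Finset.mem_of_mem_erase hi) (Finset.ne_of_mem_erase hi)
      refine hred ⟨{y₁, y₂, q}, ∅, y₁, y₂, q, by simp, {
        mark_sub := by
          intro w hw
          simp only [Finset.mem_insert, Finset.mem_singleton] at hw
          rcases hw with rfl | rfl | rfl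
          · exact hYR _ (hCY hy₁)
          · exact hYR _ (hDY hy₂)
          · exact hqR
        sub := by simp
        disj := by simp
        hub_mem := hqR
        hub_not_mem := by simp
        fan := ⟨by simp, by simp⟩
        even := by simp
        closed := by simp
        nonempty := by simpa only [Finset.sdiff_empty] using ⟨z₀, hZM hz₀⟩
        conn := ?_
        rule := .triple rfl (by rwa [hs.symm]) (by rwa [hs.symm]) hne
          (by rw [hCcl y₁ hy₁ y₂ (hDY hy₂) hy₂C]; simp) }⟩
      rw [Finset.sdiff_empty]
      refine conn_of_cover hZM hZc fun w hw => ?_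
      have hw' := hw
      simp only [Finset.mem_sdiff, Finset.mem_insert, Finset.mem_singleton, not_or] at hw
      rcases hmem w hw.1 with h | hwY | hwZ
      · exact absurd h hw.2.2.2
      · by_cases hwC : w ∈ C
        · refine hleft C hCY hCn hCc hCcl y₁ hy₁ hend₁ (fun i hi hiy => ?_) w hwC hw.2.1
          simp only [Finset.mem_sdiff, Finset.mem_insert, Finset.mem_singleton, not_or]
          exact ⟨hYR i (hCY hi), hiy, fun h => hy₂C (h ▸ hi), fun h => hqY (h ▸ hCY hi)⟩
        · by_cases hwD : w ∈ D
          · refine hleft D hDY hDn hDc hDcl y₂ hy₂ hend₂ (fun i hi hiy => ?_) w hwD hw.2.2.1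
            simp only [Finset.mem_sdiff, Finset.mem_insert, Finset.mem_singleton, not_or]
            exact ⟨hYR i (hDY hi), fun h => hy₁D (h ▸ hi), hiy, fun h => hqY (h ▸ hDY hi)⟩
          · obtain ⟨E, hEY, hwE, hEc, hEcl⟩ := exists_component hs hwY
            obtain ⟨u, hu, z, hz, huz⟩ := hattach E hEY ⟨w, hwE⟩ hEc hEcl
            have hEC := hdisj C E hCcl hEY hEc w hwE hwC
            have hED := hdisj D E hDcl hEY hEc w hwE hwD
            refine ⟨E ∪ Z, Finset.union_subset (fun i hi => ?_) hZM, conn_union hs hEc hZc hu hz huz,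
              Finset.mem_union_left _ hwE, z, by simp [hz]⟩
            simp only [Finset.mem_sdiff, Finset.mem_insert, Finset.mem_singleton, not_or]
            exact ⟨hYR i (hEY hi), fun h => Finset.disjoint_left.1 hEC hi (h ▸ hy₁),
              fun h => Finset.disjoint_left.1 hED hi (h ▸ hy₂), fun h => hqY (h ▸ hEY hi)⟩
      · exact ⟨Z, hZM, hZc, hwZ, w, by simp [hwZ]⟩
  · refine hnot ⟨fun _ => 1, fun _ => Or.inl rfl, fun u hu v hv huv => ?_⟩
    have hq : ∀ u ∈ H, u = q := fun u hu => by
      by_contra h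
      exact hYn ⟨u, Finset.mem_erase.2 ⟨h, hu⟩⟩
    exact absurd ((hq u hu).trans (hq v hv).symm) huv

/-- A reduction applies to every connected set with at least two vertices. -/
theorem reducible_of_one_lt_card (hs : IsSignMatrix s) {R : Finset V} (hRc : Conn s R)
    (hR : 1 < R.card) : Reducible s R := by
  have hRn : R.Nonempty := Finset.card_pos.1 (by omega)
  have hemp : Conn s (R \ R) := by
    intro A hA hn _
    rw [Finset.sdiff_self, Finset.subset_empty] at hA
    exact absurd hA hn.ne_empty
  rcases reducible_or_negClique hs hRc R le_rfl hRn hRc hemp with h | h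
  · exact h
  -- If `R` itself is a negative clique, all of it but `x` hangs at `x`.
  · obtain ⟨x, hx⟩ := hRn
    have hsd : R \ R.erase x = {x} := by
      rw [Finset.sdiff_erase hx, Finset.sdiff_self, insert_empty_eq]
    refine reducible_of_hanging hs hx (Finset.notMem_erase x R) (Finset.erase_subset _ _) ?_
      (by rwa [Finset.insert_erase hx]) ?_ (by rw [hsd]; exact conn_singleton x)
    · rw [← Finset.card_pos, Finset.card_erase_of_mem hx]; omega
    · intro u _ v hv hvx _
      by_contra hne
      exact hvx (Finset.mem_erase.2 ⟨hne, hv⟩)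

end SignMatrix

/-! ### The record of a sequence of reductions, and the number of marks. -/

namespace SignMatrix

variable {V : Type*} [DecidableEq V] {s : V → V → ℤ}

/-- The record of the reductions that lead to `R`: the vertices with `T v ≠ 0` have been deleted
unmarked, in groups of equal `T v` and in decreasing order of `T v`; each group together with its
hub `P v` is a negative clique. -/
structure Scheme (s : V → V → ℤ) (R : Finset V) (T : V → ℕ) (P : V → V) : Prop where
  zero : ∀ v ∈ R, T v = 0
  ge : ∀ v, T v ≠ 0 → R.card ≤ T v
  hub : ∀ u, T u ≠ 0 → s (P u) u ≠ 0
  hub_lt : ∀ u, T u ≠ 0 → T (P u) < T u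
  hub_eq : ∀ u v, T u ≠ 0 → T v = T u → P v = P u
  group : ∀ u v, T u ≠ 0 → T v = T u → u ≠ v → s (P u) u * s u v * s (P u) v = -1
  down : ∀ u v, T u ≠ 0 → s u v ≠ 0 → (v ∈ R ∨ T v ≠ 0 ∧ T v < T u) → v = P u

/-- The state after some reductions. -/
structure Reduced [Fintype V] (s : V → V → ℤ) (R : Finset V) (T : V → ℕ) (P : V → V) : Prop where
  conn : Conn s R
  nonempty : R.Nonempty
  lt : ∀ v, T v < Fintype.card V
  scheme : Scheme s R T P
  bound : ∀ x, IsPM x → ∃ x', IsPM x' ∧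
    3 * (quad s R x - R.card) + (Finset.univ.filter fun v => v ∉ R ∧ T v = 0).card ≤
      3 * (quad s Finset.univ x' - Fintype.card V)

theorem reduced_univ [Fintype V] (hc : Conn s Finset.univ) (hn : (Finset.univ : Finset V).Nonempty)
    (P : V → V) : Reduced s Finset.univ (fun _ => 0) P where
  conn := hc
  nonempty := hn
  lt _ := Finset.card_pos.2 hn
  scheme := ⟨fun _ _ => rfl, by simp, by simp, by simp, by simp, by simp, by simp⟩
  bound x hx := ⟨x, hx, by simp⟩

/-- The level of a group is the number of vertices left after its deletion. It is positive, as
something is left, and lower than the levels of all earlier groups, so levels order the groups by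
time without a clock. Level zero remains for the vertices that are marked or left. -/
theorem Reduced.step [Fintype V] (hs : IsSignMatrix s) {R M Q : Finset V} {T : V → ℕ} {P : V → V}
    {a b c : V} (h : Reduced s R T P) (hr : Reduction s R M Q a b c) :
    Reduced s ((R \ M) \ Q) (fun v => if v ∈ Q then ((R \ M) \ Q).card else T v)
      (fun v => if v ∈ Q then c else P v) := by
  set R' := (R \ M) \ Q with hR'
  have hR'R : R' ⊆ R := Finset.sdiff_subset.trans Finset.sdiff_subset
  have hpos : 0 < R'.card := Finset.card_pos.2 hr.nonempty
  have hle : R'.card ≤ R.card := Finset.card_le_card hR'R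
  have hlt : ∀ u ∈ Q, R'.card < R.card := fun u hu => Finset.card_lt_card
    ((Finset.ssubset_iff_of_subset hR'R).2 ⟨u, hr.sub hu, fun h => (Finset.mem_sdiff.1 h).2 hu⟩)
  have hsch := h.scheme
  have hQ0 : ∀ u ∈ Q, T u = 0 := fun u hu => hsch.zero u (hr.sub hu)
  refine ⟨hr.conn, hr.nonempty, fun v => ?_, ⟨?_, ?_, ?_, ?_, ?_, ?_, ?_⟩, ?_⟩
  · split_ifs with hv
    · exact (hlt v hv).trans_le (Finset.card_le_univ R)
    · exact h.lt v
  · intro v hv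
    rw [if_neg (Finset.mem_sdiff.1 hv).2]
    exact hsch.zero v (hR'R hv)
  · intro v hv
    split_ifs at hv ⊢ with hvQ
    · exact le_rfl
    · exact hle.trans (hsch.ge v hv)
  · intro u hu
    split_ifs at hu ⊢ with huQ
    · exact hr.fan.1 u huQ
    · exact hsch.hub u hu
  · intro u hu
    by_cases huQ : u ∈ Q
    · simp only [if_pos huQ, if_neg hr.hub_not_mem]
      rw [hsch.zero c hr.hub_mem]
      exact hpos
    · simp only [if_neg huQ] at hu ⊢
      -- A hub that is deleted now gets a level below those of the groups it has served.
      split_ifs with hPQ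
      · exact (hlt _ hPQ).trans_le (hsch.ge u hu)
      · exact hsch.hub_lt u hu
  · intro u v hu huv
    by_cases huQ : u ∈ Q
    · by_cases hvQ : v ∈ Q
      · simp only [if_pos huQ, if_pos hvQ]
      · simp only [if_pos huQ, if_neg hvQ] at huv
        have := hsch.ge v (by omega)
        have := hlt u huQ
        omega
    · simp only [if_neg huQ] at hu huv ⊢
      by_cases hvQ : v ∈ Q
      · simp only [if_pos hvQ] at huv
        have := hsch.ge u hu
        have := hlt v hvQ
        omega
      · simp only [if_neg hvQ] at huv ⊢
        exact hsch.hub_eq u v hu huv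
  · intro u v hu huv hne
    by_cases huQ : u ∈ Q
    · by_cases hvQ : v ∈ Q
      · simp only [if_pos huQ]
        exact hr.fan.2 u huQ v hvQ hne
      · simp only [if_pos huQ, if_neg hvQ] at huv
        have := hsch.ge v (by omega)
        have := hlt u huQ
        omega
    · simp only [if_neg huQ] at hu huv ⊢
      by_cases hvQ : v ∈ Q
      · simp only [if_pos hvQ] at huv
        have := hsch.ge u hu
        have := hlt v hvQ
        omega
      · simp only [if_neg hvQ] at huv
        exact hsch.group u v hu huv hne
  · intro u v hu huv hv
    by_cases huQ : u ∈ Q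
    · simp only [if_pos huQ] at hv ⊢
      rcases hv with hv | ⟨h1, h2⟩
      · obtain ⟨h1, h2⟩ := Finset.mem_sdiff.1 hv
        obtain ⟨h3, h4⟩ := Finset.mem_sdiff.1 h1
        exact hr.closed u huQ v h3 h4 h2 huv
      · by_cases hvQ : v ∈ Q
        · simp only [if_pos hvQ] at h2; omega
        · simp only [if_neg hvQ] at h1 h2
          have := hsch.ge v h1
          omega
    · simp only [if_neg huQ] at hu hv ⊢
      refine hsch.down u v hu huv ?_
      rcases hv with hv | ⟨h1, h2⟩
      · exact Or.inl (hR'R hv)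
      · by_cases hvQ : v ∈ Q
        · exact Or.inl (hr.sub hvQ)
        · simp only [if_neg hvQ] at h1 h2
          exact Or.inr ⟨h1, h2⟩
  · intro x hx
    obtain ⟨x₁, hx₁, h₁⟩ := hr.gain hs hx
    obtain ⟨x₂, hx₂, h₂⟩ := h.bound x₁ hx₁
    refine ⟨x₂, hx₂, ?_⟩
    have hsub : (Finset.univ.filter fun v => v ∉ R' ∧ (if v ∈ Q then R'.card else T v) = 0) ⊆
        (Finset.univ.filter fun v => v ∉ R ∧ T v = 0) ∪ M := by
      intro v hv
      simp only [Finset.mem_filter, Finset.mem_univ, true_and, Finset.mem_union] at hv ⊢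
      obtain ⟨hv1, hv2⟩ := hv
      by_cases hvQ : v ∈ Q
      · rw [if_pos hvQ] at hv2; omega
      · rw [if_neg hvQ] at hv2
        by_cases hvM : v ∈ M
        · exact Or.inr hvM
        · refine Or.inl ⟨fun hvR => hv1 ?_, hv2⟩
          exact Finset.mem_sdiff.2 ⟨Finset.mem_sdiff.2 ⟨hvR, hvM⟩, hvQ⟩
    have hcard := (Finset.card_le_card hsub).trans (Finset.card_union_le _ _)
    have hcard' : ((Finset.univ.filter fun v => v ∉ R' ∧
        (if v ∈ Q then R'.card else T v) = 0).card : ℤ) ≤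
        (Finset.univ.filter fun v => v ∉ R ∧ T v = 0).card + M.card := by exact_mod_cast hcard
    linarith

theorem Reduction.card_lt {R M Q : Finset V} {a b c : V} (h : Reduction s R M Q a b c)
    (hMQ : (M ∪ Q).Nonempty) : ((R \ M) \ Q).card < R.card := by
  obtain ⟨v, hv⟩ := hMQ
  refine Finset.card_lt_card ((Finset.ssubset_iff_of_subset
    (Finset.sdiff_subset.trans Finset.sdiff_subset)).2 ⟨v, ?_, fun h' => ?_⟩)
  · rcases Finset.mem_union.1 hv with hv | hv
    · exact h.mark_sub hv
    · exact h.sub hv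
  · rw [Finset.mem_sdiff, Finset.mem_sdiff] at h'
    rcases Finset.mem_union.1 hv with hv | hv
    · exact h'.1.2 hv
    · exact h'.2 hv

theorem exists_reduced [Fintype V] (hs : IsSignMatrix s) {R : Finset V} {T : V → ℕ} {P : V → V}
    (h : Reduced s R T P) : ∃ R' T' P', Reduced s R' T' P' ∧ R'.card = 1 := by
  induction hN : R.card using Nat.strong_induction_on generalizing R T P with
  | _ N ih =>
  by_cases hR : 1 < R.card
  · obtain ⟨M, Q, a, b, c, hMQ, hr⟩ := reducible_of_one_lt_card hs h.conn hR
    exact ih _ (hN ▸ hr.card_lt hMQ) (h.step hs hr) rfl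
  · have := Finset.card_pos.2 h.nonempty
    exact ⟨R, T, P, h, by omega⟩

/-- The number of vertices that are not deleted unmarked is bounded on no-instances. -/
theorem Reduced.card_le [Fintype V] (hs : IsSignMatrix s) {R : Finset V} {T : V → ℕ} {P : V → V}
    (h : Reduced s R T P) (hR : R.card = 1) {k : ℕ}
    (hk : ¬ ∃ x, IsPM x ∧ (Fintype.card V : ℤ) - 1 + k ≤ quad s Finset.univ x) :
    (Finset.univ.filter fun v => T v = 0).card ≤ 3 * k := by
  obtain ⟨r, rfl⟩ := Finset.card_eq_one.1 hR
  obtain ⟨x, hx, hb⟩ := h.bound (fun _ => 1) fun _ => Or.inl rfl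
  have hq : quad s {r} (fun _ => 1) = 0 := by simp [quad, hs.diag]
  rw [hq] at hb
  -- The last vertex alone has excess `-1` and every mark is worth a third, so there is room for at
  -- most `3 k - 3` marks besides the last vertex.
  have hlt : quad s Finset.univ x < (Fintype.card V : ℤ) - 1 + k := by
    by_contra hno
    exact hk ⟨x, hx, not_lt.1 hno⟩
  have hsub : (Finset.univ.filter fun v => T v = 0) ⊆
      insert r (Finset.univ.filter fun v => v ∉ ({r} : Finset V) ∧ T v = 0) := by
    intro v hv
    simp only [Finset.mem_filter, Finset.mem_univ, true_and, Finset.mem_insert,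
      Finset.mem_singleton] at hv ⊢
    by_cases h : v = r
    · exact Or.inl h
    · exact Or.inr ⟨h, hv⟩
  have hcard := (Finset.card_le_card hsub).trans (Finset.card_insert_le _ _)
  simp only [Finset.card_singleton] at hb
  push_cast at hb
  omega

end SignMatrix

/-! ### Forests of cliques from levels. -/

/-- A graph is a forest of cliques if its vertices are arranged in levels such that every level is
a clique, and each level has at most one neighbour of lower level, which is joined to all of it. -/
theorem SimpleGraph.isForestOfCliques_of_levels {X : Type*} {G : SimpleGraph X} (T : X → ℕ)
    (hadj : ∀ u v, T u = T v → u ≠ v → G.Adj u v)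
    (hhub : ∀ u u' q, G.Adj u q → T q < T u → T u' = T u → G.Adj u' q)
    (huniq : ∀ u u' q q', G.Adj u q → G.Adj u' q' → T u = T u' → T q < T u → T q' < T u' → q = q') :
    G.IsForestOfCliques := by
  intro v p hp
  obtain ⟨u, hu, hmax⟩ : ∃ u ∈ p.support, ∀ w ∈ p.support, T w ≤ T u := by
    classical
    obtain ⟨u, hu, h⟩ := Finset.exists_max_image p.support.toFinset T
      ⟨v, List.mem_toFinset.2 p.start_mem_support⟩
    exact ⟨u, List.mem_toFinset.1 hu, fun w hw => h w (List.mem_toFinset.2 hw)⟩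
  by_cases hall : ∀ w ∈ p.support, T w = T u
  · intro a ha b hb hab
    exact hadj a b ((hall a ha).trans (hall b hb).symm) hab
  push Not at hall
  obtain ⟨w₀, hw₀, hne₀⟩ := hall
  classical
  -- The level of `u` is the highest on the cycle. Somewhere the cycle leaves it along an edge `aq`,
  -- and `q` is then the only lower vertex joined to this level.
  obtain ⟨a, q, haq, hT, hqT, hqp⟩ : ∃ a q, G.Adj a q ∧ T a = T u ∧ T q < T u ∧ q ∈ p.support := by
    have hw₀' : w₀ ∈ (p.rotate u hu).support := (p.mem_support_rotate_iff u hu).2 hw₀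
    obtain ⟨d, hd, h1, h2⟩ := ((p.rotate u hu).takeUntil w₀ hw₀').exists_boundary_dart
      {w | T w = T u} rfl hne₀
    have hd2 : d.snd ∈ p.support := (p.mem_support_rotate_iff u hu).1
      (SimpleGraph.Walk.support_takeUntil_subset_support _ hw₀'
        (SimpleGraph.Walk.dart_snd_mem_support_of_mem_darts _ hd))
    exact ⟨d.fst, d.snd, d.adj, h1, lt_of_le_of_ne (hmax _ hd2) h2, hd2⟩
  have leave : ∀ x y, G.Adj x y → T x = T u → T y < T u → y = q := fun x y hxy hx hy =>
    huniq x a y q hxy haq (hx.trans hT.symm) (hx ▸ hy) (hT ▸ hqT)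
  suffices h : ∀ w ∈ p.support, T w = T u ∨ w = q by
    intro x hx y hy hxy
    rcases h x hx with hx | rfl <;> rcases h y hy with hy | rfl
    · exact hadj x y (hx.trans hy.symm) hxy
    · exact hhub a x y haq (hT ▸ hqT) (hx.trans hT.symm)
    · exact (hhub a y x haq (hT ▸ hqT) (hy.trans hT.symm)).symm
    · exact absurd rfl hxy
  -- Without its first edge, the cycle started at `q` is a path back to `q`, which meets `q` at its
  -- end only. The top level can be entered and left only through `q`, so up to its end the path
  -- stays inside this level or avoids it; the latter is impossible because `u` lies on it.
  have inside : ∀ (w : X) (r : G.Walk w q), r.IsPath → (∀ x ∈ r.support, T x ≤ T u) → T w = T u →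
      ∀ x ∈ r.support, T x = T u ∨ x = q := by
    intro w r
    generalize hq' : q = q' at r
    induction r with
    | nil => intro _ _ hw x hx; rw [SimpleGraph.Walk.mem_support_nil_iff] at hx; exact Or.inr hx
    | @cons w y _ h r ih =>
      subst hq'
      intro hr hle hw x hx
      rw [SimpleGraph.Walk.cons_isPath_iff] at hr
      rw [SimpleGraph.Walk.support_cons, List.mem_cons] at hx
      have hle' : ∀ x ∈ r.support, T x ≤ T u := fun x hx => hle x (by simp [hx])
      rcases hx with rfl | hx
      · exact Or.inl hw
      by_cases hy : T y = T u
      · exact ih rfl hr.1 hle' hy x hx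
      · obtain rfl := leave w y h hw (lt_of_le_of_ne (hle' _ r.start_mem_support) hy)
        rw [(SimpleGraph.Walk.isPath_iff_nil.1 hr.1).eq_nil,
          SimpleGraph.Walk.mem_support_nil_iff] at hx
        exact Or.inr hx
  have outside : ∀ (w : X) (r : G.Walk w q), r.IsPath → (∀ x ∈ r.support, T x ≤ T u) → T w ≠ T u →
      ∀ x ∈ r.support, T x ≠ T u := by
    intro w r
    generalize hq' : q = q' at r
    induction r with
    | nil => intro _ _ hw x hx; rw [SimpleGraph.Walk.mem_support_nil_iff] at hx; rwa [hx]
    | @cons w y _ h r ih =>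
      subst hq'
      intro hr hle hw x hx
      rw [SimpleGraph.Walk.cons_isPath_iff] at hr
      rw [SimpleGraph.Walk.support_cons, List.mem_cons] at hx
      have hle' : ∀ x ∈ r.support, T x ≤ T u := fun x hx => hle x (by simp [hx])
      rcases hx with rfl | hx
      · exact hw
      by_cases hy : T y = T u
      · obtain rfl := leave y w h.symm hy (lt_of_le_of_ne (hle _ (by simp)) hw)
        exact absurd r.end_mem_support hr.2
      · exact ih rfl hr.1 hle' hy x hx
  have hrot : (p.rotate q hqp).IsCycle := hp.rotate hqp
  have hsupp : ∀ w, w ∈ p.support ↔ w ∈ (p.rotate q hqp).support := fun w =>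
    (p.mem_support_rotate_iff q hqp).symm
  simp only [hsupp] at hmax hu ⊢
  generalize p.rotate q hqp = c at hrot hmax hu ⊢
  cases c with
  | nil => exact absurd hrot SimpleGraph.Walk.not_isCycle_nil
  | @cons _ w _ h r =>
    rw [SimpleGraph.Walk.cons_isCycle_iff] at hrot
    have hle : ∀ x ∈ r.support, T x ≤ T u := fun x hx => hmax x (by simp [hx])
    intro x hx
    rw [SimpleGraph.Walk.support_cons, List.mem_cons] at hx hu
    rcases hx with rfl | hx
    · exact Or.inr rfl
    by_cases hw : T w = T u
    · exact inside w r hrot.1 hle hw x hx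
    · rcases hu with rfl | hu
      · exact absurd hqT (lt_irrefl _)
      · exact absurd rfl (outside w r hrot.1 hle hw u hu)

/-! ### The vertices of positive level: switch and forest of cliques. -/

namespace SignMatrix

variable {V : Type*} {s : V → V → ℤ}

/-- Off the vertices with `T v = 0`, the signs become negative after a switch. -/
theorem Scheme.exists_switch (hs : IsSignMatrix s) {r : V} {T : V → ℕ} {P : V → V}
    (h : Scheme s {r} T P) (n : ℕ) : ∃ y, IsPM y ∧ ∀ u v, T u ≠ 0 → T v ≠ 0 → T u < n → T v < n →
      s u v ≠ 0 → s u v = -(y u * y v) := by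
  induction n with
  | zero => exact ⟨fun _ => 1, fun _ => Or.inl rfl, fun u v _ _ hu => absurd hu (Nat.not_lt_zero _)⟩
  | succ n ih =>
    obtain ⟨y, hy, ih⟩ := ih
    -- The hub forces the colours of a group, unless it has level zero. Then the edge to the hub is
    -- not subject to the claim, and the signs of the spokes already make the group negative.
    have key : ∀ u, ∃ z : ℤ, (z = 1 ∨ z = -1) ∧ (T u ≠ n → z = y u) ∧ (T u = n → T u ≠ 0 →
        z = if T (P u) = 0 then s (P u) u else -(s (P u) u * y (P u))) := by
      intro u
      by_cases hu : T u ≠ 0 ∧ T u = n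
      · refine ⟨_, ?_, fun h => absurd hu.2 h, fun _ _ => rfl⟩
        have := h.hub u hu.1
        rcases hs.vals (P u) u with h0 | h0 | h0 <;> rcases hy (P u) with h1 | h1 <;>
          split_ifs <;> simp_all
      · exact ⟨y u, hy u, fun _ => rfl, fun h1 h2 => absurd ⟨h2, h1⟩ hu⟩
    choose z hz hz1 hz2 using key
    have mixed : ∀ u v, T u = n → T v < n → T u ≠ 0 → T v ≠ 0 → s u v ≠ 0 →
        s u v = -(z u * z v) := by
      intro u v hu hv hu0 hv0 huv
      have hP := h.down u v hu0 huv (Or.inr ⟨hv0, hu ▸ hv⟩)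
      rw [hz2 u hu hu0, ← hP, if_neg hv0, hz1 v hv.ne, hs.symm v u]
      linear_combination -(s u v) * hy.sq v
    refine ⟨z, hz, fun u v hu0 hv0 hu hv huv => ?_⟩
    rcases Nat.lt_succ_iff_lt_or_eq.1 hu with hu | hu <;>
      rcases Nat.lt_succ_iff_lt_or_eq.1 hv with hv | hv
    · rw [hz1 u hu.ne, hz1 v hv.ne]
      exact ih u v hu0 hv0 hu hv huv
    · rw [hs.symm, mixed v u hv hu hv0 hu0 (by rwa [hs.symm]), mul_comm]
    · exact mixed u v hu hv hu0 hv0 huv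
    · have hne : u ≠ v := by rintro rfl; exact huv (hs.diag u)
      have hg := h.group u v hu0 (hv.trans hu.symm) hne
      have hP := h.hub_eq u v hu0 (hv.trans hu.symm)
      have h1 := hs.sq (h.hub u hu0)
      have h2 := hs.sq (h.hub v hv0)
      rw [hP] at h2
      have : s u v = -(s (P u) u * s (P u) v) := by
        calc s u v = (s (P u) u * s (P u) u) * (s (P u) v * s (P u) v) * s u v := by
              rw [h1, h2]; ring
          _ = (s (P u) u * s u v * s (P u) v) * (s (P u) u * s (P u) v) := by ring
          _ = _ := by rw [hg]; ring
      rw [this, hz2 u hu hu0, hz2 v hv hv0, hP]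
      split_ifs
      · rfl
      · linear_combination (s (P u) u * s (P u) v) * hy.sq (P u)

/-- Off the vertices with `T v = 0`, a graph is a forest of cliques. -/
theorem Scheme.isForestOfCliques (hs : IsSignMatrix s) {r : V} {T : V → ℕ} {P : V → V}
    (h : Scheme s {r} T P) {X : Set V} (hX : ∀ v ∈ X, T v ≠ 0) {G : SimpleGraph X}
    (hG : ∀ u v, G.Adj u v ↔ s u v ≠ 0) : G.IsForestOfCliques := by
  have down : ∀ u q : X, G.Adj u q → T q < T u → (q : V) = P u := fun u q huq hlt =>
    h.down u q (hX u u.2) ((hG u q).1 huq) (Or.inr ⟨hX q q.2, hlt⟩)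
  refine SimpleGraph.isForestOfCliques_of_levels (fun v => T v) (fun u v huv hne => ?_)
    (fun u u' q huq hlt hu => ?_) (fun u u' q q' huq huq' huu hlt hlt' => ?_)
  · have := h.group u v (hX u u.2) huv.symm (fun e => hne (Subtype.ext e))
    rw [hG]
    intro h0
    rw [h0] at this
    simp at this
  · rw [hG, hs.symm, down u q huq hlt, ← h.hub_eq u u' (hX u u.2) hu]
    exact h.hub u' (hX u' u'.2)
  · refine Subtype.ext ?_
    rw [down u q huq hlt, down u' q' huq' hlt', h.hub_eq u u' (hX u u.2) huu.symm]

end SignMatrix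

/-! ### From signed graphs to sign matrices; the deletion set. -/

namespace SignedGraph

variable {V : Type*} (G : SignedGraph V)

open Classical in
/-- The sign of a pair of vertices, `0` if it is not an edge. -/
noncomputable def sign (u v : V) : ℤ :=
  if G.pos.Adj u v then 1 else if G.neg.Adj u v then -1 else 0

theorem sign_eq_one {u v : V} : G.sign u v = 1 ↔ G.pos.Adj u v := by
  unfold sign; split_ifs <;> simp_all

theorem sign_eq_neg_one {u v : V} : G.sign u v = -1 ↔ G.neg.Adj u v := by
  have := G.disj u v
  unfold sign; split_ifs <;> simp_all

theorem sign_ne_zero {u v : V} : G.sign u v ≠ 0 ↔ G.graph.Adj u v := by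
  unfold sign graph; split_ifs <;> simp_all

theorem isSignMatrix_sign : IsSignMatrix G.sign where
  symm u v := by
    have h1 : G.pos.Adj u v ↔ G.pos.Adj v u := G.pos.adj_comm u v
    have h2 : G.neg.Adj u v ↔ G.neg.Adj v u := G.neg.adj_comm u v
    unfold sign
    split_ifs <;> simp_all
  diag v := by simp [sign]
  vals u v := by unfold sign; split_ifs <;> simp

theorem conn_univ [Fintype V] (h : G.graph.Connected) : SignMatrix.Conn G.sign Finset.univ := by
  intro A _ ⟨a, ha⟩ hne
  obtain ⟨b, hb⟩ : ∃ b, b ∉ A := by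
    by_contra hno
    push Not at hno
    exact hne (Finset.eq_univ_iff_forall.2 hno)
  obtain ⟨p⟩ := h.preconnected a b
  obtain ⟨d, -, h1, h2⟩ := p.exists_boundary_dart (A : Set V) ha hb
  exact ⟨d.fst, h1, d.snd, Finset.mem_univ _, h2, G.sign_ne_zero.2 d.adj⟩

theorem two_mul_edgeCount [Fintype V] : 2 * (G.edgeCount : ℤ) =
    ∑ u, ∑ v, G.sign u v * G.sign u v := by
  classical
  have h1 : G.edgeCount = G.graph.edgeFinset.card := by
    rw [edgeCount, ← SimpleGraph.coe_edgeFinset, Set.ncard_coe_finset]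
  have h2 : ∀ u v, G.sign u v * G.sign u v = if G.graph.Adj u v then 1 else 0 := by
    intro u v
    split_ifs with h
    · exact G.isSignMatrix_sign.sq (G.sign_ne_zero.2 h)
    · have := mt G.sign_ne_zero.1 h
      push Not at this
      rw [this]; rfl
  have h3 := SimpleGraph.sum_degrees_eq_twice_card_edges G.graph
  rw [h1]
  simp only [h2, Finset.sum_boole]
  rw [← Nat.cast_ofNat, ← Nat.cast_mul, ← h3, Nat.cast_sum]
  refine Finset.sum_congr rfl fun u _ => ?_
  rw [← SimpleGraph.card_neighborFinset_eq_degree, SimpleGraph.neighborFinset_eq_filter]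

/-- The edges of `G` that agree with the two-colouring `x`. -/
def satisfied (x : V → ℤ) : SignedGraph V where
  pos :=
    { Adj := fun u v => G.pos.Adj u v ∧ x u = x v
      symm := ⟨fun _ _ h => ⟨h.1.symm, h.2.symm⟩⟩
      loopless := ⟨fun _ h => G.pos.irrefl h.1⟩ }
  neg :=
    { Adj := fun u v => G.neg.Adj u v ∧ x u ≠ x v
      symm := ⟨fun _ _ h => ⟨h.1.symm, h.2.symm⟩⟩
      loopless := ⟨fun _ h => G.neg.irrefl h.1⟩ }
  disj u v h h' := G.disj u v h.1 h'.1

/-- A satisfied edge adds `2` to the form and any other edge subtracts `2`, so the form plus `2 m`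
is four times the number of satisfied edges. A balanced subgraph contains only edges satisfied by
its partition, and all of these together form a balanced subgraph. -/
theorem isYesInstance_iff [Fintype V] (k : ℕ) : G.IsYesInstance k ↔
    ∃ x, IsPM x ∧ (Fintype.card V : ℤ) - 1 + k ≤ SignMatrix.quad G.sign Finset.univ x := by
  have hquad : ∀ x, SignMatrix.quad G.sign Finset.univ x + 2 * G.edgeCount =
      ∑ u, ∑ v, (G.sign u v * x u * x v + G.sign u v * G.sign u v) := fun x => by
    rw [two_mul_edgeCount]; simp only [SignMatrix.quad, Finset.sum_add_distrib]
  have hcount : ∀ H : SignedGraph V, 4 * (H.edgeCount : ℤ) =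
      ∑ u, ∑ v, 2 * (H.sign u v * H.sign u v) := fun H => by
    simp only [← Finset.mul_sum]
    linarith [H.two_mul_edgeCount]
  have hbound : ∀ (H : SignedGraph V) (q : ℤ), (q + 2 * G.edgeCount = 4 * H.edgeCount) →
      (G.ptBound + (k : ℚ) / 4 ≤ (H.edgeCount : ℚ) ↔ (Fintype.card V : ℤ) - 1 + k ≤ q) := by
    intro H q h
    have h' : (q : ℚ) + 2 * G.edgeCount = 4 * H.edgeCount := by exact_mod_cast h
    rw [ptBound, Nat.card_eq_fintype_card, ← Int.cast_le (R := ℚ)]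
    push_cast
    constructor <;> intro _ <;> linarith
  constructor
  · rintro ⟨H, ⟨h1, h2⟩, ⟨A, h3, h4⟩, h5⟩
    classical
    set x : V → ℤ := fun v => if v ∈ A then 1 else -1 with hx
    have hle : 4 * (H.edgeCount : ℤ) ≤ SignMatrix.quad G.sign Finset.univ x + 2 * G.edgeCount := by
      rw [hquad, hcount]
      refine Finset.sum_le_sum fun u _ => Finset.sum_le_sum fun v _ => ?_
      rcases H.isSignMatrix_sign.vals u v with h | h | h
      · rw [h]
        rcases G.isSignMatrix_sign.vals u v with h' | h' | h' <;> rw [h', hx] <;> dsimp only <;>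
          split_ifs <;> norm_num
      · rw [h, G.sign_eq_one.2 (h1 (H.sign_eq_one.1 h)), hx]
        have := h3 u v (H.sign_eq_one.1 h)
        dsimp only
        split_ifs <;> first | (exfalso; tauto) | norm_num
      · rw [h, G.sign_eq_neg_one.2 (h2 (H.sign_eq_neg_one.1 h)), hx]
        have := h4 u v (H.sign_eq_neg_one.1 h)
        dsimp only
        split_ifs <;> first | (exfalso; tauto) | norm_num
    refine ⟨x, fun v => ite_eq_or_eq _ _ _, ?_⟩
    have := (hbound H (4 * H.edgeCount - 2 * G.edgeCount) (by ring)).1 h5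
    linarith
  · rintro ⟨x, hx, hq⟩
    refine ⟨G.satisfied x, ⟨fun _ _ h => h.1, fun _ _ h => h.1⟩, ⟨{v | x v = 1}, ?_, ?_⟩,
      (hbound _ _ ?_).2 hq⟩
    · rintro u v ⟨-, h⟩
      rw [Set.mem_ofPred_eq, Set.mem_ofPred_eq, h]
    · rintro u v ⟨-, h⟩
      rw [Set.mem_ofPred_eq, Set.mem_ofPred_eq]
      rcases hx u with h1 | h1 <;> rcases hx v with h2 | h2 <;> simp_all
    · rw [hquad, hcount]
      refine Finset.sum_congr rfl fun u _ => Finset.sum_congr rfl fun v _ => ?_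
      have hsat : (G.satisfied x).sign u v = if x u = x v then (if G.sign u v = 1 then 1 else 0)
          else (if G.sign u v = -1 then -1 else 0) := by
        have := G.disj u v
        have h1 : (G.satisfied x).pos.Adj u v ↔ G.pos.Adj u v ∧ x u = x v := Iff.rfl
        have h2 : (G.satisfied x).neg.Adj u v ↔ G.neg.Adj u v ∧ x u ≠ x v := Iff.rfl
        unfold sign
        split_ifs <;> simp_all
      rw [hsat]
      rcases hx u with h1 | h1 <;> rcases hx v with h2 | h2 <;>
        rcases G.isSignMatrix_sign.vals u v with h' | h' | h' <;> rw [h1, h2, h'] <;> norm_num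

/-- The structural half of the main result. -/
theorem exists_deletion_set [Finite V] (k : ℕ) (hG : G.graph.Connected)
    (hk : ¬ G.IsYesInstance k) : ∃ S : Set V, S.ncard ≤ 3 * k ∧
      (G.induce Sᶜ).graph.IsForestOfCliques ∧ ¬ (G.induce Sᶜ).HasPositiveTriangle ∧
      ∃ W : Set V, W ⊆ Sᶜ ∧ ((G.switch W).induce Sᶜ).pos = ⊥ := by
  classical
  have := Fintype.ofFinite V
  have hs := G.isSignMatrix_sign
  have hne := hG.nonempty
  obtain ⟨R, T, P, hred, hcard⟩ := SignMatrix.exists_reduced hs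
    (SignMatrix.reduced_univ (G.conn_univ hG) Finset.univ_nonempty id)
  have hle := hred.card_le hs hcard (mt (G.isYesInstance_iff k).2 hk)
  obtain ⟨r, rfl⟩ := Finset.card_eq_one.1 hcard
  obtain ⟨y, hy, hyy⟩ := hred.scheme.exists_switch hs (Fintype.card V)
  have hyy : ∀ u v, T u ≠ 0 → T v ≠ 0 → G.sign u v ≠ 0 → G.sign u v = -(y u * y v) :=
    fun u v hu hv => hyy u v hu hv (hred.lt u) (hred.lt v)
  -- Edges between vertices of positive level have sign `-(y u * y v)`, so switching one colour
  -- class of `y` makes them all negative.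
  refine ⟨{v | T v = 0}, ?_, ?_, ?_, {v | T v ≠ 0 ∧ y v = 1}, fun v hv => hv.1, ?_⟩
  · rwa [← Set.ncard_coe_finset, Finset.coe_filter_univ] at hle
  · exact hred.scheme.isForestOfCliques hs (fun v hv => hv) fun u v => G.sign_ne_zero.symm
  · have key : ∀ u v : ({v | T v = 0}ᶜ : Set V), (G.induce _).graph.Adj u v →
        (((G.induce {v | T v = 0}ᶜ).neg.Adj u v) ↔ y u * y v = 1) := by
      intro u v huv
      have h1 : G.sign u v ≠ 0 := G.sign_ne_zero.2 huv
      have h2 := hyy u v u.2 v.2 h1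
      change G.neg.Adj u v ↔ _
      rw [← G.sign_eq_neg_one, h2]
      constructor <;> intro h <;> linarith
    -- In a product of three signs of this form every `y` occurs twice, so each triangle has an odd
    -- number of negative edges.
    rintro ⟨a, p, hp, hlen, hpos⟩
    unfold IsPositiveWalk at hpos
    cases p with
    | nil => simp at hlen
    | @cons _ b _ h₁ p =>
      cases p with
      | nil => simp at hlen
      | @cons _ c _ h₂ p =>
        cases p with
        | nil => simp at hlen
        | @cons _ d _ h₃ p =>
          cases p with
          | cons _ _ => simp at hlen
          | nil =>
            simp only [SimpleGraph.Walk.edges_cons, SimpleGraph.Walk.edges_nil, List.filter_cons,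
              List.filter_nil, SimpleGraph.mem_edgeSet, decide_eq_true_eq, key _ _ h₁, key _ _ h₂,
              key _ _ h₃] at hpos
            rcases hy a with h1 | h1 <;> rcases hy b with h2 | h2 <;> rcases hy c with h3 | h3 <;>
              rw [h1, h2, h3] at hpos <;> revert hpos <;> norm_num
  · refine SimpleGraph.ext (funext fun u => funext fun v => propext ⟨fun h => ?_, fun h => h.elim⟩)
    have hu : T u ≠ 0 := u.2
    have hv : T v ≠ 0 := v.2
    rcases h with ⟨h, h'⟩ | ⟨h, h'⟩
    · have h1 : G.sign u v = 1 := G.sign_eq_one.2 h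
      have h' : (T u ≠ 0 ∧ y u = 1) ↔ (T v ≠ 0 ∧ y v = 1) := h'
      have h2 := hyy u v hu hv (by rw [h1]; norm_num)
      rw [h1] at h2
      rcases hy u with h3 | h3 <;> rcases hy v with h4 | h4 <;> rw [h3, h4] at h2 h' <;>
        first | (exfalso; revert h2; norm_num; done) | (exfalso; revert h'; norm_num [hu, hv])
    · have h1 : G.sign u v = -1 := G.sign_eq_neg_one.2 h
      have h' : ¬ ((T u ≠ 0 ∧ y u = 1) ↔ (T v ≠ 0 ∧ y v = 1)) := h'
      have h2 := hyy u v hu hv (by rw [h1]; norm_num)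
      rw [h1] at h2
      rcases hy u with h3 | h3 <;> rcases hy v with h4 | h4 <;> rw [h3, h4] at h2 h' <;>
        first | (exfalso; revert h2; norm_num; done) | (exfalso; revert h'; norm_num [hu, hv])

end SignedGraph

/-! ### Satisfied edges, and their number in a negative clique. -/

namespace SignMatrix

variable {V : Type*} {s : V → V → ℤ}

/-- Whether the pair `u`, `v` with colours `b`, `b'` is a satisfied edge. -/
def sat (s : V → V → ℤ) (u v : V) (b b' : Bool) : ℕ :=
  if (s u v = 1 ∧ b = b') ∨ (s u v = -1 ∧ b ≠ b') then 1 else 0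

/-- Twice the number of satisfied edges within `X`. -/
def satCount (s : V → V → ℤ) (X : Finset V) (β : V → Bool) : ℕ :=
  ∑ u ∈ X, ∑ v ∈ X, sat s u v (β u) (β v)

theorem sat_le_one (u v : V) (b b' : Bool) : sat s u v b b' ≤ 1 := by
  unfold sat; split_ifs <;> omega

theorem sat_symm (hs : IsSignMatrix s) (u v : V) (b b' : Bool) :
    sat s u v b b' = sat s v u b' b := by
  unfold sat
  rw [hs.symm u v]
  congr 1
  simp only [eq_comm, ne_eq]

theorem satCount_le [Fintype V] (X : Finset V) (β : V → Bool) :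
    satCount s X β ≤ Fintype.card V * Fintype.card V := by
  calc satCount s X β ≤ ∑ u ∈ X, ∑ v ∈ X, 1 :=
        Finset.sum_le_sum fun u _ => Finset.sum_le_sum fun v _ => sat_le_one _ _ _ _
    _ = X.card * X.card := by simp
    _ ≤ _ := by gcongr <;> exact Finset.card_le_univ X

theorem satCount_congr {X : Finset V} {β β' : V → Bool} (h : ∀ v ∈ X, β v = β' v) :
    satCount s X β = satCount s X β' :=
  Finset.sum_congr rfl fun u hu => Finset.sum_congr rfl fun v hv => by rw [h u hu, h v hv]

/-- On an edge, `s u v * x u * x v + 1` is `2` or `0`. This passes from the form to natural numbers,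
which the machine can handle. -/
theorem quad_eq_satCount (hs : IsSignMatrix s) (X : Finset V) (β : V → Bool) :
    quad s X (fun v => if β v then 1 else -1) + ((∑ u ∈ X, ∑ v ∈ X, if s u v = 0 then 0 else 1 : ℕ) : ℤ)
      = 2 * satCount s X β := by
  simp only [quad, satCount, Nat.cast_sum, Finset.mul_sum, ← Finset.sum_add_distrib]
  refine Finset.sum_congr rfl fun u _ => Finset.sum_congr rfl fun v _ => ?_
  unfold sat
  rcases hs.vals u v with h | h | h <;> rw [h] <;> cases β u <;> cases β v <;> simp

theorem satCount_union [DecidableEq V] (hs : IsSignMatrix s) {Y Q : Finset V} (h : Disjoint Y Q)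
    (β : V → Bool) : satCount s (Y ∪ Q) β = satCount s Y β + satCount s Q β +
      2 * ∑ c ∈ Q, ∑ u ∈ Y, sat s c u (β c) (β u) := by
  have h1 : ∑ u ∈ Y, ∑ c ∈ Q, sat s u c (β u) (β c) = ∑ c ∈ Q, ∑ u ∈ Y, sat s c u (β c) (β u) := by
    rw [Finset.sum_comm]
    exact Finset.sum_congr rfl fun _ _ => Finset.sum_congr rfl fun _ _ => sat_symm hs _ _ _ _
  unfold satCount
  simp only [Finset.sum_union h, Finset.sum_add_distrib]
  rw [h1]; ring

/-- The colour of `c` such that the edge from `q`, of colour `b`, is satisfied if and only if `z`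
is true. -/
def bitOf (s : V → V → ℤ) (q c : V) (b z : Bool) : Bool := xor b (xor (decide (s q c = 1)) z)

theorem sat_bitOf (hs : IsSignMatrix s) {q c : V} (h : s q c ≠ 0) (b z : Bool) :
    sat s q c b (bitOf s q c b z) = if z then 1 else 0 := by
  unfold sat bitOf
  rcases hs.vals q c with h' | h' | h'
  · exact absurd h' h
  all_goals rw [h']; cases b <;> cases z <;> simp

theorem bitOf_sat (hs : IsSignMatrix s) {q c : V} (h : s q c ≠ 0) (b b' : Bool) :
    bitOf s q c b (decide (sat s q c b b' = 1)) = b' := by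
  unfold sat bitOf
  rcases hs.vals q c with h' | h' | h'
  · exact absurd h' h
  all_goals rw [h']; cases b <;> cases b' <;> simp

/-- Under every colouring, a negative triangle has an even number of satisfied edges. -/
theorem sat_fan (hs : IsSignMatrix s) {q c c' : V} (h : s q c * s c c' * s q c' = -1)
    (b b₁ b₂ : Bool) : sat s c c' b₁ b₂ =
      if (sat s q c b b₁ = 1 ↔ sat s q c' b b₂ = 1) then 0 else 1 := by
  unfold sat
  rcases hs.vals q c with h1 | h1 | h1 <;> rcases hs.vals c c' with h2 | h2 | h2 <;>
    rcases hs.vals q c' with h3 | h3 | h3 <;> rw [h1, h2, h3] at h <;> norm_num at h <;>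
    rw [h1, h2, h3] <;> cases b <;> cases b₁ <;> cases b₂ <;> simp

/-- A fan has `2 z (m + 1 - z)` satisfied edges (counted twice), where `m` is the number of its
spokes and `z` the number of satisfied ones. -/
theorem satCount_fan [DecidableEq V] (hs : IsSignMatrix s) {q : V} {Q : Finset V}
    (h : Fan s q Q) (β : V → Bool) :
    satCount s Q β + 2 * ∑ c ∈ Q, sat s q c (β q) (β c) =
      2 * ((Q.filter fun c => sat s q c (β q) (β c) = 1).card *
        (Q.card + 1 - (Q.filter fun c => sat s q c (β q) (β c) = 1).card)) := by
  set Z := Q.filter fun c => sat s q c (β q) (β c) = 1 with hZ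
  set Z' := Q.filter fun c => ¬ sat s q c (β q) (β c) = 1 with hZ'
  have hcard : Z.card + Z'.card = Q.card := Finset.card_filter_add_card_filter_not _
  have h1 : ∑ c ∈ Q, sat s q c (β q) (β c) = Z.card := by
    rw [Finset.card_filter]
    refine Finset.sum_congr rfl fun c _ => ?_
    have := sat_le_one (s := s) q c (β q) (β c)
    split_ifs <;> omega
  -- An edge of the group is satisfied iff exactly one of its ends has a satisfied spoke.
  have h2 : satCount s Q β = Z.card * Z'.card + Z'.card * Z.card := by
    have : ∀ c ∈ Q, ∑ c' ∈ Q, sat s c c' (β c) (β c') =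
        if sat s q c (β q) (β c) = 1 then Z'.card else Z.card := by
      intro c hc
      have : ∀ c' ∈ Q, sat s c c' (β c) (β c') =
          if (sat s q c (β q) (β c) = 1 ↔ sat s q c' (β q) (β c') = 1) then 0 else 1 := by
        intro c' hc'
        by_cases hcc : c = c'
        · subst hcc
          simp [sat, hs.diag]
        · exact sat_fan hs (h.2 c hc c' hc' hcc) _ _ _
      rw [Finset.sum_congr rfl this]
      split_ifs with h0
      · rw [Finset.card_filter]
        refine Finset.sum_congr rfl fun c' _ => ?_
        simp only [h0, true_iff]
        split_ifs <;> rfl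
      · rw [Finset.card_filter]
        refine Finset.sum_congr rfl fun c' _ => ?_
        simp only [h0, false_iff]
        split_ifs <;> rfl
    unfold satCount
    rw [Finset.sum_congr rfl this, Finset.sum_ite, Finset.sum_const, Finset.sum_const]
    rfl
  rw [h1, h2]
  have : Q.card + 1 - Z.card = Z'.card + 1 := by omega
  rw [this]; ring

end SignMatrix

/-! ### Dynamic programming over the levels. -/

namespace SignMatrix

variable {V : Type*} [Fintype V] {s : V → V → ℤ}

/-- The colouring `β` extends the colours `B` of the vertices with `T v = 0`. -/
def Extends (T : V → ℕ) (B β : V → Bool) : Prop := ∀ v, T v = 0 → β v = B v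

/-- The vertices of level less than `t`. -/
def below (T : V → ℕ) (t : ℕ) : Finset V := Finset.univ.filter fun v => T v < t

/-- The weights `W` on the vertices of level less than `t` account for the best colouring of the
other vertices. -/
structure Tables (s : V → V → ℤ) (T : V → ℕ) (B : V → Bool) (t : ℕ) (W : Bool → V → ℕ) :
    Prop where
  le : ∀ β β', Extends T B β → Extends T B β' → (∀ v ∈ below T t, β' v = β v) →
    satCount s Finset.univ β' ≤ satCount s (below T t) β + ∑ v ∈ below T t, W (β v) v
  exists_eq : ∀ β, Extends T B β → ∃ β', Extends T B β' ∧ (∀ v ∈ below T t, β' v = β v) ∧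
    satCount s Finset.univ β' = satCount s (below T t) β + ∑ v ∈ below T t, W (β v) v

/-- Above all levels there are no vertices left to colour, so zero weights are exact. -/
theorem tables_zero {T : V → ℕ} {t : ℕ} (hT : ∀ v, T v < t) (B : V → Bool) :
    Tables s T B t fun _ _ => 0 := by
  have : below T t = Finset.univ := Finset.filter_true_of_mem fun v _ => hT v
  constructor
  · intro β β' _ _ h
    rw [this] at h ⊢
    rw [satCount_congr h]
    simp
  · intro β h
    exact ⟨β, h, fun _ _ => rfl, by rw [this]; simp⟩

/-- The total is attained by some colouring, so it counts pairs of vertices. This bound keeps the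
computed values below the cap. -/
theorem Tables.le_sq {T : V → ℕ} {B : V → Bool} {t : ℕ} {W : Bool → V → ℕ} (h : Tables s T B t W)
    {β : V → Bool} (hβ : Extends T B β) :
    satCount s (below T t) β + ∑ v ∈ below T t, W (β v) v ≤ Fintype.card V * Fintype.card V := by
  obtain ⟨β', -, -, h⟩ := h.exists_eq β hβ
  rw [← h]
  exact satCount_le _ _

variable [DecidableEq V]

/-- The weight of colouring `c` such that the edge to its hub `q`, of colour `b`, is satisfied if
and only if `z` is true. -/
def weight (s : V → V → ℤ) (T : V → ℕ) (B : V → Bool) (W : Bool → V → ℕ) (q : V) (b : Bool)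
    (c : V) (z : Bool) : ℕ :=
  W (bitOf s q c b z) c +
    2 * ∑ u, if T u = 0 ∧ u ≠ q then sat s c u (bitOf s q c b z) (B u) else 0

/-- The value of colouring the group `Q` with hub `q` such that exactly the edges from `q` to `Z`
are satisfied. -/
def groupValue (s : V → V → ℤ) (T : V → ℕ) (B : V → Bool) (W : Bool → V → ℕ) (q : V) (b : Bool)
    (Q Z : Finset V) : ℕ :=
  ∑ c ∈ Q, weight s T B W q b c (decide (c ∈ Z)) + 2 * (Z.card * (Q.card + 1 - Z.card))

section

variable {T : V → ℕ} {P : V → V} {r q : V} {t : ℕ} {B : V → Bool} {W : Bool → V → ℕ}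

theorem below_succ (T : V → ℕ) (t : ℕ) :
    below T (t + 1) = below T t ∪ Finset.univ.filter fun v => T v = t := by
  ext v
  simp only [below, Finset.mem_union, Finset.mem_filter, Finset.mem_univ, true_and]
  omega

omit [DecidableEq V] in
theorem disjoint_below (T : V → ℕ) (t : ℕ) :
    Disjoint (below T t) (Finset.univ.filter fun v => T v = t) := by
  rw [Finset.disjoint_left]
  intro v h1 h2
  simp only [below, Finset.mem_filter, Finset.mem_univ, true_and] at h1 h2
  omega

omit [DecidableEq V] in
theorem Scheme.fan (h : Scheme s {r} T P) (ht : t ≠ 0) (hq : ∀ c, T c = t → P c = q) :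
    Fan s q (Finset.univ.filter fun v => T v = t) := by
  constructor
  · intro c hc
    rw [Finset.mem_filter] at hc
    rw [← hq c hc.2]
    exact h.hub c (by omega)
  · intro c hc d hd hcd
    rw [Finset.mem_filter] at hc hd
    rw [← hq c hc.2]
    exact h.group c d (by omega) (by omega) hcd

/-- The value of a colouring of one more level. -/
theorem Scheme.satCount_below_succ (hs : IsSignMatrix s) (h : Scheme s {r} T P) (ht : t ≠ 0)
    (hq : ∀ c, T c = t → P c = q) (hqt : T q < t) {β : V → Bool} (hβ : Extends T B β) :
    satCount s (below T (t + 1)) β + ∑ v ∈ below T (t + 1), W (β v) v =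
      satCount s (below T t) β + ∑ v ∈ below T t, W (β v) v +
      groupValue s T B W q (β q) (Finset.univ.filter fun v => T v = t)
        ((Finset.univ.filter fun v => T v = t).filter fun c => sat s q c (β q) (β c) = 1) := by
  set Q := Finset.univ.filter fun v => T v = t with hQ
  have hfan : Fan s q Q := h.fan ht hq
  have hTQ : ∀ c ∈ Q, T c = t := fun c hc => (Finset.mem_filter.1 hc).2
  rw [below_succ, satCount_union hs (disjoint_below T t), Finset.sum_union (disjoint_below T t)]
  -- Below its own level, `c` has neighbours only at level zero and in its hub. The hub is counted
  -- separately because it may have level zero as well.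
  have hcross : ∀ c ∈ Q, ∑ u ∈ below T t, sat s c u (β c) (β u) =
      sat s q c (β q) (β c) + ∑ u, if T u = 0 ∧ u ≠ q then sat s c u (β c) (B u) else 0 := by
    intro c hc
    have hmem : q ∈ below T t := Finset.mem_filter.2 ⟨Finset.mem_univ _, hqt⟩
    rw [← Finset.add_sum_erase _ _ hmem, sat_symm hs c q]
    congr 1
    rw [← Finset.sum_filter]
    symm
    rw [Finset.sum_congr rfl (g := fun u => sat s c u (β c) (β u)) (fun u hu => ?_)]
    · refine Finset.sum_subset (fun u hu => ?_) (fun u hu hu' => ?_)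
      · rw [Finset.mem_filter] at hu
        refine Finset.mem_erase.2 ⟨hu.2.2, Finset.mem_filter.2 ⟨Finset.mem_univ _, ?_⟩⟩
        omega
      · rw [Finset.mem_erase, below, Finset.mem_filter] at hu
        have hu0 : T u ≠ 0 := fun h0 => hu' (Finset.mem_filter.2 ⟨Finset.mem_univ _, h0, hu.1⟩)
        have : s c u = 0 := by
          by_contra hne
          have hc' := hTQ c hc
          have := h.down c u (by omega) hne (Or.inr ⟨hu0, by omega⟩)
          exact hu.1 (this.trans (hq c hc'))
        simp [sat, this]
    · rw [Finset.mem_filter] at hu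
      rw [hβ u hu.2.1]
  have hweight : ∀ c ∈ Q, weight s T B W q (β q) c
      (decide (c ∈ Q.filter fun c => sat s q c (β q) (β c) = 1)) =
      W (β c) c + 2 * ∑ u, if T u = 0 ∧ u ≠ q then sat s c u (β c) (B u) else 0 := by
    intro c hc
    have : decide (c ∈ Q.filter fun c => sat s q c (β q) (β c) = 1) =
        decide (sat s q c (β q) (β c) = 1) := by simp [hc]
    rw [weight, this, bitOf_sat hs (hfan.1 c hc)]
  rw [groupValue, ← satCount_fan hs hfan, Finset.sum_congr rfl hcross, Finset.sum_congr rfl hweight]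
  simp only [Finset.sum_add_distrib, ← Finset.mul_sum]
  ring

/-- The colouring of `Q` that satisfies exactly the edges from `q` to `Z`. -/
def recolour (s : V → V → ℤ) (β : V → Bool) (q : V) (Q Z : Finset V) : V → Bool :=
  fun v => if v ∈ Q then bitOf s q v (β q) (decide (v ∈ Z)) else β v

/-- Every `Z` occurs as the set of satisfied spokes of some recolouring of the group, so the best
colouring may be sought among the sets `Z`. -/
theorem Scheme.satCount_recolour (hs : IsSignMatrix s) (h : Scheme s {r} T P) (ht : t ≠ 0)
    (hq : ∀ c, T c = t → P c = q) (hqt : T q < t) {β : V → Bool} (hβ : Extends T B β)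
    {Z : Finset V} (hZ : Z ⊆ Finset.univ.filter fun v => T v = t) {β' : V → Bool}
    (hβ' : β' = recolour s β q (Finset.univ.filter fun v => T v = t) Z) :
    Extends T B β' ∧ (∀ v ∈ below T t, β' v = β v) ∧
    satCount s (below T (t + 1)) β' + ∑ v ∈ below T (t + 1), W (β' v) v =
      satCount s (below T t) β + ∑ v ∈ below T t, W (β v) v +
      groupValue s T B W q (β q) (Finset.univ.filter fun v => T v = t) Z := by
  set Q := Finset.univ.filter fun v => T v = t with hQ
  have hTQ : ∀ c ∈ Q, T c = t := fun c hc => (Finset.mem_filter.1 hc).2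
  have hext : Extends T B β' := by
    intro v hv
    rw [hβ', recolour, if_neg (fun hm => ht ((hTQ v hm).symm.trans hv))]
    exact hβ v hv
  have hagree : ∀ v ∈ below T t, β' v = β v := by
    intro v hv
    rw [hβ', recolour, if_neg (fun hm => ?_)]
    exact Finset.disjoint_left.1 (disjoint_below T t) hv hm
  have hqq : β' q = β q := hagree q (Finset.mem_filter.2 ⟨Finset.mem_univ _, hqt⟩)
  have hZ' : Q.filter (fun c => sat s q c (β' q) (β' c) = 1) = Z := by
    ext c
    rw [Finset.mem_filter]
    constructor
    · rintro ⟨hc, h1⟩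
      rw [hqq, hβ', recolour, if_pos hc, sat_bitOf hs ((h.fan ht hq).1 c hc)] at h1
      by_contra hno
      simp [hno] at h1
    · intro hc
      refine ⟨hZ hc, ?_⟩
      rw [hqq, hβ', recolour, if_pos (hZ hc), sat_bitOf hs ((h.fan ht hq).1 c (hZ hc))]
      simp [hc]
  refine ⟨hext, hagree, ?_⟩
  rw [h.satCount_below_succ hs ht hq hqt hext, hZ', hqq, satCount_congr hagree]
  congr 2
  exact Finset.sum_congr rfl fun v hv => by rw [hagree v hv]

/-- The value of a group is bounded, if the colour of the hub is possible. -/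
theorem Tables.add_groupValue_le (hs : IsSignMatrix s) (h : Scheme s {r} T P) (ht : t ≠ 0)
    (hq : ∀ c, T c = t → P c = q) (hqt : T q < t) (hW : Tables s T B (t + 1) W) {b : Bool}
    (hb : T q = 0 → b = B q) {Z : Finset V} (hZ : Z ⊆ Finset.univ.filter fun v => T v = t) :
    W b q + groupValue s T B W q b (Finset.univ.filter fun v => T v = t) Z ≤
      Fintype.card V * Fintype.card V := by
  -- The bound is read off an actual colouring that gives `q` the colour `b`. This is why `b` has to
  -- be the prescribed colour if `q` has level zero.
  set β : V → Bool := Function.update B q b with hβdef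
  have hβq : β q = b := Function.update_self ..
  have hβ : Extends T B β := by
    intro v hv
    by_cases hvq : v = q
    · rw [hvq, hβq]; exact hb (hvq ▸ hv)
    · exact Function.update_of_ne hvq _ _
  obtain ⟨h1, -, h3⟩ := h.satCount_recolour (W := W) hs ht hq hqt hβ hZ rfl
  have h4 := hW.le_sq h1
  rw [h3, hβq] at h4
  have h5 : W b q ≤ ∑ v ∈ below T t, W (β v) v := by
    have : W (β q) q ≤ ∑ v ∈ below T t, W (β v) v :=
      Finset.single_le_sum (f := fun v => W (β v) v) (fun _ _ => Nat.zero_le _)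
      (Finset.mem_filter.2 ⟨Finset.mem_univ _, hqt⟩ : q ∈ below T t)
    rwa [hβq] at this
  omega

/-- One more level is removed. -/
theorem Tables.step (hs : IsSignMatrix s) (h : Scheme s {r} T P) (ht : t ≠ 0)
    (hq : ∀ c, T c = t → P c = q) (hqt : T q < t) (hW : Tables s T B (t + 1) W)
    {W' : Bool → V → ℕ} (hW' : ∀ b v, (T v = 0 → b = B v) → T v < t →
      W' b v = if v = q then W b v + (Finset.univ.filter fun v => T v = t).powerset.sup
        (groupValue s T B W q b (Finset.univ.filter fun v => T v = t)) else W b v) :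
    Tables s T B t W' := by
  set Q := Finset.univ.filter fun v => T v = t with hQ
  have hmem : q ∈ below T t := Finset.mem_filter.2 ⟨Finset.mem_univ _, hqt⟩
  -- The entry of a level-zero vertex for the wrong colour never occurs in such a sum, so nothing is
  -- required of it.
  have hsum : ∀ β, Extends T B β → ∑ v ∈ below T t, W' (β v) v = ∑ v ∈ below T t, W (β v) v +
      Q.powerset.sup (groupValue s T B W q (β q) Q) := by
    intro β hβ
    have : ∀ v ∈ below T t, W' (β v) v =
        W (β v) v + if v = q then Q.powerset.sup (groupValue s T B W q (β q) Q) else 0 := by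
      intro v hv
      rw [hW' (β v) v (hβ v) (Finset.mem_filter.1 hv).2]
      split_ifs with hvq
      · rw [hvq]
      · rfl
    rw [Finset.sum_congr rfl this, Finset.sum_add_distrib, Finset.sum_ite_eq' , if_pos hmem]
  constructor
  · intro β β' hβ hβ' hagree
    have h1 := hW.le β' β' hβ' hβ' fun _ _ => rfl
    rw [h.satCount_below_succ hs ht hq hqt hβ', ← hQ] at h1
    rw [hsum β hβ, ← satCount_congr hagree, ← hagree q hmem]
    have h2 : ∑ v ∈ below T t, W (β' v) v = ∑ v ∈ below T t, W (β v) v :=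
      Finset.sum_congr rfl fun v hv => by rw [hagree v hv]
    have h3 : groupValue s T B W q (β' q) Q (Q.filter fun c => sat s q c (β' q) (β' c) = 1) ≤
        Q.powerset.sup (groupValue s T B W q (β' q) Q) :=
      Finset.le_sup (f := groupValue s T B W q (β' q) Q)
        (Finset.mem_powerset.2 (Finset.filter_subset _ _))
    omega
  · intro β hβ
    obtain ⟨Z, hZ, hmax⟩ := Finset.exists_mem_eq_sup Q.powerset ⟨∅, Finset.empty_mem_powerset Q⟩
      (groupValue s T B W q (β q) Q)
    obtain ⟨h1, h2, h3⟩ := h.satCount_recolour (W := W) hs ht hq hqt hβ (Finset.mem_powerset.1 hZ) rfl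
    obtain ⟨β'', h4, h5, h6⟩ := hW.exists_eq _ h1
    refine ⟨β'', h4, fun v hv => ?_, ?_⟩
    · rw [h5 v, h2 v hv]
      rw [below_succ]
      exact Finset.mem_union_left _ hv
    · rw [h6, h3, hsum β hβ, hmax]
      ring

omit [DecidableEq V] in
/-- A level without vertices is removed. -/
theorem Tables.step_empty (hW : Tables s T B (t + 1) W) (hQ : ∀ v, T v ≠ t)
    {W' : Bool → V → ℕ} (hW' : ∀ b v, (T v = 0 → b = B v) → T v < t → W' b v = W b v) :
    Tables s T B t W' := by
  have hbelow : below T (t + 1) = below T t := by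
    ext v
    have := hQ v
    simp only [below, Finset.mem_filter, Finset.mem_univ, true_and]
    omega
  have hsum : ∀ β, Extends T B β → ∑ v ∈ below T t, W' (β v) v = ∑ v ∈ below T t, W (β v) v :=
    fun β hβ => Finset.sum_congr rfl fun v hv => hW' _ _ (hβ v) (Finset.mem_filter.1 hv).2
  constructor
  · intro β β' h1 h2 h3
    rw [hsum β h1, ← hbelow]
    exact hW.le β β' h1 h2 (hbelow ▸ h3)
  · intro β h1
    rw [hsum β h1, ← hbelow]
    exact hW.exists_eq β h1

omit [DecidableEq V] in
/-- When only the vertices with `T v = 0` are left, the tables give the best colouring. -/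
theorem Tables.isGreatest (hW : Tables s T B 1 W) :
    IsGreatest {m | ∃ β, Extends T B β ∧ m = satCount s Finset.univ β}
      (satCount s (below T 1) B + ∑ v ∈ below T 1, W (B v) v) := by
  have hB : Extends T B B := fun _ _ => rfl
  constructor
  · obtain ⟨β, h1, -, h3⟩ := hW.exists_eq B hB
    exact ⟨β, h1, h3.symm⟩
  · rintro _ ⟨β, hβ, rfl⟩
    refine hW.le B β hB hβ fun v hv => hβ v ?_
    have := (Finset.mem_filter.1 hv).2
    omega

end

end SignMatrix

/-! ### The knapsack recursion and binary counting. -/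

namespace SignMatrix

variable {V : Type*} [DecidableEq V]

/-- The largest total weight of a selection of `y` elements of `D`, plus one; zero if there is no
such selection. -/
def knapsack (w : V → Bool → ℕ) (D : Finset V) (y : ℕ) : ℕ :=
  (D.powersetCard y).sup fun Z => 1 + ∑ c ∈ D, w c (decide (c ∈ Z))

theorem knapsack_empty (w : V → Bool → ℕ) (y : ℕ) :
    knapsack w ∅ y = if y = 0 then 1 else 0 := by
  unfold knapsack
  cases y with
  | zero => simp
  | succ y => rw [Finset.powersetCard_eq_empty.2 (by simp)]; simp

/-- An empty supremum is `0`. As all values are positive, `0` unambiguously means that there is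
nothing to choose from; this is the purpose of the extra one in `knapsack`. -/
theorem sup_add_const {ι : Type*} (A : Finset ι) (g : ι → ℕ) (hg : ∀ i ∈ A, g i ≠ 0) (w : ℕ) :
    A.sup (fun i => g i + w) = if A.sup g = 0 then 0 else A.sup g + w := by
  rcases A.eq_empty_or_nonempty with rfl | hA
  · simp
  · obtain ⟨i, hi, h⟩ := Finset.exists_mem_eq_sup A hA g
    rw [if_neg (by rw [h]; exact hg i hi)]
    refine le_antisymm (Finset.sup_le fun j hj => ?_) ?_
    · have := Finset.le_sup (f := g) hj
      omega
    · rw [h]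
      exact Finset.le_sup (f := fun i => g i + w) hi

/-- A selection either omits `c` or consists of `c` and `y - 1` elements of `D`. The second case
needs `y ≠ 0`, because `0 - 1 = 0`. -/
theorem knapsack_insert (w : V → Bool → ℕ) {D : Finset V} {c : V} (hc : c ∉ D) (y : ℕ) :
    knapsack w (insert c D) y = max (if knapsack w D y = 0 then 0 else knapsack w D y + w c false)
      (if y = 0 ∨ knapsack w D (y - 1) = 0 then 0 else knapsack w D (y - 1) + w c true) := by
  have hout : ∀ z, (D.powersetCard z).sup (fun Z => 1 + ∑ d ∈ insert c D, w d (decide (d ∈ Z))) =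
      if knapsack w D z = 0 then 0 else knapsack w D z + w c false := by
    intro z
    rw [knapsack, ← sup_add_const _ _ (fun Z _ => by omega)]
    refine Finset.sup_congr rfl fun Z hZ => ?_
    have hcZ : c ∉ Z := fun h => hc ((Finset.mem_powersetCard.1 hZ).1 h)
    rw [Finset.sum_insert hc, decide_eq_false hcZ]
    ring
  cases y with
  | zero =>
    rw [if_pos (Or.inl rfl), ← hout, knapsack]
    simp
  | succ y =>
    have hin : ((D.powersetCard y).image (insert c)).sup
        (fun Z => 1 + ∑ d ∈ insert c D, w d (decide (d ∈ Z))) =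
        if knapsack w D y = 0 then 0 else knapsack w D y + w c true := by
      rw [knapsack, ← sup_add_const _ _ (fun Z _ => by omega), Finset.sup_image]
      refine Finset.sup_congr rfl fun Z hZ => ?_
      rw [Function.comp_apply, Finset.sum_insert hc, decide_eq_true (Finset.mem_insert_self c Z)]
      have : ∀ d ∈ D, w d (decide (d ∈ insert c Z)) = w d (decide (d ∈ Z)) := by
        intro d hd
        have : d ≠ c := fun h => hc (h ▸ hd)
        simp [this]
      rw [Finset.sum_congr rfl this]
      ring
    rw [knapsack, Finset.powersetCard_succ_insert hc, Finset.sup_union, hout, hin]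
    simp

/-- Partial tables never exceed the bound for complete selections by more than the extra one, so
clipping does not touch them. -/
theorem knapsack_le (w : V → Bool → ℕ) {D Q : Finset V} (hD : D ⊆ Q) (y : ℕ) {m : ℕ}
    (h : ∀ Z ⊆ Q, ∑ c ∈ Q, w c (decide (c ∈ Z)) ≤ m) : knapsack w D y ≤ m + 1 := by
  refine Finset.sup_le fun Z hZ => ?_
  have h1 := h Z ((Finset.mem_powersetCard.1 hZ).1.trans hD)
  have h2 : ∑ c ∈ D, w c (decide (c ∈ Z)) ≤ ∑ c ∈ Q, w c (decide (c ∈ Z)) :=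
    Finset.sum_le_sum_of_subset hD
  omega

/-- The best selection is found by looking at the best selections of each size. -/
theorem sup_powerset_eq (w : V → Bool → ℕ) (g : ℕ → ℕ) {Q : Finset V} {n : ℕ} (hn : Q.card < n) :
    Q.powerset.sup (fun Z => ∑ c ∈ Q, w c (decide (c ∈ Z)) + g Z.card) =
      Finset.univ.sup fun y : Fin n =>
        if knapsack w Q y = 0 then 0 else knapsack w Q y - 1 + g y := by
  refine le_antisymm (Finset.sup_le fun Z hZ => ?_) (Finset.sup_le fun y _ => ?_)
  · have hle := Finset.card_le_card (Finset.mem_powerset.1 hZ)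
    have h1 : 1 + ∑ c ∈ Q, w c (decide (c ∈ Z)) ≤ knapsack w Q Z.card :=
      Finset.le_sup (f := fun Z => 1 + ∑ c ∈ Q, w c (decide (c ∈ Z)))
        (Finset.mem_powersetCard.2 ⟨Finset.mem_powerset.1 hZ, rfl⟩)
    refine le_trans ?_ (Finset.le_sup (f := fun y : Fin n =>
      if knapsack w Q y = 0 then 0 else knapsack w Q y - 1 + g y)
      (Finset.mem_univ (⟨Z.card, by omega⟩ : Fin n)))
    simp only
    rw [if_neg (by omega)]
    omega
  · split_ifs with h
    · exact Nat.zero_le _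
    · have hne : (Q.powersetCard y).Nonempty := by
        rw [Finset.nonempty_iff_ne_empty]
        intro h0
        exact h (by rw [knapsack, h0]; rfl)
      obtain ⟨Z, hZ, hmax⟩ := Finset.exists_mem_eq_sup (Q.powersetCard y) hne
        (fun Z => 1 + ∑ c ∈ Q, w c (decide (c ∈ Z)))
      obtain ⟨h1, h2⟩ := Finset.mem_powersetCard.1 hZ
      rw [knapsack, hmax, ← h2]
      refine le_trans ?_ (Finset.le_sup (f := fun Z => ∑ c ∈ Q, w c (decide (c ∈ Z)) + g Z.card)
        (Finset.mem_powerset.2 h1))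
      omega

/-- Binary counting on the bits in a list. -/
def increment : List V → (V → Bool) → V → Bool
  | [], B => B
  | v :: L, B => if B v then increment L (Function.update B v false) else Function.update B v true

theorem increment_update {L : List V} {v : V} (hv : v ∉ L) (B : V → Bool) (b : Bool) :
    increment L (Function.update B v b) = Function.update (increment L B) v b := by
  induction L generalizing B with
  | nil => rfl
  | cons u L ih =>
    rw [List.mem_cons, not_or] at hv
    have huv : u ≠ v := fun h => hv.1 h.symm
    rw [increment, increment, Function.update_of_ne huv, Function.update_comm hv.1,
      Function.update_comm hv.1, ih hv.2]
    split_ifs <;> rfl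

/-- The head of the list is the lowest bit: two steps restore it and carry once into the tail. -/
theorem increment_two {L : List V} {v : V} (hv : v ∉ L) :
    (increment (v :: L))^[2] = increment L := by
  funext B
  change increment (v :: L) (increment (v :: L) B) = _
  by_cases h : B v
  · rw [increment, increment, if_pos h, increment_update hv, Function.update_self,
      if_neg (by simp), Function.update_idem]
    rw [← increment_update hv]
    congr 1
    rw [← h, Function.update_eq_self]
  · rw [increment, increment, if_neg h, Function.update_self, if_pos rfl, Function.update_idem]
    congr 1
    rw [show false = B v by simpa using h, Function.update_eq_self]

theorem increment_of_notMem {L : List V} {v : V} (hv : v ∉ L) (B : V → Bool) :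
    increment L B v = B v := by
  have := increment_update hv B (B v)
  rw [Function.update_eq_self] at this
  rw [this, Function.update_self]

/-- Counting reaches every combination of the bits. -/
theorem exists_iterate_increment {L : List V} (hL : L.Nodup) (B C : V → Bool)
    (h : ∀ v, v ∉ L → B v = C v) : ∃ i < 2 ^ L.length, (increment L)^[i] B = C := by
  induction L generalizing B C with
  | nil => exact ⟨0, by simp, funext fun v => h v (by simp)⟩
  | cons v L ih =>
    -- An even number of steps keeps the bit of `v` and counts on `L`. If that bit is wrong at the
    -- start, one step corrects it.
    rw [List.nodup_cons] at hL
    have even : ∀ B : V → Bool, (∀ w, w ∉ v :: L → B w = C w) → B v = C v →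
        ∃ i < 2 ^ L.length, (increment (v :: L))^[2 * i] B = C := by
      intro B h hv
      obtain ⟨i, hi, hi'⟩ := ih hL.2 B C fun w hw => by
        by_cases hwv : w = v
        · rw [hwv, hv]
        · exact h w (by simp [hwv, hw])
      exact ⟨i, hi, by rw [Function.iterate_mul, increment_two hL.1, hi']⟩
    rw [List.length_cons, pow_succ]
    by_cases hv : B v = C v
    · obtain ⟨i, hi, hi'⟩ := even B h hv
      exact ⟨2 * i, by omega, hi'⟩
    · obtain ⟨i, hi, hi'⟩ := even (increment (v :: L) B)
        (fun w hw => by rw [increment_of_notMem hw, h w hw]) (by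
          rw [increment]
          split_ifs with hb
          · rw [increment_update hL.1, Function.update_self]
            revert hv; rw [hb]; cases C v <;> simp
          · rw [Function.update_self]
            revert hv hb; cases C v <;> cases B v <;> simp)
      exact ⟨2 * i + 1, by omega, by rw [Function.iterate_add_apply]; exact hi'⟩

end SignMatrix

/-! ### Logic within expressions, and frame rules for commands. -/

namespace RAM

namespace Exp

/-- The expression holds if its value is not zero. -/
def Holds {n : ℕ} (k : ℕ) (σ : Arr n) (e : Exp) (d : ℕ) (ρ : ℕ → Fin n) : Prop := e.eval k σ d ρ ≠ 0

def not (e : Exp) : Exp := ite e (const 0) (const 1)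

def and (e f : Exp) : Exp := ite e f (const 0)

def or (e f : Exp) : Exp := ite e (const 1) f

/-- Subtraction is truncated; only for equal values do both differences vanish. -/
def eq (e f : Exp) : Exp := ite (add (sub e f) (sub f e)) (const 0) (const 1)

def all (e : Exp) : Exp := not (sup (not e))

def max (e f : Exp) : Exp := add e (sub f e)

/-- The value `1` if `e` holds and `0` otherwise. -/
def flag (e : Exp) : Exp := ite e (const 1) (const 0)

variable {n : ℕ} {k : ℕ} {σ : Arr n} {d : ℕ} {ρ : ℕ → Fin n} {e f g : Exp}

theorem eval_const {c : ℕ} : (const c).eval k σ d ρ = c := rfl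

theorem eval_var {i : ℕ} : (var i).eval k σ d ρ = ρ i := rfl

theorem eval_par : par.eval k σ d ρ = k := rfl

theorem eval_rd {a i j : ℕ} : (rd a i j).eval k σ d ρ = σ a (ρ i) (ρ j) := rfl

theorem eval_add : (add e f).eval k σ d ρ = e.eval k σ d ρ + f.eval k σ d ρ := rfl

theorem eval_sub : (sub e f).eval k σ d ρ = e.eval k σ d ρ - f.eval k σ d ρ := rfl

theorem eval_sum : (sum e).eval k σ d ρ =
    ∑ x, e.eval k σ (d + 1) (Function.update ρ d x) := rfl

theorem eval_sup : (sup e).eval k σ d ρ =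
    Finset.univ.sup fun x => e.eval k σ (d + 1) (Function.update ρ d x) := rfl

open Classical in
theorem eval_ite : (ite e f g).eval k σ d ρ =
    if e.Holds k σ d ρ then f.eval k σ d ρ else g.eval k σ d ρ := by
  rw [eval, Holds]
  congr

theorem eval_max : (max e f).eval k σ d ρ = Max.max (e.eval k σ d ρ) (f.eval k σ d ρ) := by
  rw [max, eval_add, eval_sub]
  omega

open Classical in
theorem eval_flag : (flag e).eval k σ d ρ = if e.Holds k σ d ρ then 1 else 0 := eval_ite

theorem holds_not : (not e).Holds k σ d ρ ↔ ¬ e.Holds k σ d ρ := by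
  rw [Holds, not, eval_ite]
  split_ifs with h <;> simp [eval_const, h]

theorem holds_and : (and e f).Holds k σ d ρ ↔ e.Holds k σ d ρ ∧ f.Holds k σ d ρ := by
  rw [Holds, and, eval_ite]
  split_ifs with h
  · exact ⟨fun h' => ⟨h, h'⟩, fun h' => h'.2⟩
  · exact ⟨fun h' => absurd rfl h', fun h' => absurd h'.1 h⟩

theorem holds_or : (or e f).Holds k σ d ρ ↔ e.Holds k σ d ρ ∨ f.Holds k σ d ρ := by
  rw [Holds, or, eval_ite]
  split_ifs with h
  · exact ⟨fun _ => Or.inl h, fun _ => one_ne_zero⟩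
  · exact ⟨Or.inr, fun h' => h'.resolve_left h⟩

theorem holds_ite : (ite e f g).Holds k σ d ρ ↔
    (e.Holds k σ d ρ ∧ f.Holds k σ d ρ) ∨ (¬ e.Holds k σ d ρ ∧ g.Holds k σ d ρ) := by
  rw [Holds, eval_ite]
  split_ifs with h
  · exact ⟨fun h' => Or.inl ⟨h, h'⟩, fun h' => (h'.resolve_right fun h'' => h''.1 h).2⟩
  · exact ⟨fun h' => Or.inr ⟨h, h'⟩, fun h' => (h'.resolve_left fun h'' => h h''.1).2⟩

theorem holds_eq : (eq e f).Holds k σ d ρ ↔ e.eval k σ d ρ = f.eval k σ d ρ := by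
  rw [Holds, eq, eval_ite, Holds, eval_add, eval_sub, eval_sub]
  split_ifs with h <;> simp only [eval_const] <;> omega

theorem holds_sub : (sub e f).Holds k σ d ρ ↔ f.eval k σ d ρ < e.eval k σ d ρ := by
  rw [Holds, eval_sub]
  omega

theorem holds_rd {a i j : ℕ} : (rd a i j).Holds k σ d ρ ↔ σ a (ρ i) (ρ j) ≠ 0 := Iff.rfl

theorem holds_flag : (flag e).Holds k σ d ρ ↔ e.Holds k σ d ρ := by
  rw [Holds, eval_flag]
  split_ifs with h <;> simp [h]

theorem holds_sup : (sup e).Holds k σ d ρ ↔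
    ∃ x, e.Holds k σ (d + 1) (Function.update ρ d x) := by
  rw [Holds, eval_sup, ← Nat.pos_iff_ne_zero]
  rw [Finset.lt_sup_iff]
  simp [Holds, Nat.pos_iff_ne_zero]

theorem holds_all : (all e).Holds k σ d ρ ↔
    ∀ x, e.Holds k σ (d + 1) (Function.update ρ d x) := by
  rw [all, holds_not, holds_sup]
  simp only [holds_not, not_exists, not_not]

end Exp

namespace Cmd

/-- The command does not assign to the array `a`. -/
def Keeps (a : ℕ) : Cmd → Prop
  | asg b _ => a ≠ b
  | seq c c' => c.Keeps a ∧ c'.Keeps a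
  | for_ c => c.Keeps a

variable {n : ℕ} {k cap : ℕ}

theorem Keeps.denote_eq {a : ℕ} {c : Cmd} (h : c.Keeps a) (d : ℕ) (ρ : ℕ → Fin n) (σ : Arr n) :
    c.denote k cap d ρ σ a = σ a := by
  induction c generalizing d ρ σ with
  | asg b e => exact Function.update_of_ne h _ _
  | seq c c' ih ih' => rw [denote, ih' h.2, ih h.1]
  | for_ c ih =>
    rw [denote]
    exact forDown_induction (fun _ σ' => σ' a = σ a) (fun x σ' h' => (ih h _ _ _).trans h') n le_rfl
      σ rfl

theorem denote_seq (c c' : Cmd) (d : ℕ) (ρ : ℕ → Fin n) (σ : Arr n) :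
    (seq c c').denote k cap d ρ σ = c'.denote k cap d ρ (c.denote k cap d ρ σ) := rfl

theorem denote_asg_self (a : ℕ) (e : Exp) (d : ℕ) (ρ : ℕ → Fin n) (σ : Arr n) (x y : Fin n) :
    (asg a e).denote k cap d ρ σ a x y =
      min (e.eval k σ (d + 2) (Function.update (Function.update ρ d x) (d + 1) y)) cap := by
  rw [denote, Function.update_self]

theorem denote_asg_ne (a : ℕ) (e : Exp) (d : ℕ) (ρ : ℕ → Fin n) (σ : Arr n) {b : ℕ} (h : b ≠ a) :
    (asg a e).denote k cap d ρ σ b = σ b := Function.update_of_ne h _ _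

theorem denote_asg_ne_zero (hcap : cap ≠ 0) (a : ℕ) (e : Exp) (d : ℕ) (ρ : ℕ → Fin n) (σ : Arr n)
    (x y : Fin n) : (asg a e).denote k cap d ρ σ a x y ≠ 0 ↔
      e.Holds k σ (d + 2) (Function.update (Function.update ρ d x) (d + 1) y) := by
  rw [denote_asg_self, Exp.Holds]
  omega

end Cmd

end RAM

/-! ### The expressions and commands of the second phase. -/

namespace RAM

open Exp Cmd

/-! The arrays of the program: `0` the matrix of codes; `1` to `6` see the first phase; `7` and `8`
the levels and the hubs; `9` the colours of the vertices of level zero; `10` and `11` the weights;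
`12` the knapsack; `13` the carry; `14` and `16` the values of the group; `15` the best value.
Apart from the matrix, only the diagonals are used. -/

/-- The vertex `c` is in the group of level `t`. -/
def inGroupExp (t c : ℕ) : Exp := and (rd 7 c c) (eq (rd 7 c c) (var t))

/-- The pair `u`, `v`, with the colours given by `e` and `f`, is a satisfied edge. -/
def satExp (u v : ℕ) (e f : Exp) : Exp :=
  flag (or (and (eq (rd 0 u v) (const 1)) (or (and e f) (and (not e) (not f))))
    (and (eq (rd 0 u v) (const 2)) (or (and e (not f)) (and (not e) f))))

/-- The weight table for a colour. -/
def weightArr (b : Bool) : ℕ := if b then 11 else 10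

def boolExp (b : Bool) : Exp := const b.toNat

/-- The weight of `c` with colour `b`, where `d` variables are bound. -/
def colourWeightExp (d c : ℕ) (b : Bool) : Exp :=
  let e := sum (ite (and (not (rd 7 d d)) (not (eq (var d) (rd 8 c c))))
    (satExp c d (boolExp b) (rd 9 d d)) (const 0))
  add (rd (weightArr b) c c) (add e e)

/-- Arrays are indexed by variables only, so the sign of the edge to the hub is read through a bound
variable that equals the hub. The two branches are the two values of the sign test in `bitOf`. -/
def weightExp (d c : ℕ) (b z : Bool) : Exp :=
  ite (sup (and (eq (var d) (rd 8 c c)) (eq (rd 0 d c) (const 1))))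
    (colourWeightExp d c (xor b (xor true z))) (colourWeightExp d c (xor b (xor false z)))

/-- The update of the knapsack for the element in variable `1`; the size is in variable `2`. -/
def knapsackExp (b : Bool) : Exp :=
  max (ite (rd 12 2 2) (add (rd 12 2 2) (weightExp 4 1 b false)) (const 0))
    (sup (ite (and (eq (add (var 4) (const 1)) (var 2)) (rd 12 4 4))
      (add (rd 12 4 4) (weightExp 5 1 b true)) (const 0)))

/-- There is no multiplication: the product of `y` and `|Q| + 1 - y` is a sum over the values below
`y`. A knapsack entry `0` means that no selection has this size; other entries are one too large. -/
def groupBestExp : Exp :=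
  let g := sum (ite (sub (var 3) (var 4)) (sub (add (sum (flag (inGroupExp 0 5))) (const 1)) (var 3))
    (const 0))
  sup (ite (rd 12 3 3) (add (sub (rd 12 3 3) (const 1)) (add g g)) (const 0))

/-- The array for the value of the group when its hub has colour `b`. -/
def resultArr (b : Bool) : ℕ := if b then 16 else 14

/-- Computes the best value of the group of the level in variable `0`, if its hub has colour `b`. -/
def groupCmd (b : Bool) : Cmd :=
  .seq (.asg 12 (eq (var 1) (const 0)))
  (.seq (.for_ (.asg 12 (ite (inGroupExp 0 1) (knapsackExp b) (rd 12 2 2))))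
    (.asg (resultArr b) groupBestExp))

/-- Adds the value of the group of the level in variable `0` to the weights of its hub. -/
def addCmd (b : Bool) : Cmd :=
  .asg (weightArr b) (add (rd (weightArr b) 1 1)
    (ite (sup (and (inGroupExp 0 3) (eq (rd 8 3 3) (var 1)))) (rd (resultArr b) 1 1) (const 0)))

/-- Both group values are computed before either weight table changes, since each of them reads both
tables. -/
def levelCmd : Cmd :=
  .seq (groupCmd false) (.seq (groupCmd true) (.seq (addCmd false) (addCmd true)))

section

variable {n : ℕ} {k : ℕ} {σ : Arr n} {d : ℕ} {ρ : ℕ → Fin n}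

theorem holds_inGroupExp {t c : ℕ} : (inGroupExp t c).Holds k σ d ρ ↔
    σ 7 (ρ c) (ρ c) ≠ 0 ∧ σ 7 (ρ c) (ρ c) = ρ t := by
  simp only [inGroupExp, holds_and, holds_rd, holds_eq, eval_rd, eval_var]

/-- The input array holds the codes of the signs. -/
def Codes (σ : Arr n) (s : Fin n → Fin n → ℤ) : Prop :=
  ∀ u v, (σ 0 u v = 1 ↔ s u v = 1) ∧ (σ 0 u v = 2 ↔ s u v = -1) ∧ (σ 0 u v = 0 ↔ s u v = 0)

open SignMatrix

theorem eval_satExp {s : Fin n → Fin n → ℤ} (hc : Codes σ s) {u v : ℕ} {e f : Exp} {b b' : Bool}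
    (he : e.Holds k σ d ρ ↔ b = true) (hf : f.Holds k σ d ρ ↔ b' = true) :
    (satExp u v e f).eval k σ d ρ = sat s (ρ u) (ρ v) b b' := by
  simp only [satExp, eval_flag, holds_or, holds_and, holds_eq, holds_not, eval_rd, eval_const, he,
    hf, (hc _ _).1, (hc _ _).2.1, sat]
  cases b <;> cases b' <;> simp

theorem holds_boolExp {b : Bool} : (boolExp b).Holds k σ d ρ ↔ b = true := by
  cases b <;> simp [boolExp, Holds, eval_const]

/-- The diagonals hold the levels, the hubs, the colours and the best value. -/
structure Holding (σ : Arr n) (s : Fin n → Fin n → ℤ) (T : Fin n → ℕ) (P : Fin n → Fin n)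
    (B : Fin n → Bool) : Prop where
  codes : Codes σ s
  level : ∀ v, σ 7 v v = T v
  hub : ∀ v, σ 8 v v = P v
  colour : ∀ v, σ 9 v v ≠ 0 ↔ B v = true

variable {s : Fin n → Fin n → ℤ} {T : Fin n → ℕ} {P : Fin n → Fin n} {B : Fin n → Bool}

theorem eval_colourWeightExp (h : Holding σ s T P B) {c : ℕ} (hcd : c ≠ d) {b : Bool} :
    (colourWeightExp d c b).eval k σ d ρ = σ (weightArr b) (ρ c) (ρ c) +
      2 * ∑ u, if T u = 0 ∧ u ≠ P (ρ c) then sat s (ρ c) u b (B u) else 0 := by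
  simp only [colourWeightExp, eval_add, eval_rd, eval_sum]
  rw [← two_mul]
  congr 2
  refine Finset.sum_congr rfl fun u _ => ?_
  have hsat := eval_satExp (k := k) (d := d + 1) (ρ := Function.update ρ d u) h.codes (u := c)
    (v := d) (e := boolExp b) (f := rd 9 d d) (b := b) (b' := B u) holds_boolExp
    (by rw [holds_rd, Function.update_self]; exact h.colour u)
  rw [Function.update_self, Function.update_of_ne hcd] at hsat
  simp only [eval_ite, holds_and, holds_not, holds_eq, holds_rd, eval_rd, eval_var, eval_const,
    Function.update_self, Function.update_of_ne hcd, h.level, h.hub, hsat, Fin.val_inj]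
  congr 1
  simp

theorem eval_weightExp (h : Holding σ s T P B) {c : ℕ} (hcd : c ≠ d) {b z : Bool} :
    (weightExp d c b z).eval k σ d ρ =
      weight s T B (fun b v => σ (weightArr b) v v) (P (ρ c)) b (ρ c) z := by
  have hpos : (sup (and (eq (var d) (rd 8 c c)) (eq (rd 0 d c) (const 1)))).Holds k σ d ρ ↔
      s (P (ρ c)) (ρ c) = 1 := by
    simp only [holds_sup, holds_and, holds_eq, eval_var, eval_rd, eval_const, Function.update_self,
      Function.update_of_ne hcd, h.hub, Fin.val_inj, exists_eq_left, (h.codes _ _).1]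
  rw [weightExp, eval_ite, weight, bitOf]
  split_ifs with h'
  · rw [eval_colourWeightExp h hcd, decide_eq_true (hpos.1 h')]
  · rw [eval_colourWeightExp h hcd, decide_eq_false (mt hpos.2 h')]

theorem Holding.congr {σ' : Arr n} (h : Holding σ s T P B) (h0 : σ' 0 = σ 0) (h7 : σ' 7 = σ 7)
    (h8 : σ' 8 = σ 8) (h9 : σ' 9 = σ 9) : Holding σ' s T P B where
  codes u v := by rw [h0]; exact h.codes u v
  level v := by rw [h7]; exact h.level v
  hub v := by rw [h8]; exact h.hub v
  colour v := by rw [h9]; exact h.colour v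

end

end RAM

/-! ### Correctness of the knapsack computation. -/

namespace RAM

open Exp Cmd SignMatrix

variable {n k cap : ℕ} {σ : Arr n} {ρ : ℕ → Fin n} {s : Fin n → Fin n → ℤ} {T : Fin n → ℕ}
  {P : Fin n → Fin n} {B : Fin n → Bool}

theorem weightArr_ne {b : Bool} {a : ℕ} (h : a ≠ 10) (h' : a ≠ 11) : weightArr b ≠ a := by
  cases b
  · exact h.symm
  · exact h'.symm

/-- One step of the knapsack. -/
theorem denote_knapsackExp (h : Holding σ s T P B) {b : Bool} {q : Fin n} {D : Finset (Fin n)}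
    {c : Fin n} (hc : c ∉ D) (hq : P c = q) {w : Fin n → Bool → ℕ}
    (hw : w = weight s T B (fun b v => σ (weightArr b) v v) q b)
    (hF : ∀ y : Fin n, σ 12 y y = knapsack w D y) {ρ : ℕ → Fin n} (hρ : ρ 1 = c) :
    (knapsackExp b).eval k σ 4 ρ = knapsack w (insert c D) (ρ 2) := by
  rw [knapsack_insert w hc, knapsackExp, eval_max]
  congr 1
  · rw [eval_ite, holds_rd, eval_add, eval_rd, hF, eval_weightExp h (by omega), hρ, hq, ← hw]
    split_ifs <;> first | rfl | contradiction
  · rw [eval_sup]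
    have hterm : ∀ x, (ite (and (eq (add (var 4) (const 1)) (var 2)) (rd 12 4 4))
        (add (rd 12 4 4) (weightExp 5 1 b true)) (const 0)).eval k σ (4 + 1)
        (Function.update ρ 4 x) = if (x : ℕ) + 1 = ρ 2 ∧ knapsack w D x ≠ 0
          then knapsack w D x + w c true else 0 := by
      intro x
      rw [eval_ite, holds_and, holds_eq, holds_rd, eval_add, eval_add, eval_weightExp h (by omega)]
      simp only [eval_var, eval_const, eval_rd, Function.update_self, hF, Function.update_apply,
        show ¬ (2 = 4) by omega, show ¬ (1 = 4) by omega, if_false, hρ, hq, ← hw]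
    simp only [hterm]
    refine le_antisymm (Finset.sup_le fun x _ => ?_) ?_
    · split_ifs with h1 h2 h2
      · rcases h2 with h2 | h2
        · omega
        · exact absurd ((show ((ρ 2 : Fin n) : ℕ) - 1 = x by omega) ▸ h2) h1.2
      · rw [show ((ρ 2 : Fin n) : ℕ) - 1 = x by omega]
      · exact Nat.zero_le _
      · exact Nat.zero_le _
    · split_ifs with h2
      · exact Nat.zero_le _
      · push Not at h2
        have hlt : ((ρ 2 : Fin n) : ℕ) - 1 < n := by omega
        refine le_trans ?_ (Finset.le_sup (f := fun x : Fin n => if (x : ℕ) + 1 = ρ 2 ∧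
          knapsack w D x ≠ 0 then knapsack w D x + w c true else 0) (Finset.mem_univ ⟨_, hlt⟩))
        simp only
        rw [if_pos ⟨by omega, h2.2⟩]

/-- The knapsack loop. -/
theorem denote_knapsack (h : Holding σ s T P B) {b : Bool} {q : Fin n}
    {Q : Finset (Fin n)} (hQ : ∀ c, c ∈ Q ↔ T c ≠ 0 ∧ T c = ρ 0) (hq : ∀ c ∈ Q, P c = q)
    {w : Fin n → Bool → ℕ} (hw : w = weight s T B (fun b v => σ (weightArr b) v v) q b) {m : ℕ}
    (hm : ∀ Z ⊆ Q, ∑ c ∈ Q, w c (decide (c ∈ Z)) ≤ m) (hcap : m + 1 ≤ cap)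
    (hF : ∀ y : Fin n, σ 12 y y = if (y : ℕ) = 0 then 1 else 0) (y : Fin n) :
    (for_ (.asg 12 (ite (inGroupExp 0 1) (knapsackExp b) (rd 12 2 2)))).denote k cap 1 ρ σ 12 y y =
      knapsack w Q y := by
  have := forDown_induction (f := fun x => (asg 12 (ite (inGroupExp 0 1) (knapsackExp b)
    (rd 12 2 2))).denote k cap 2 (Function.update ρ 1 x))
    -- After the rounds from `n - 1` down to `m`, the table is the one for the elements of `Q` that
    -- are at least `m`.
    (fun m σ' => (∀ a, a ≠ 12 → σ' a = σ a) ∧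
      ∀ y : Fin n, σ' 12 y y = knapsack w (Q.filter fun c => m ≤ (c : ℕ)) y) ?_ n le_rfl σ ?_
  · rw [denote, this.2 y]
    congr 1
    exact Finset.filter_true_of_mem fun _ _ => Nat.zero_le _
  · rintro x σ' ⟨h1, h2⟩
    refine ⟨fun a ha => (denote_asg_ne _ _ _ _ _ ha).trans (h1 a ha), fun y => ?_⟩
    have h' : Holding σ' s T P B := h.congr (h1 _ (by omega)) (h1 _ (by omega)) (h1 _ (by omega))
      (h1 _ (by omega))
    rw [denote_asg_self, eval_ite, holds_inGroupExp]
    simp only [Function.update_apply, h'.level, show ¬ (0 = 3) by omega, show ¬ (0 = 2) by omega,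
      show ¬ (0 = 1) by omega, show ¬ (1 = 3) by omega, show ¬ (1 = 2) by omega, if_false, if_true]
    by_cases hx : x ∈ Q
    · rw [if_pos ((hQ x).1 hx), denote_knapsackExp h' (w := w) (q := q) (c := x)
        (D := Q.filter fun c => (x : ℕ) + 1 ≤ c) (by simp) (hq x hx) ?_ h2 (by simp)]
      · have hins : insert x (Q.filter fun c : Fin n => (x : ℕ) + 1 ≤ c) =
            Q.filter fun c : Fin n => (x : ℕ) ≤ c := by
          ext c
          simp only [Finset.mem_insert, Finset.mem_filter, Fin.ext_iff]
          constructor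
          · rintro (h | h)
            · exact ⟨(Fin.ext h : c = x) ▸ hx, by omega⟩
            · exact ⟨h.1, by omega⟩
          · rintro ⟨h, h'⟩
            by_cases hcx : (c : ℕ) = x
            · exact Or.inl hcx
            · exact Or.inr ⟨h, by omega⟩
        rw [hins, Function.update_apply, if_neg (by omega), Function.update_self, min_eq_left]
        exact (knapsack_le w (Finset.filter_subset _ _) _ hm).trans hcap
      · rw [hw]
        congr 1
        funext b v
        rw [h1 _ (weightArr_ne (by omega) (by omega))]
    · rw [if_neg (mt (hQ x).2 hx), eval_rd, Function.update_apply, if_neg (by omega),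
        Function.update_self, h2]
      have hins : (Q.filter fun c : Fin n => (x : ℕ) + 1 ≤ c) =
            Q.filter fun c : Fin n => (x : ℕ) ≤ c := by
        refine Finset.filter_congr fun c hc => ?_
        have : (c : ℕ) ≠ x := fun h => hx ((Fin.ext h : c = x) ▸ hc)
        omega
      rw [hins, min_eq_left]
      exact (knapsack_le w (Finset.filter_subset _ _) _ hm).trans hcap
  · refine ⟨fun _ _ => rfl, fun y => ?_⟩
    rw [Finset.filter_false_of_mem (fun c _ => by omega), knapsack_empty, hF]

theorem card_filter_lt_val (y : Fin n) :
    (Finset.univ.filter fun i : Fin n => (i : ℕ) < y).card = y := by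
  have : (Finset.univ.filter fun i : Fin n => (i : ℕ) < y) = Finset.Iio y := by
    ext i
    rw [Finset.mem_filter, Finset.mem_Iio, Fin.lt_def]
    exact and_iff_right (Finset.mem_univ i)
  rw [this, Fin.card_Iio]

theorem eval_groupBestExp (h : Holding σ s T P B) {Q : Finset (Fin n)}
    (hQ : ∀ c, c ∈ Q ↔ T c ≠ 0 ∧ T c = ρ 0) :
    groupBestExp.eval k σ 3 ρ = Finset.univ.sup fun y : Fin n =>
      if σ 12 y y = 0 then 0 else σ 12 y y - 1 + 2 * ((y : ℕ) * (Q.card + 1 - y)) := by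
  rw [groupBestExp, eval_sup]
  refine Finset.sup_congr rfl fun y _ => ?_
  rw [eval_ite, holds_rd, eval_add, eval_add, eval_sub, eval_rd, eval_const, Function.update_self]
  have hg : (sum (ite (sub (var 3) (var 4))
      (sub (add (sum (flag (inGroupExp 0 5))) (const 1)) (var 3)) (const 0))).eval k σ (3 + 1)
      (Function.update ρ 3 y) = (y : ℕ) * (Q.card + 1 - y) := by
    rw [eval_sum]
    have hcard : ∀ x, (sum (flag (inGroupExp 0 5))).eval k σ (3 + 1 + 1)
        (Function.update (Function.update ρ 3 y) (3 + 1) x) = Q.card := by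
      intro x
      rw [eval_sum, Finset.card_eq_sum_ones, ← Finset.sum_filter_add_sum_filter_not Finset.univ
        (· ∈ Q), Finset.filter_univ_mem]
      rw [Finset.sum_eq_zero (s := Finset.univ.filter _), add_zero]
      · refine Finset.sum_congr rfl fun c hc => ?_
        rw [eval_flag, holds_inGroupExp, if_pos]
        simpa [Function.update_apply, h.level] using (hQ c).1 hc
      · intro c hc
        rw [eval_flag, holds_inGroupExp, if_neg]
        have := mt (hQ c).2 (Finset.mem_filter.1 hc).2
        simpa [Function.update_apply, h.level] using this
    have : ∀ x : Fin n, (ite (sub (var 3) (var 4))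
        (sub (add (sum (flag (inGroupExp 0 5))) (const 1)) (var 3)) (const 0)).eval k σ (3 + 1 + 1)
        (Function.update (Function.update ρ 3 y) (3 + 1) x) =
        if (x : ℕ) < y then Q.card + 1 - y else 0 := by
      intro x
      rw [eval_ite, holds_sub, eval_sub, eval_add, hcard, eval_var, eval_var, eval_const, eval_const]
      simp only [Function.update_apply]
      simp
    simp only [this]
    rw [← Finset.sum_filter, Finset.sum_const, card_filter_lt_val, smul_eq_mul]
  rw [hg, ← two_mul]
  split_ifs <;> first | rfl | contradiction

end RAM

/-! ### Processing all levels. -/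

namespace RAM

open Exp Cmd SignMatrix

variable {n k cap : ℕ} {σ : Arr n} {ρ : ℕ → Fin n} {s : Fin n → Fin n → ℤ} {T : Fin n → ℕ}
  {P : Fin n → Fin n} {B : Fin n → Bool}

/-- The weights held by the arrays. -/
def weightTable (σ : Arr n) (b : Bool) (v : Fin n) : ℕ := σ (weightArr b) v v

theorem groupCmd_keeps {a : ℕ} (b : Bool) (h : a ≠ 12) (h' : a ≠ resultArr b) :
    (groupCmd b).Keeps a := ⟨h, h, h'⟩

/-- The bound `m` on the group values excludes any effect of clipping; the cap exceeds it by one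
because of the offset of the knapsack. -/
theorem denote_groupCmd (h : Holding σ s T P B) {b : Bool} {q : Fin n}
    {Q : Finset (Fin n)} (hQ : ∀ c, c ∈ Q ↔ T c ≠ 0 ∧ T c = ρ 0) (hq : ∀ c ∈ Q, P c = q)
    (hcard : Q.card < n) {m : ℕ} (hm : ∀ Z ⊆ Q, groupValue s T B (weightTable σ) q b Q Z ≤ m)
    (hcap : m + 1 ≤ cap) (v : Fin n) :
    (groupCmd b).denote k cap 1 ρ σ (resultArr b) v v =
      Q.powerset.sup (groupValue s T B (weightTable σ) q b Q) := by
  rw [groupCmd, denote_seq, denote_seq]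
  set σ₁ := (asg 12 (eq (var 1) (const 0))).denote k cap 1 ρ σ with hσ₁
  have h1 : ∀ a, a ≠ 12 → σ₁ a = σ a := fun a ha => denote_asg_ne _ _ _ _ _ ha
  have h1' : Holding σ₁ s T P B := h.congr (h1 _ (by omega)) (h1 _ (by omega)) (h1 _ (by omega))
      (h1 _ (by omega))
  have hW : (fun b v => σ₁ (weightArr b) v v) = weightTable σ := by
    funext b v
    rw [h1 _ (weightArr_ne (by omega) (by omega)), weightTable]
  have hF : ∀ y : Fin n, σ₁ 12 y y = if (y : ℕ) = 0 then 1 else 0 := by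
    intro y
    have := denote_asg_ne_zero (k := k) (cap := cap) (by omega) 12 (eq (var 1) (const 0)) 1 ρ σ y y
    rw [holds_eq, eval_var, eval_const, Function.update_of_ne (by omega), Function.update_self,
      ← hσ₁] at this
    have hle : σ₁ 12 y y ≤ 1 := by
      rw [hσ₁, denote_asg_self]
      refine (min_le_left _ _).trans ?_
      rw [Exp.eq, eval_ite]
      split_ifs <;> simp [eval_const]
    split_ifs <;> omega
  set w := weight s T B (weightTable σ) q b with hw
  have hwm : ∀ Z ⊆ Q, ∑ c ∈ Q, w c (decide (c ∈ Z)) ≤ m := fun Z hZ =>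
    (Nat.le_add_right _ _).trans (hm Z hZ)
  have hkn := denote_knapsack (k := k) (cap := cap) (ρ := ρ) (w := w) h1' hQ hq (hW ▸ hw) hwm hcap hF
  set σ₂ := (for_ (.asg 12 (ite (inGroupExp 0 1) (knapsackExp b) (rd 12 2 2)))).denote k cap 1 ρ σ₁
    with hσ₂
  have h2 : ∀ a, a ≠ 12 → σ₂ a = σ₁ a := fun a ha => Keeps.denote_eq (by exact ha) _ _ _
  have h2' : Holding σ₂ s T P B := h1'.congr (h2 _ (by omega)) (h2 _ (by omega)) (h2 _ (by omega))
      (h2 _ (by omega))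
  have hval : ∀ Z, groupValue s T B (weightTable σ) q b Q Z =
    ∑ c ∈ Q, w c (decide (c ∈ Z)) + (fun y => 2 * (y * (Q.card + 1 - y))) Z.card := fun Z => rfl
  have hsup : Q.powerset.sup (groupValue s T B (weightTable σ) q b Q) =
      Finset.univ.sup fun y : Fin n =>
        if knapsack w Q y = 0 then 0 else knapsack w Q y - 1 + 2 * ((y : ℕ) * (Q.card + 1 - y)) := by
    exact (Finset.sup_congr rfl fun Z _ => hval Z).trans
      (sup_powerset_eq w (fun y => 2 * (y * (Q.card + 1 - y))) hcard)
  rw [denote_asg_self, eval_groupBestExp h2' (Q := Q), hsup]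
  · simp only [hkn]
    rw [← hsup, min_eq_left]
    exact (Finset.sup_le fun Z hZ => hm Z (Finset.mem_powerset.1 hZ)).trans (by omega)
  · intro c
    rw [hQ c]
    simp

theorem addCmd_keeps {a : ℕ} (b : Bool) (h : a ≠ 10) (h' : a ≠ 11) : (addCmd b).Keeps a :=
  (weightArr_ne h h').symm

theorem levelCmd_keeps {a : ℕ} (h : a < 10 ∨ a = 13 ∨ a = 15) : levelCmd.Keeps a :=
  ⟨groupCmd_keeps _ (by omega) (show a ≠ 14 by omega),
    groupCmd_keeps _ (by omega) (show a ≠ 16 by omega),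
    addCmd_keeps _ (by omega) (by omega), addCmd_keeps _ (by omega) (by omega)⟩

theorem denote_addCmd (h : Holding σ s T P B) (b : Bool) (v : Fin n) :
    ((∃ c, T c ≠ 0 ∧ T c = ρ 0 ∧ P c = v) → weightTable ((addCmd b).denote k cap 1 ρ σ) b v =
      min (weightTable σ b v + σ (resultArr b) v v) cap) ∧
    ((¬ ∃ c, T c ≠ 0 ∧ T c = ρ 0 ∧ P c = v) →
      weightTable ((addCmd b).denote k cap 1 ρ σ) b v = min (weightTable σ b v) cap) := by
  have key : (sup (and (inGroupExp 0 3) (eq (rd 8 3 3) (var 1)))).Holds k σ (1 + 2)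
      (Function.update (Function.update ρ 1 v) (1 + 1) v) ↔ ∃ c, T c ≠ 0 ∧ T c = ρ 0 ∧ P c = v := by
    simp only [holds_sup, holds_and, holds_inGroupExp, holds_eq, eval_rd, eval_var,
      Function.update_apply, h.level, h.hub]
    simp [Fin.val_inj, and_assoc]
  have hval : weightTable ((addCmd b).denote k cap 1 ρ σ) b v = _ := denote_asg_self _ _ _ _ _ _ _
  rw [hval, eval_add, eval_ite]
  constructor
  · intro hc
    rw [if_pos (key.2 hc)]
    simp [eval_rd, weightTable]
  · intro hc
    rw [if_neg (mt key.1 hc)]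
    simp [eval_rd, eval_const, weightTable]

/-- The effect of processing a level on the weights. -/
theorem denote_levelCmd (h : Holding σ s T P B) (b : Bool) (v : Fin n) : ∃ R,
    (∀ (q : Fin n) (Q : Finset (Fin n)) (m : ℕ), (∀ c, c ∈ Q ↔ T c ≠ 0 ∧ T c = ρ 0) →
      (∀ c ∈ Q, P c = q) → Q.card < n →
      (∀ Z ⊆ Q, groupValue s T B (weightTable σ) q b Q Z ≤ m) → m + 1 ≤ cap →
      R = Q.powerset.sup (groupValue s T B (weightTable σ) q b Q)) ∧
    ((∃ c, T c ≠ 0 ∧ T c = ρ 0 ∧ P c = v) →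
      weightTable (levelCmd.denote k cap 1 ρ σ) b v = min (weightTable σ b v + R) cap) ∧
    ((¬ ∃ c, T c ≠ 0 ∧ T c = ρ 0 ∧ P c = v) →
      weightTable (levelCmd.denote k cap 1 ρ σ) b v = min (weightTable σ b v) cap) := by
  rw [levelCmd, denote_seq, denote_seq, denote_seq]
  set σ₁ := (groupCmd false).denote k cap 1 ρ σ with hσ₁
  have h1 : ∀ a, a ≠ 12 → a ≠ 14 → σ₁ a = σ a := fun a ha ha' =>
    (groupCmd_keeps false ha ha').denote_eq _ _ _
  have h1' : Holding σ₁ s T P B := h.congr (h1 _ (by omega) (by omega)) (h1 _ (by omega) (by omega))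
    (h1 _ (by omega) (by omega)) (h1 _ (by omega) (by omega))
  set σ₂ := (groupCmd true).denote k cap 1 ρ σ₁ with hσ₂
  have h2 : ∀ a, a ≠ 12 → a ≠ 16 → σ₂ a = σ₁ a := fun a ha ha' =>
    (groupCmd_keeps true ha ha').denote_eq _ _ _
  have h2' : Holding σ₂ s T P B := h1'.congr (h2 _ (by omega) (by omega))
    (h2 _ (by omega) (by omega)) (h2 _ (by omega) (by omega)) (h2 _ (by omega) (by omega))
  set σ₃ := (addCmd false).denote k cap 1 ρ σ₂ with hσ₃
  have h3 : ∀ a, a ≠ 10 → σ₃ a = σ₂ a := fun a ha => denote_asg_ne _ _ _ _ _ ha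
  have h3' : Holding σ₃ s T P B := h2'.congr (h3 _ (by omega)) (h3 _ (by omega)) (h3 _ (by omega))
    (h3 _ (by omega))
  have hW1 : weightTable σ₁ = weightTable σ := by
    funext b v
    rw [weightTable, h1 _ (weightArr_ne (by omega) (by omega)) (weightArr_ne (by omega) (by omega)),
      weightTable]
  have hW2 : weightTable σ₂ = weightTable σ := by
    rw [← hW1]
    funext b v
    rw [weightTable, h2 _ (weightArr_ne (by omega) (by omega)) (weightArr_ne (by omega) (by omega)),
      weightTable]
  cases b
  · refine ⟨σ₂ 14 v v, fun q Q m hQ hq hcard hm hcap => ?_, ?_⟩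
    · rw [h2 _ (by omega) (by omega)]
      exact denote_groupCmd h hQ hq hcard hm hcap v
    · have : weightTable ((addCmd true).denote k cap 1 ρ σ₃) false v = weightTable σ₃ false v := by
        rw [weightTable, addCmd, denote_asg_ne _ _ _ _ _ (by decide), weightTable]
      rw [this, ← hW2]
      exact denote_addCmd h2' false v
  · refine ⟨σ₃ 16 v v, fun q Q m hQ hq hcard hm hcap => ?_, ?_⟩
    · rw [h3 _ (by omega), ← hW1]
      rw [← hW1] at hm
      exact denote_groupCmd h1' hQ hq hcard hm hcap v
    · have : weightTable σ₃ true v = weightTable σ true v := by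
        rw [← hW2, weightTable, h3 _ (by decide), weightTable]
      rw [← this]
      exact denote_addCmd h3' true v

/-- All levels are processed. -/
def tablesCmd : Cmd := .seq (.asg 10 (const 0)) (.seq (.asg 11 (const 0)) (.for_ levelCmd))

theorem tablesCmd_keeps {a : ℕ} (h : a < 10 ∨ a = 13 ∨ a = 15) : tablesCmd.Keeps a :=
  ⟨show a ≠ 10 by omega, show a ≠ 11 by omega, levelCmd_keeps h⟩

/-- Each round is an instance of `Tables.step`, or of `Tables.step_empty` if the level has no
vertices. The totals are at most `n * n`, so clipping changes no entry that matters. -/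
theorem denote_tablesCmd (hs : IsSignMatrix s) {r : Fin n} (hsch : Scheme s {r} T P)
    (hT : ∀ v, T v < n) (h : Holding σ s T P B) (hcap : n * n + 1 ≤ cap) :
    Tables s T B 1 (weightTable (tablesCmd.denote k cap 0 ρ σ)) := by
  rw [tablesCmd, denote_seq, denote_seq]
  set σ₂ := (asg 11 (const 0)).denote k cap 0 ρ ((asg 10 (const 0)).denote k cap 0 ρ σ) with hσ₂
  have h2 : ∀ a, a ≠ 10 → a ≠ 11 → σ₂ a = σ a := fun a ha ha' =>
    (denote_asg_ne _ _ _ _ _ ha').trans (denote_asg_ne _ _ _ _ _ ha)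
  have hW2 : weightTable σ₂ = fun _ _ => 0 := by
    funext b v
    cases b
    · rw [weightTable, hσ₂, denote_asg_ne _ _ _ _ _ (by decide)]
      exact (denote_asg_self _ _ _ _ _ _ _).trans (Nat.zero_min _)
    · exact (denote_asg_self _ _ _ _ _ _ _).trans (Nat.zero_min _)
  have key := forDown_induction (f := fun x => levelCmd.denote k cap 1 (Function.update ρ 0 x))
    -- The maximum with `1` appears because level zero is not a group: the last round changes
    -- nothing.
    (fun m σ' => (∀ a, a < 10 → σ' a = σ a) ∧ (∀ b v, weightTable σ' b v ≤ cap) ∧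
      Tables s T B (max m 1) (weightTable σ')) ?_ n le_rfl σ₂ ?_
  · exact key.2.2
  · rintro x σ' ⟨h1, h2, h3⟩
    have h' : Holding σ' s T P B := h.congr (h1 _ (by omega)) (h1 _ (by omega)) (h1 _ (by omega))
      (h1 _ (by omega))
    have spec := denote_levelCmd (k := k) (cap := cap) (ρ := Function.update ρ 0 x) h'
    simp only [Function.update_self] at spec
    refine ⟨fun a ha => ((levelCmd_keeps (Or.inl ha)).denote_eq _ _ _).trans (h1 a ha),
      fun b v => ?_, ?_⟩
    · obtain ⟨R, -, hR1, hR2⟩ := spec b v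
      by_cases hc : ∃ c, T c ≠ 0 ∧ T c = x ∧ P c = v
      · rw [hR1 hc]; exact min_le_right _ _
      · rw [hR2 hc]; exact min_le_right _ _
    · by_cases hx : ∃ c, T c ≠ 0 ∧ T c = x
      · obtain ⟨c₀, hc₀, hc₀x⟩ := hx
        have hx0 : (x : ℕ) ≠ 0 := hc₀x ▸ hc₀
        set q := P c₀ with hq
        have hhub : ∀ c, T c = x → P c = q := fun c hc =>
          hsch.hub_eq c₀ c hc₀ (hc.trans hc₀x.symm)
        have hqx : T q < x := hc₀x ▸ hsch.hub_lt c₀ hc₀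
        rw [max_eq_left (by omega)] at h3 ⊢
        have hQ : ∀ c, c ∈ (Finset.univ.filter fun v => T v = (x : ℕ)) ↔ T c ≠ 0 ∧ T c = x := by
          intro c
          simp only [Finset.mem_filter, Finset.mem_univ, true_and]
          omega
        -- The hub lies outside its group, so all selection sizes from `0` to the size of the group
        -- fit into `Fin n`.
        have hcard : (Finset.univ.filter fun v => T v = (x : ℕ)).card < n := by
          have := Finset.card_lt_univ_of_notMem (x := q)
            (s := Finset.univ.filter fun v => T v = (x : ℕ)) (by simp; omega)
          simpa using this
        refine Tables.step hs hsch hx0 hhub hqx h3 fun b v hbv hv => ?_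
        obtain ⟨R, hR, hR1, hR2⟩ := spec b v
        split_ifs with hvq
        · subst hvq
          have hm : ∀ Z ⊆ Finset.univ.filter fun v => T v = (x : ℕ), weightTable σ' b q +
              groupValue s T B (weightTable σ') q b (Finset.univ.filter fun v => T v = (x : ℕ)) Z ≤
              n * n := fun Z hZ => by
            have := h3.add_groupValue_le hs hsch hx0 hhub hqx hbv hZ
            rwa [Fintype.card_fin] at this
          rw [hR1 ⟨c₀, hc₀, hc₀x, rfl⟩, hR q _ (n * n) hQ (fun c hc => hhub c ((hQ c).1 hc).2) hcard
            (fun Z hZ => (Nat.le_add_left _ _).trans (hm Z hZ)) hcap, min_eq_left]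
          obtain ⟨Z, hZ, hmax⟩ := Finset.exists_mem_eq_sup
            (Finset.univ.filter fun v => T v = (x : ℕ)).powerset ⟨∅, Finset.empty_mem_powerset _⟩
            (groupValue s T B (weightTable σ') q b (Finset.univ.filter fun v => T v = (x : ℕ)))
          rw [hmax]
          exact (hm Z (Finset.mem_powerset.1 hZ)).trans (by omega)
        · rw [hR2 (fun ⟨c, _, h2, h3⟩ => hvq (h3.symm.trans (hhub c h2))), min_eq_left (h2 b v)]
      · have hW : weightTable (levelCmd.denote k cap 1 (Function.update ρ 0 x) σ') =
            weightTable σ' := by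
          funext b v
          obtain ⟨R, -, -, hR2⟩ := spec b v
          rw [hR2 (fun ⟨c, h1, h2, _⟩ => hx ⟨c, h1, h2⟩), min_eq_left (h2 b v)]
        rw [hW]
        by_cases hx0 : (x : ℕ) = 0
        · simpa [hx0] using h3
        · rw [max_eq_left (by omega)] at h3 ⊢
          exact h3.step_empty (fun v hv => hx ⟨v, by omega, hv⟩) fun _ _ _ _ => rfl
  · refine ⟨fun a ha => h2 a (by omega) (by omega), fun b v => by rw [hW2]; exact Nat.zero_le _, ?_⟩
    rw [hW2, max_eq_left (by have := r.pos; omega)]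
    exact tables_zero hT B

end RAM

/-! ### Enumerating the colours of level zero. -/

namespace RAM

open Exp Cmd SignMatrix

variable {n k cap : ℕ} {σ : Arr n} {ρ : ℕ → Fin n} {s : Fin n → Fin n → ℤ} {T : Fin n → ℕ}
  {P : Fin n → Fin n} {B : Fin n → Bool}

/-- The largest number of satisfied edges, counted twice, for the present colours. -/
def valueExp : Exp :=
  add (sum (sum (ite (and (not (rd 7 2 2)) (not (rd 7 3 3))) (satExp 2 3 (rd 9 2 2) (rd 9 3 3))
    (const 0))))
  (sum (ite (rd 7 2 2) (const 0) (ite (rd 9 2 2) (rd 11 2 2) (rd 10 2 2))))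

theorem eval_valueExp (h : Holding σ s T P B) : valueExp.eval k σ 2 ρ =
    satCount s (below T 1) B + ∑ v ∈ below T 1, weightTable σ (B v) v := by
  have hmem : ∀ v, v ∈ below T 1 ↔ T v = 0 := fun v => by simp [below]
  rw [valueExp, eval_add]
  congr 1
  · rw [eval_sum, satCount, ← Finset.sum_filter_add_sum_filter_not Finset.univ (· ∈ below T 1),
      Finset.filter_univ_mem, Finset.sum_eq_zero (s := Finset.univ.filter _), add_zero]
    · refine Finset.sum_congr rfl fun u hu => ?_
      rw [eval_sum, ← Finset.sum_filter_add_sum_filter_not Finset.univ (· ∈ below T 1),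
        Finset.filter_univ_mem, Finset.sum_eq_zero (s := Finset.univ.filter _), add_zero]
      · refine Finset.sum_congr rfl fun v hv => ?_
        rw [eval_ite, holds_and, holds_not, holds_not, holds_rd, holds_rd,
          eval_satExp h.codes (b := B u) (b' := B v), if_pos]
        · simp
        · simpa [Function.update_apply, h.level] using ⟨(hmem u).1 hu, (hmem v).1 hv⟩
        · simpa [holds_rd, Function.update_apply] using h.colour u
        · simpa [holds_rd, Function.update_apply] using h.colour v
      · intro v hv
        rw [eval_ite, if_neg]
        · rfl
        · have := mt (hmem v).2 (Finset.mem_filter.1 hv).2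
          simp [holds_and, holds_not, holds_rd, h.level, this]
    · intro u hu
      rw [eval_sum]
      refine Finset.sum_eq_zero fun v _ => ?_
      rw [eval_ite, if_neg]
      · rfl
      · have := mt (hmem u).2 (Finset.mem_filter.1 hu).2
        simp [holds_and, holds_not, holds_rd, h.level, this]
  · rw [eval_sum, ← Finset.sum_filter_add_sum_filter_not Finset.univ (· ∈ below T 1),
      Finset.filter_univ_mem, Finset.sum_eq_zero (s := Finset.univ.filter _), add_zero]
    · refine Finset.sum_congr rfl fun v hv => ?_
      rw [eval_ite, if_neg (by simp [holds_rd, h.level, (hmem v).1 hv]), eval_ite]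
      have := h.colour v
      cases hB : B v
      · rw [if_neg (by simpa [holds_rd, hB] using this)]
        simp [eval_rd, weightTable, weightArr]
      · rw [if_pos (by simpa [holds_rd, hB] using this)]
        simp [eval_rd, weightTable, weightArr]
    · intro v hv
      have := mt (hmem v).2 (Finset.mem_filter.1 hv).2
      rw [eval_ite, if_pos (by simp [holds_rd, h.level, this])]
      rfl

def bestCmd : Cmd := .asg 15 (max (rd 15 0 0) valueExp)

/-- Advances the colours of the vertices of level zero. -/
def incrementCmd : Cmd :=
  .seq (.asg 13 (const 1)) (.for_ (.seq
    (.asg 9 (ite (and (eq (var 1) (var 0)) (and (not (rd 7 1 1)) (rd 13 1 1))) (not (rd 9 1 1))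
      (rd 9 1 1)))
    (.asg 13 (and (rd 13 1 1) (or (rd 7 0 0) (not (rd 9 0 0)))))))

/-- The vertices of level zero below `m`, in decreasing order. -/
def zeroList (T : Fin n → ℕ) : ℕ → List (Fin n)
  | 0 => []
  | m + 1 => if h : ∃ h : m < n, T ⟨m, h⟩ = 0 then ⟨m, h.1⟩ :: zeroList T m else zeroList T m

theorem mem_zeroList {T : Fin n → ℕ} {m : ℕ} {v : Fin n} :
    v ∈ zeroList T m ↔ (v : ℕ) < m ∧ T v = 0 := by
  induction m with
  | zero => simp [zeroList]
  | succ m ih =>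
    rw [zeroList]
    split_ifs with h
    · obtain ⟨h1, h2⟩ := h
      rw [List.mem_cons, ih, Fin.ext_iff]
      constructor
      · rintro (h | h)
        · exact ⟨by simp only at h; omega, by rw [← h2]; congr 1; exact Fin.ext h⟩
        · exact ⟨by omega, h.2⟩
      · rintro ⟨h, h'⟩
        by_cases hv : (v : ℕ) = m
        · exact Or.inl hv
        · exact Or.inr ⟨by omega, h'⟩
    · rw [ih]
      constructor
      · rintro ⟨h1, h2⟩
        exact ⟨by omega, h2⟩
      · rintro ⟨h1, h2⟩
        refine ⟨lt_of_le_of_ne (by omega) fun hv => h ⟨hv ▸ v.isLt, ?_⟩, h2⟩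
        rw [← h2]; congr 1; exact Fin.ext hv.symm

theorem nodup_zeroList (T : Fin n → ℕ) (m : ℕ) : (zeroList T m).Nodup := by
  induction m with
  | zero => simp [zeroList]
  | succ m ih =>
    rw [zeroList]
    split_ifs with h
    · exact List.nodup_cons.2 ⟨fun h' => absurd (mem_zeroList.1 h').1 (lt_irrefl _), ih⟩
    · exact ih

theorem length_zeroList (T : Fin n → ℕ) :
    (zeroList T n).length = (Finset.univ.filter fun v => T v = 0).card := by
  rw [← List.toFinset_card_of_nodup (nodup_zeroList T n)]
  congr 1
  ext v
  simp [mem_zeroList]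

theorem incrementCmd_keeps {a : ℕ} (h : a ≠ 9) (h' : a ≠ 13) : incrementCmd.Keeps a :=
  ⟨h', h, h'⟩

/-- The carry tells whether counting is still under way: while it is set, the rest of the list is
yet to be incremented; once it is cleared, the bits are final. It survives a vertex of positive
level, or a bit that has just become zero. -/
theorem denote_incrementCmd (h : Holding σ s T P B) (hcap : cap ≠ 0) (v : Fin n) :
    incrementCmd.denote k cap 0 ρ σ 9 v v ≠ 0 ↔ increment (zeroList T n) B v = true := by
  rw [incrementCmd, denote_seq]
  set σ₁ := (asg 13 (const 1)).denote k cap 0 ρ σ with hσ₁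
  have h1 : ∀ a, a ≠ 13 → σ₁ a = σ a := fun a ha => denote_asg_ne _ _ _ _ _ ha
  have h1' : Holding σ₁ s T P B := h.congr (h1 _ (by omega)) (h1 _ (by omega)) (h1 _ (by omega))
      (h1 _ (by omega))
  have key := forDown_induction (f := fun x => denote k cap (.seq
    (.asg 9 (ite (and (eq (var 1) (var 0)) (and (not (rd 7 1 1)) (rd 13 1 1))) (not (rd 9 1 1))
      (rd 9 1 1)))
    (.asg 13 (and (rd 13 1 1) (or (rd 7 0 0) (not (rd 9 0 0)))))) 1 (Function.update ρ 0 x))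
    (fun m σ' => ∃ B' c, Holding σ' s T P B' ∧ (∀ v, σ' 13 v v ≠ 0 ↔ c = true) ∧
      (if c = true then increment (zeroList T m) B' else B') = increment (zeroList T n) B)
    ?_ n le_rfl σ₁ ?_
  · obtain ⟨B', c, h2, -, h3⟩ := key
    have : B' = increment (zeroList T n) B := by
      rw [← h3]
      split_ifs <;> rfl
    rw [← this]
    exact h2.colour v
  · rintro x σ' ⟨B', c, h2, h3, h4⟩
    rw [denote_seq]
    set e9 := ite (and (eq (var 1) (var 0)) (and (not (rd 7 1 1)) (rd 13 1 1))) (not (rd 9 1 1))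
      (rd 9 1 1) with he9
    set σ₂ := (asg 9 e9).denote k cap 1 (Function.update ρ 0 x) σ' with hσ₂
    have g2 : ∀ a, a ≠ 9 → σ₂ a = σ' a := fun a ha => denote_asg_ne _ _ _ _ _ ha
    have g3 : ∀ a, a ≠ 13 → (asg 13 (and (rd 13 1 1) (or (rd 7 0 0) (not (rd 9 0 0))))).denote k cap
      1 (Function.update ρ 0 x) σ₂ a = σ₂ a := fun a ha => denote_asg_ne _ _ _ _ _ ha
    have hflip : ∀ v, σ₂ 9 v v ≠ 0 ↔
        (if v = x ∧ T v = 0 ∧ c = true then !(B' v) else B' v) = true := by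
      intro v
      rw [hσ₂, denote_asg_ne_zero hcap, he9]
      simp only [holds_ite, holds_and, holds_eq, holds_not, holds_rd, eval_var,
        Function.update_apply, h2.level, h2.colour, h3]
      simp only [show ¬ (1 = 2) by omega, show ¬ (0 = 2) by omega, show ¬ (0 = 1) by omega,
        if_false, if_true, Nat.reduceAdd, Fin.val_inj, not_not]
      split_ifs with hc
      · have hTx : T x = 0 := hc.1 ▸ hc.2.1
        cases hB : B' v <;> simp [hc, hTx]
      · cases hB : B' v <;> simp [hc]
    set B'' : Fin n → Bool := fun v => if v = x ∧ T v = 0 ∧ c = true then !(B' v) else B' v with hB''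
    have hflip : ∀ v, σ₂ 9 v v ≠ 0 ↔ B'' v = true := hflip
    have hcarry : ∀ v, (asg 13 (and (rd 13 1 1) (or (rd 7 0 0) (not (rd 9 0 0))))).denote k cap
        1 (Function.update ρ 0 x) σ₂ 13 v v ≠ 0 ↔
        (c && (decide (T x ≠ 0) || !(B'' x))) = true := by
      intro v
      rw [denote_asg_ne_zero hcap]
      simp only [holds_or, holds_and, holds_not, holds_rd, Function.update_apply,
        show ¬ (1 = 2) by omega, show ¬ (0 = 2) by omega, show ¬ (0 = 1) by omega,
        if_false, if_true, Nat.reduceAdd, hflip, g2 13 (by omega), g2 7 (by omega), h2.level, h3]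
      simp
    refine ⟨B'', _, ⟨?_, fun v => ?_, fun v => ?_, fun v => ?_⟩, hcarry, ?_⟩
    · intro u v
      rw [g3 _ (by omega), g2 _ (by omega)]
      exact h2.codes u v
    · rw [g3 _ (by omega), g2 _ (by omega)]
      exact h2.level v
    · rw [g3 _ (by omega), g2 _ (by omega)]
      exact h2.hub v
    · rw [g3 _ (by omega)]
      exact hflip v
    · rw [← h4, zeroList]
      by_cases hx : T x = 0
      · rw [dif_pos ⟨x.isLt, hx⟩]
        have hB : c = true → B'' = Function.update B' x (!(B' x)) := by
          intro hc
          funext v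
          rw [hB'', Function.update_apply]
          by_cases hv : v = x
          · subst hv; simp [hx, hc]
          · simp [hv]
        cases c
        · simp [hB'']
        · rw [hB rfl]
          cases hb : B' x <;> simp [hx, hb, increment]
      · rw [dif_neg (by rintro ⟨_, h⟩; exact hx h)]
        have hB : B'' = B' := by
          funext v
          rw [hB'']
          by_cases hv : v = x
          · subst hv; simp [hx]
          · simp [hv]
        rw [hB]
        simp [hx]
  · refine ⟨B, true, h1', fun v => ?_, by simp⟩
    rw [hσ₁, denote_asg_ne_zero hcap]
    simp [Holds, eval_const]

/-- The second phase: the best value for the present colours, and the next colours. -/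
def sweepCmd : Cmd := .seq tablesCmd (.seq bestCmd incrementCmd)

theorem denote_sweepCmd (hs : IsSignMatrix s) {r : Fin n} (hsch : Scheme s {r} T P)
    (hT : ∀ v, T v < n) (h : Holding σ s T P B) (hcap : n * n + 1 ≤ cap) {m : ℕ}
    (hm : ∀ v, σ 15 v v = m) (hmn : m ≤ n * n) : ∃ m',
    IsGreatest {m | ∃ β, Extends T B β ∧ m = satCount s Finset.univ β} m' ∧
    Holding (sweepCmd.denote k cap 0 ρ σ) s T P (increment (zeroList T n) B) ∧
    ∀ v, sweepCmd.denote k cap 0 ρ σ 15 v v = Max.max m m' := by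
  rw [sweepCmd, denote_seq, denote_seq]
  have h1 := denote_tablesCmd (k := k) (ρ := ρ) hs hsch hT h hcap
  set σ₁ := tablesCmd.denote k cap 0 ρ σ with hσ₁
  have g1 : ∀ a, (a < 10 ∨ a = 13 ∨ a = 15) → σ₁ a = σ a := fun a ha =>
    (tablesCmd_keeps ha).denote_eq _ _ _
  have h1' : Holding σ₁ s T P B := h.congr (g1 _ (by omega)) (g1 _ (by omega)) (g1 _ (by omega))
      (g1 _ (by omega))
  set σ₂ := bestCmd.denote k cap 0 ρ σ₁ with hσ₂
  have g2 : ∀ a, a ≠ 15 → σ₂ a = σ₁ a := fun a ha => denote_asg_ne _ _ _ _ _ ha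
  have h2' : Holding σ₂ s T P B := h1'.congr (g2 _ (by omega)) (g2 _ (by omega)) (g2 _ (by omega))
      (g2 _ (by omega))
  have g3 : ∀ a, a ≠ 9 → a ≠ 13 → incrementCmd.denote k cap 0 ρ σ₂ a = σ₂ a := fun a ha ha' =>
    (incrementCmd_keeps ha ha').denote_eq _ _ _
  have hle := h1.le_sq (β := B) fun _ _ => rfl
  rw [Fintype.card_fin] at hle
  refine ⟨_, h1.isGreatest, ⟨?_, ?_, ?_, denote_incrementCmd h2' (by omega)⟩, fun v => ?_⟩
  · intro u v
    rw [g3 _ (by omega) (by omega)]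
    exact h2'.codes u v
  · intro v
    rw [g3 _ (by omega) (by omega)]
    exact h2'.level v
  · intro v
    rw [g3 _ (by omega) (by omega)]
    exact h2'.hub v
  · rw [g3 _ (by omega) (by omega), hσ₂, bestCmd, denote_asg_self, eval_max, eval_valueExp h1',
      eval_rd, Function.update_apply, if_neg (by omega), Function.update_self, g1 _ (by omega), hm,
      min_eq_left (max_le (by omega) (by omega))]

end RAM

/-! ### The best value over all sweeps, and the answer. -/

namespace RAM

open Exp Cmd SignMatrix

variable {n k cap : ℕ} {σ : Arr n} {ρ : ℕ → Fin n} {s : Fin n → Fin n → ℤ} {T : Fin n → ℕ}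
  {P : Fin n → Fin n} {B : Fin n → Bool}

/-- The recorded best value is zero or that of an actual colouring. Hence it is at most `n * n` and
survives clipping, and a large value certifies a Yes-instance. -/
theorem iterate_sweepCmd (hs : IsSignMatrix s) {r : Fin n} (hsch : Scheme s {r} T P)
    (hT : ∀ v, T v < n) (h : Holding σ s T P B) (hcap : n * n + 1 ≤ cap)
    (h0 : ∀ v, σ 15 v v = 0) (i : ℕ) : ∃ m,
    Holding ((sweepCmd.denote k cap 0 ρ)^[i] σ) s T P ((increment (zeroList T n))^[i] B) ∧
    (∀ v, (sweepCmd.denote k cap 0 ρ)^[i] σ 15 v v = m) ∧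
    (m = 0 ∨ ∃ β, m = satCount s Finset.univ β) ∧
    ∀ j < i, ∀ β, Extends T ((increment (zeroList T n))^[j] B) β →
      satCount s Finset.univ β ≤ m := by
  induction i with
  | zero => exact ⟨0, h, h0, Or.inl rfl, fun j hj => absurd hj (Nat.not_lt_zero j)⟩
  | succ i ih =>
    obtain ⟨m, h1, h2, h3, h4⟩ := ih
    have hmn : m ≤ n * n := by
      rcases h3 with rfl | ⟨β, rfl⟩
      · exact Nat.zero_le _
      · simpa using satCount_le (s := s) Finset.univ β
    obtain ⟨m', ⟨⟨β, -, hβ⟩, hub⟩, h6, h7⟩ :=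
      denote_sweepCmd (k := k) (ρ := ρ) hs hsch hT h1 hcap h2 hmn
    rw [Function.iterate_succ_apply', Function.iterate_succ_apply']
    refine ⟨_, h6, h7, ?_, fun j hj β' hβ' => ?_⟩
    · rcases le_total m m' with hle | hle
      · exact Or.inr ⟨β, by rw [max_eq_right hle, hβ]⟩
      · rwa [max_eq_left hle]
    · rcases Nat.lt_succ_iff_lt_or_eq.1 hj with hj | rfl
      · exact (h4 j hj β' hβ').trans (le_max_left _ _)
      · exact (hub ⟨β', hβ', rfl⟩).trans (le_max_right _ _)

/-- Whether there are more than `3 k` vertices of level zero, or the best value is large enough. -/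
def answerExp : Exp :=
  flag (or (sub (sum (flag (not (rd 7 0 0)))) (add par (add par par)))
    (sub (add (sup (rd 15 0 0)) (add (sup (rd 15 0 0)) (const 2)))
      (add (sum (const 1)) (add par (sum (sum (flag (rd 0 0 1))))))))

/-- Adding the number of ordered adjacent pairs to both sides turns the form into `2 * satCount`.
The strict form with `+ 2` replaces `n - 1`, which is awkward in natural numbers. -/
theorem exists_quad_iff (hs : IsSignMatrix s) : (∃ x, IsPM x ∧
      (Fintype.card (Fin n) : ℤ) - 1 + k ≤ quad s Finset.univ x) ↔
    ∃ β, n + (k + ∑ u, ∑ v, if s u v = 0 then 0 else 1) < 2 * satCount s Finset.univ β + 2 := by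
  rw [Fintype.card_fin]
  constructor
  · rintro ⟨x, hx, h⟩
    refine ⟨fun v => decide (x v = 1), ?_⟩
    have h1 := quad_eq_satCount hs Finset.univ fun v => decide (x v = 1)
    rw [quad_congr (y := x) fun v _ => ?_] at h1
    · omega
    · rcases hx v with h | h <;> simp [h]
  · rintro ⟨β, h⟩
    refine ⟨fun v => if β v then 1 else -1, fun v => ite_eq_or_eq _ _ _, ?_⟩
    have h1 := quad_eq_satCount hs Finset.univ β
    exact le_of_add_le_add_right (a := ((∑ u, ∑ v, if s u v = 0 then 0 else 1 : ℕ) : ℤ))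
      (by rw [h1]; omega)

/-- With more than `3 * k` vertices of level zero the answer is yes by `hk`, whatever the sweeps
found. Otherwise these vertices have at most `8 ^ k` colourings, and the sweeps meet all of them. -/
theorem eval_answerExp (hs : IsSignMatrix s) {r : Fin n} (hsch : Scheme s {r} T P)
    (hT : ∀ v, T v < n) (h : Holding σ s T P B) (hcap : n * n + 1 ≤ cap)
    (h0 : ∀ v, σ 15 v v = 0)
    (hk : (¬ ∃ x, IsPM x ∧ (Fintype.card (Fin n) : ℤ) - 1 + k ≤ quad s Finset.univ x) →
      (Finset.univ.filter fun v => T v = 0).card ≤ 3 * k) :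
    ((∃ x, IsPM x ∧ (Fintype.card (Fin n) : ℤ) - 1 + k ≤ quad s Finset.univ x) →
      answerExp.eval k ((sweepCmd.denote k cap 0 ρ)^[8 ^ k] σ) 0 ρ = 1) ∧
    ((¬ ∃ x, IsPM x ∧ (Fintype.card (Fin n) : ℤ) - 1 + k ≤ quad s Finset.univ x) →
      answerExp.eval k ((sweepCmd.denote k cap 0 ρ)^[8 ^ k] σ) 0 ρ = 0) := by
  obtain ⟨m, h1, h2, h3, h4⟩ := iterate_sweepCmd (k := k) (ρ := ρ) hs hsch hT h hcap h0 (8 ^ k)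
  set σ' := (sweepCmd.denote k cap 0 ρ)^[8 ^ k] σ
  rw [exists_quad_iff hs] at hk ⊢
  set M := ∑ u, ∑ v, if s u v = 0 then 0 else 1 with hM
  have hcount : (sum (flag (not (rd 7 0 0)))).eval k σ' 0 ρ =
      (Finset.univ.filter fun v => T v = 0).card := by
    rw [eval_sum, Finset.card_filter]
    refine Finset.sum_congr rfl fun v _ => ?_
    rw [eval_flag, holds_not, holds_rd, Function.update_self, h1.level, not_not]
    congr
  have hbest : (sup (rd 15 0 0)).eval k σ' 0 ρ = m := by
    rw [eval_sup]
    simp only [eval_rd, Function.update_self, h2]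
    exact Finset.sup_const ⟨r, Finset.mem_univ r⟩ m
  have hedges : (sum (sum (flag (rd 0 0 1)))).eval k σ' 0 ρ = M := by
    rw [eval_sum]
    refine Finset.sum_congr rfl fun u _ => ?_
    rw [eval_sum]
    refine Finset.sum_congr rfl fun v _ => ?_
    have := (h1.codes u v).2.2
    rw [eval_flag, holds_rd]
    simp only [Function.update_apply, zero_add, show ¬ (0 = 1) by omega, if_true, if_false, ne_eq,
      this, ite_not]
  have hnum : (sum (const 1)).eval k σ' 0 ρ = n := by
    rw [eval_sum]; simp [eval_const]
  have key : answerExp.Holds k σ' 0 ρ ↔ 3 * k < (Finset.univ.filter fun v => T v = 0).card ∨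
      n + (k + M) < 2 * m + 2 := by
    rw [answerExp, holds_flag, holds_or, holds_sub, holds_sub]
    simp only [eval_add, hcount, hbest, hedges, hnum, eval_const, eval_par]
    constructor <;> rintro (h | h) <;> first | (left; omega) | (right; omega)
  have hval : answerExp.eval k σ' 0 ρ = 0 ∨ answerExp.eval k σ' 0 ρ = 1 := by
    rw [answerExp, eval_flag]
    split_ifs <;> simp
  constructor
  · rintro ⟨β, hβ⟩
    refine hval.resolve_left fun hzero => key.not.1 (not_not.2 hzero) ?_
    by_cases hcard : 3 * k < (Finset.univ.filter fun v => T v = 0).card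
    · exact Or.inl hcard
    · refine Or.inr ?_
      obtain ⟨i, hi, hi'⟩ := exists_iterate_increment (nodup_zeroList T n) B
        (fun v => if T v = 0 then β v else B v) fun v hv => by
          rw [if_neg]
          intro h0
          exact hv (mem_zeroList.2 ⟨v.isLt, h0⟩)
      have hle := h4 i ?_ β ?_
      · omega
      · rw [length_zeroList] at hi
        refine hi.trans_le ?_
        calc 2 ^ _ ≤ 2 ^ (3 * k) := Nat.pow_le_pow_right (by omega) (by omega)
          _ = 8 ^ k := by rw [pow_mul]; rfl
      · intro v hv
        rw [hi']
        exact (if_pos hv).symm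
  · intro hno
    refine not_not.1 (key.not.2 ?_)
    rintro (hlt | hlt)
    · have := hk hno
      omega
    · rcases h3 with rfl | ⟨β, rfl⟩
      -- The value zero need not be attained, but every colouring has at least this value.
      · exact hno ⟨fun _ => true, by omega⟩
      · exact hno ⟨β, hlt⟩

end RAM

/-! ### Finding reductions by search. -/

namespace SignMatrix

variable {V : Type*} [DecidableEq V] {s : V → V → ℤ}

/-- Adds to `X` its neighbours in `Y`. -/
def grow (s : V → V → ℤ) (Y X : Finset V) : Finset V :=
  X ∪ Y.filter fun v => ∃ u ∈ X, s u v ≠ 0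

theorem Conn.grow (hs : IsSignMatrix s) {X : Finset V} (h : Conn s X) (Y : Finset V) :
    Conn s (grow s Y X) := by
  have hnb : ∀ v ∈ SignMatrix.grow s Y X, v ∉ X → ∃ u ∈ X, s u v ≠ 0 := by
    intro v hv hvX
    exact (Finset.mem_filter.1 ((Finset.mem_union.1 hv).resolve_left hvX)).2
  have hsub : X ⊆ SignMatrix.grow s Y X := Finset.subset_union_left
  intro A hA hne hAX
  by_cases h0 : (A ∩ X).Nonempty
  · by_cases h1 : A ∩ X = X
    · obtain ⟨b, hb, hbA⟩ : ∃ b ∈ SignMatrix.grow s Y X, b ∉ A := by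
        by_contra hno
        push Not at hno
        exact hAX (Finset.Subset.antisymm hA hno)
      have hXA : X ⊆ A := Finset.inter_eq_right.1 h1
      obtain ⟨u, hu, huv⟩ := hnb b hb fun h => hbA (hXA h)
      exact ⟨u, hXA hu, b, hb, hbA, huv⟩
    · obtain ⟨a, ha, b, hb, hbA, hab⟩ := h _ Finset.inter_subset_right h0 h1
      exact ⟨a, (Finset.mem_inter.1 ha).1, b, hsub hb,
        fun h' => hbA (Finset.mem_inter.2 ⟨h', hb⟩), hab⟩
  · obtain ⟨a, ha⟩ := hne
    have hdis : ∀ v ∈ A, v ∉ X := fun v hv hvX => h0 ⟨v, Finset.mem_inter.2 ⟨hv, hvX⟩⟩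
    obtain ⟨u, hu, hua⟩ := hnb a (hA ha) (hdis a ha)
    exact ⟨a, ha, u, hsub hu, fun h' => hdis u h' hu, by rwa [hs.symm]⟩

theorem conn_iterate_grow (hs : IsSignMatrix s) {X : Finset V} (h : Conn s X) (Y : Finset V)
    (i : ℕ) : Conn s ((grow s Y)^[i] X) := by
  induction i with
  | zero => exact h
  | succ i ih => rw [Function.iterate_succ_apply']; exact ih.grow hs Y

theorem iterate_grow_subset {X Y : Finset V} (h : X ⊆ Y) (i : ℕ) : (grow s Y)^[i] X ⊆ Y := by
  induction i with
  | zero => exact h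
  | succ i ih =>
    rw [Function.iterate_succ_apply']
    exact Finset.union_subset ih (Finset.filter_subset _ _)

theorem iterate_grow_empty (Y : Finset V) (i : ℕ) : (grow s Y)^[i] ∅ = ∅ := by
  induction i with
  | zero => rfl
  | succ i ih => rw [Function.iterate_succ_apply', ih]; simp [grow]

/-- Growing a vertex reaches its component. -/
theorem iterate_grow_eq {C Y : Finset V} (hC : Conn s C) (hCY : C ⊆ Y)
    (hclosed : ∀ u ∈ C, ∀ v ∈ Y, v ∉ C → s u v = 0) {e : V} (he : e ∈ C) {i : ℕ}
    (hi : C.card ≤ i) : (grow s Y)^[i] {e} = C := by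
  -- Until the component is exhausted, each step adds a vertex.
  have key : ∀ i, (grow s Y)^[i] {e} ⊆ C ∧
      ((grow s Y)^[i] {e} = C ∨ i + 1 ≤ ((grow s Y)^[i] {e}).card) := by
    intro i
    induction i with
    | zero => exact ⟨Finset.singleton_subset_iff.2 he, Or.inr (by simp)⟩
    | succ i ih =>
      obtain ⟨h1, h2⟩ := ih
      rw [Function.iterate_succ_apply']
      set X := (grow s Y)^[i] {e} with hX
      have hsub : X ⊆ grow s Y X := Finset.subset_union_left
      have hsubC : grow s Y X ⊆ C := by
        refine Finset.union_subset h1 fun v hv => ?_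
        obtain ⟨hvY, u, hu, huv⟩ := Finset.mem_filter.1 hv
        by_contra hvC
        exact huv (hclosed u (h1 hu) v hvY hvC)
      refine ⟨hsubC, ?_⟩
      by_cases hXC : X = C
      · exact Or.inl (Finset.Subset.antisymm hsubC (hXC ▸ hsub))
      · have hne : X.Nonempty := Finset.card_pos.1 (by have := h2.resolve_left hXC; omega)
        obtain ⟨a, ha, b, hb, hbX, hab⟩ := hC X h1 hne hXC
        refine Or.inr ?_
        have hlt : X.card < (grow s Y X).card := Finset.card_lt_card
          ((Finset.ssubset_iff_of_subset hsub).2 ⟨b, Finset.mem_union_right _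
            (Finset.mem_filter.2 ⟨hCY hb, a, ha, hab⟩), hbX⟩)
        have := h2.resolve_left hXC
        omega
  obtain ⟨h1, h2⟩ := key i
  rcases h2 with h2 | h2
  · exact h2
  · have := Finset.card_le_card h1
    omega

/-- The four kinds of reductions. -/
inductive Kind
  | none
  | triple
  | odd
  | twins

/-- The vertices that a kind of reduction marks. -/
def Kind.mark (a b c : V) : Kind → Finset V
  | none => ∅
  | triple => {a, b, c}
  | odd => {a}
  | twins => {a, b}

/-- The condition of a kind of reduction. -/
def Kind.Cond (s : V → V → ℤ) (R Q : Finset V) (a b c : V) : Kind → Prop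
  | none => True
  | triple => s a c ≠ 0 ∧ s b c ≠ 0 ∧ a ≠ b ∧ s a c * s a b * s b c ≠ -1
  | odd => Q = ∅ ∧ Odd (R.filter fun v => s a v ≠ 0).card
  | twins => Q = ∅ ∧ s a c * s a b * s b c = 1 ∧ ∀ w ∈ R, w ≠ a → w ≠ b → w ≠ c →
      (s a w = 0 ∧ s b w = 0) ∨ s a w * s a b * s b w = -1

theorem Kind.Cond.markRule {R Q : Finset V} {a b c : V} {κ : Kind} (h : κ.Cond s R Q a b c) :
    MarkRule s R (κ.mark a b c) Q a b c := by
  cases κ with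
  | none => exact .none rfl
  | triple => exact .triple rfl h.1 h.2.1 h.2.2.1 h.2.2.2
  | odd => exact .odd rfl h.1 h.2
  | twins => exact .twins rfl h.1 h.2.1 h.2.2

theorem MarkRule.exists_kind {R M Q : Finset V} {a b c : V} (h : MarkRule s R M Q a b c) :
    ∃ κ : Kind, M = κ.mark a b c ∧ κ.Cond s R Q a b c := by
  cases h with
  | none h => exact ⟨.none, h, trivial⟩
  | triple h h1 h2 h3 h4 => exact ⟨.triple, h, h1, h2, h3, h4⟩
  | odd h h1 h2 => exact ⟨.odd, h, h1, h2⟩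
  | twins h h1 h2 h3 => exact ⟨.twins, h, h1, h2, h3⟩

/-- The reduction that the program tries for a kind and five vertices. -/
structure Attempt (s : V → V → ℤ) (R M Q X : Finset V) (κ : Kind) (a b c e : V) : Prop where
  mark_sub : M ⊆ R
  hub_mem : c ∈ R
  fan : Fan s c Q
  even : Even Q.card
  closed : ∀ u ∈ Q, ∀ v ∈ (R \ M) \ Q, s u v ≠ 0 → v = c
  mem : e ∈ (R \ M) \ Q
  cover : ∀ v ∈ (R \ M) \ Q, v ∈ X
  cond : κ.Cond s R Q a b c

/-- The group that the program tries. -/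
def tryGroup (s : V → V → ℤ) (R M : Finset V) (c d : V) (i : ℕ) : Finset V :=
  (grow s ((R \ M).erase c))^[i] (if d ∈ (R \ M).erase c then {d} else ∅)

theorem tryGroup_subset (R M : Finset V) (c d : V) (i : ℕ) :
    tryGroup s R M c d i ⊆ (R \ M).erase c := by
  refine iterate_grow_subset ?_ i
  split_ifs with h
  · exact Finset.singleton_subset_iff.2 h
  · exact Finset.empty_subset _

/-- The vertices that the program reaches from `e`. -/
def tryReach (s : V → V → ℤ) (R' : Finset V) (e : V) (i : ℕ) : Finset V :=
  (grow s R')^[i] (if e ∈ R' then {e} else ∅)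

/-- Grown sets are connected, so reaching every remaining vertex proves connectivity. Soundness does
not depend on how long the search ran. -/
theorem Attempt.reduction (hs : IsSignMatrix s) {R M Q : Finset V} {κ : Kind} {a b c d e : V}
    {i j : ℕ} (hM : M = κ.mark a b c) (hQ : Q = tryGroup s R M c d i)
    (h : Attempt s R M Q (tryReach s ((R \ M) \ Q) e j) κ a b c e) : Reduction s R M Q a b c := by
  have hsub : Q ⊆ (R \ M).erase c := hQ ▸ tryGroup_subset R M c d i
  have hR' : tryReach s ((R \ M) \ Q) e j = (R \ M) \ Q := by
    refine Finset.Subset.antisymm ?_ h.cover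
    rw [tryReach, if_pos h.mem]
    exact iterate_grow_subset (Finset.singleton_subset_iff.2 h.mem) j
  refine ⟨h.mark_sub, fun v hv => ?_, ?_, h.hub_mem, fun hc => ?_, h.fan, h.even, ?_, ⟨e, h.mem⟩,
    ?_, hM ▸ h.cond.markRule⟩
  · exact (Finset.mem_sdiff.1 (Finset.mem_of_mem_erase (hsub hv))).1
  · rw [Finset.disjoint_right]
    exact fun v hv => (Finset.mem_sdiff.1 (Finset.mem_of_mem_erase (hsub hv))).2
  · exact absurd rfl (Finset.ne_of_mem_erase (hsub hc))
  · intro u hu v hv hvM hvQ huv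
    exact h.closed u hu v (Finset.mem_sdiff.2 ⟨Finset.mem_sdiff.2 ⟨hv, hvM⟩, hvQ⟩) huv
  · rw [← hR', tryReach, if_pos h.mem]
    exact conn_iterate_grow hs (conn_singleton e) _ _

/-- The group of a reduction is a clique without neighbours in `R \ M` other than the hub. It is
therefore a component of `(R \ M).erase c` and is found from any of its vertices; starting at `c`
itself yields the empty group. -/
theorem Reduction.exists_attempt {R M Q : Finset V} {a b c : V}
    (h : Reduction s R M Q a b c) {i : ℕ} (hi : R.card ≤ i) : ∃ (κ : Kind) (d e : V),
    M = κ.mark a b c ∧ Q = tryGroup s R M c d i ∧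
    Attempt s R M Q (tryReach s ((R \ M) \ Q) e i) κ a b c e := by
  obtain ⟨κ, hκ, hcond⟩ := h.rule.exists_kind
  obtain ⟨e, he⟩ := h.nonempty
  have hQ : ∃ d, Q = tryGroup s R M c d i := by
    rcases Q.eq_empty_or_nonempty with hQ | ⟨d, hd⟩
    · refine ⟨c, ?_⟩
      rw [tryGroup, if_neg (Finset.notMem_erase c _), iterate_grow_empty, hQ]
    · refine ⟨d, ?_⟩
      have hsub : Q ⊆ (R \ M).erase c := fun v hv => Finset.mem_erase.2
        ⟨fun hvc => h.hub_not_mem (hvc ▸ hv), Finset.mem_sdiff.2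
          ⟨h.sub hv, Finset.disjoint_right.1 h.disj hv⟩⟩
      rw [tryGroup, if_pos (hsub hd)]
      refine (iterate_grow_eq (conn_of_clique fun u hu v hv huv => ?_) hsub
        (fun u hu v hv hvQ => ?_) hd ((Finset.card_le_card h.sub).trans hi)).symm
      · intro h0
        have := h.fan.2 u hu v hv huv
        rw [h0] at this
        simp at this
      · by_contra huv
        obtain ⟨hvc, hv⟩ := Finset.mem_erase.1 hv
        obtain ⟨hvR, hvM⟩ := Finset.mem_sdiff.1 hv
        exact hvc (h.closed u hu v hvR hvM hvQ huv)
  obtain ⟨d, hd⟩ := hQ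
  refine ⟨κ, d, e, hκ, hd, h.mark_sub, h.hub_mem, h.fan, h.even, fun u hu v hv huv => ?_, he,
    fun v hv => ?_, hcond⟩
  · obtain ⟨hv, hvQ⟩ := Finset.mem_sdiff.1 hv
    obtain ⟨hvR, hvM⟩ := Finset.mem_sdiff.1 hv
    exact h.closed u hu v hvR hvM hvQ huv
  · rw [tryReach, if_pos he, iterate_grow_eq h.conn (Finset.Subset.refl _)
      (fun u _ v hv hv' => absurd hv hv') he ((Finset.card_le_card
        (Finset.sdiff_subset.trans Finset.sdiff_subset)).trans hi)]
    exact hv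

end SignMatrix

/-! ### The tests of the first phase. -/

namespace RAM

open Exp Cmd SignMatrix

/-! In the first phase, array `1` holds the vertices that are left, array `2` the vertices to be
marked, array `3` the group, array `6` the test; arrays `4` and `5` are for searching. Variable `0`
counts the rounds, and the variables `1` to `5` are the vertices of the attempt. -/

/-- The product of three signs, with the codes given, is negative. -/
def negExp (p q r : Exp) : Exp :=
  and p (and q (and r (or (eq (add p (add q r)) (const 4)) (eq (add p (add q r)) (const 6)))))

/-- The product of three signs, with the codes given, is positive. -/
def posExp (p q r : Exp) : Exp :=
  and p (and q (and r (or (eq (add p (add q r)) (const 3)) (eq (add p (add q r)) (const 5)))))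

def evenExp (d : ℕ) (e : Exp) : Exp := sup (eq (add (var d) (var d)) e)

def oddExp (d : ℕ) (e : Exp) : Exp := sup (eq (add (var d) (add (var d) (const 1))) e)

def markExp : Kind → Exp
  | .none => const 0
  | .triple => or (eq (var 6) (var 1)) (or (eq (var 6) (var 2)) (eq (var 6) (var 3)))
  | .odd => eq (var 6) (var 1)
  | .twins => or (eq (var 6) (var 1)) (eq (var 6) (var 2))

def condExp : Kind → Exp
  | .none => const 1
  | .triple => and (rd 0 1 3) (and (rd 0 2 3) (and (not (eq (var 1) (var 2)))
      (not (negExp (rd 0 1 3) (rd 0 1 2) (rd 0 2 3)))))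
  | .odd => and (all (not (rd 3 8 8))) (oddExp 8 (sum (flag (and (rd 1 9 9) (rd 0 1 9)))))
  | .twins => and (all (not (rd 3 8 8))) (and (posExp (rd 0 1 3) (rd 0 1 2) (rd 0 2 3))
      (all (or (not (rd 1 8 8)) (or (eq (var 8) (var 1)) (or (eq (var 8) (var 2))
        (or (eq (var 8) (var 3)) (or (and (not (rd 0 1 8)) (not (rd 0 2 8)))
          (negExp (rd 0 1 8) (rd 0 1 2) (rd 0 2 8)))))))))

def attemptExp (κ : Kind) : Exp :=
  and (all (or (not (rd 2 8 8)) (rd 1 8 8)))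
  (and (rd 1 3 3)
  (and (all (or (not (rd 3 8 8)) (and (rd 0 3 8) (all (or (not (rd 3 9 9)) (or (eq (var 8) (var 9))
    (negExp (rd 0 3 8) (rd 0 8 9) (rd 0 3 9))))))))
  (and (evenExp 8 (sum (flag (rd 3 9 9))))
  (and (all (or (not (rd 3 8 8)) (all (or (not (rd 5 9 9)) (or (not (rd 0 8 9))
    (eq (var 9) (var 3)))))))
  (and (rd 5 5 5)
  (and (all (or (not (rd 5 8 8)) (rd 4 8 8)))
    (condExp κ)))))))

variable {n k cap : ℕ} {σ : Arr n} {ρ : ℕ → Fin n} {s : Fin n → Fin n → ℤ} {d : ℕ}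

/-- The diagonal of an array is nonzero exactly on a set. -/
def IsSet (σ : Arr n) (a : ℕ) (X : Finset (Fin n)) : Prop := ∀ v, σ a v v ≠ 0 ↔ v ∈ X

theorem holds_const {c : ℕ} : (const c).Holds k σ d ρ ↔ c ≠ 0 := Iff.rfl

theorem Codes.cases (hs : IsSignMatrix s) (h : Codes σ s) (u v : Fin n) :
    (s u v = 0 ∧ σ 0 u v = 0) ∨ (s u v = 1 ∧ σ 0 u v = 1) ∨ (s u v = -1 ∧ σ 0 u v = 2) := by
  obtain ⟨h1, h2, h3⟩ := h u v
  rcases hs.vals u v with h' | h' | h'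
  · exact Or.inl ⟨h', h3.2 h'⟩
  · exact Or.inr (Or.inl ⟨h', h1.2 h'⟩)
  · exact Or.inr (Or.inr ⟨h', h2.2 h'⟩)

theorem Codes.ne_zero (h : Codes σ s) (u v : Fin n) : σ 0 u v ≠ 0 ↔ s u v ≠ 0 :=
  (h u v).2.2.not

/-- The sum of three nonzero codes is `3` plus the number of negative signs; this number is odd for
the sums `4` and `6`. -/
theorem holds_negExp (hs : IsSignMatrix s) (h : Codes σ s) {i j i' j' i'' j'' : ℕ} :
    (negExp (rd 0 i j) (rd 0 i' j') (rd 0 i'' j'')).Holds k σ d ρ ↔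
      s (ρ i) (ρ j) * s (ρ i') (ρ j') * s (ρ i'') (ρ j'') = -1 := by
  simp only [negExp, holds_and, holds_or, holds_eq, holds_rd, eval_add, eval_rd, eval_const]
  rcases h.cases hs (ρ i) (ρ j) with ⟨h1, h2⟩ | ⟨h1, h2⟩ | ⟨h1, h2⟩ <;>
    rcases h.cases hs (ρ i') (ρ j') with ⟨h3, h4⟩ | ⟨h3, h4⟩ | ⟨h3, h4⟩ <;>
    rcases h.cases hs (ρ i'') (ρ j'') with ⟨h5, h6⟩ | ⟨h5, h6⟩ | ⟨h5, h6⟩ <;>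
    rw [h1, h2, h3, h4, h5, h6] <;> norm_num

theorem holds_posExp (hs : IsSignMatrix s) (h : Codes σ s) {i j i' j' i'' j'' : ℕ} :
    (posExp (rd 0 i j) (rd 0 i' j') (rd 0 i'' j'')).Holds k σ d ρ ↔
      s (ρ i) (ρ j) * s (ρ i') (ρ j') * s (ρ i'') (ρ j'') = 1 := by
  simp only [posExp, holds_and, holds_or, holds_eq, holds_rd, eval_add, eval_rd, eval_const]
  rcases h.cases hs (ρ i) (ρ j) with ⟨h1, h2⟩ | ⟨h1, h2⟩ | ⟨h1, h2⟩ <;>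
    rcases h.cases hs (ρ i') (ρ j') with ⟨h3, h4⟩ | ⟨h3, h4⟩ | ⟨h3, h4⟩ <;>
    rcases h.cases hs (ρ i'') (ρ j'') with ⟨h5, h6⟩ | ⟨h5, h6⟩ | ⟨h5, h6⟩ <;>
    rw [h1, h2, h3, h4, h5, h6] <;> norm_num

/-- The bounds ensure that half of `m` lies in the range of the bound variable. -/
theorem holds_evenExp {e : Exp} {m : ℕ} (hm : m ≤ n) (hn : 0 < n)
    (he : ∀ x, e.eval k σ (d + 1) (Function.update ρ d x) = m) :
    (evenExp d e).Holds k σ d ρ ↔ Even m := by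
  simp only [evenExp, holds_sup, holds_eq, eval_add, eval_var, he, Function.update_self]
  constructor
  · rintro ⟨x, hx⟩
    exact ⟨x, hx.symm⟩
  · rintro ⟨x, hx⟩
    exact ⟨⟨x, by omega⟩, hx.symm⟩

theorem holds_oddExp {e : Exp} {m : ℕ} (hm : m ≤ n)
    (he : ∀ x, e.eval k σ (d + 1) (Function.update ρ d x) = m) :
    (oddExp d e).Holds k σ d ρ ↔ Odd m := by
  simp only [oddExp, holds_sup, holds_eq, eval_add, eval_var, eval_const, he, Function.update_self]
  constructor
  · rintro ⟨x, hx⟩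
    exact ⟨x, by omega⟩
  · rintro ⟨x, hx⟩
    refine ⟨⟨x, by omega⟩, ?_⟩
    simp only
    omega

theorem eval_sum_flag {e : Exp} {X : Finset (Fin n)}
    (he : ∀ x, e.Holds k σ (d + 1) (Function.update ρ d x) ↔ x ∈ X) :
    (sum (flag e)).eval k σ d ρ = X.card := by
  classical
  rw [eval_sum, ← Finset.filter_univ_mem X, Finset.card_filter]
  refine Finset.sum_congr rfl fun x _ => ?_
  rw [eval_flag]
  simp only [he]

theorem holds_markExp {κ : Kind} :
    (markExp κ).Holds k σ d ρ ↔ ρ 6 ∈ κ.mark (ρ 1) (ρ 2) (ρ 3) := by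
  cases κ <;> simp [markExp, Kind.mark, holds_or, holds_eq, eval_var, Fin.val_inj, holds_const]

theorem holds_condExp (hs : IsSignMatrix s) (h : Codes σ s) {R Q : Finset (Fin n)}
    (hR : IsSet σ 1 R) (hQ : IsSet σ 3 Q) {κ : Kind} :
    (condExp κ).Holds k σ 8 ρ ↔ κ.Cond s R Q (ρ 1) (ρ 2) (ρ 3) := by
  have hempty : (∀ x, x ∉ Q) ↔ Q = ∅ := Finset.eq_empty_iff_forall_notMem.symm
  cases κ with
  | none => simp [condExp, Kind.Cond, holds_const]
  | triple =>
    simp only [condExp, Kind.Cond, holds_and, holds_not, holds_eq, holds_rd, holds_negExp hs h,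
      eval_var, h.ne_zero, Fin.val_inj, ne_eq]
  | odd =>
    have hcount : ∀ x, (sum (flag (and (rd 1 9 9) (rd 0 1 9)))).eval k σ (8 + 1)
        (Function.update ρ 8 x) = (R.filter fun v => s (ρ 1) v ≠ 0).card := by
      intro x
      refine eval_sum_flag fun v => ?_
      simp [holds_and, holds_rd, (hR v).symm, (h.ne_zero _ _).symm]
    have hodd := holds_oddExp (k := k) (σ := σ) (d := 8) (ρ := ρ)
      ((Finset.card_le_univ _).trans (Fintype.card_fin n).le) hcount
    simp only [condExp, Kind.Cond, holds_and, hodd, holds_all, holds_not, holds_rd,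
      Function.update_self, hQ _, hempty]
  | twins =>
    simp only [condExp, Kind.Cond, holds_and, holds_all, holds_or, holds_not, holds_rd, holds_eq,
      holds_posExp hs h, holds_negExp hs h, eval_var, Function.update_apply, hQ _, hR _, hempty,
      Fin.val_inj, h.ne_zero, not_not, if_true]
    simp only [show ¬ (1 = 8) by omega, show ¬ (2 = 8) by omega, show ¬ (3 = 8) by omega, if_false]
    refine and_congr_right fun _ => and_congr_right fun _ => forall_congr' fun w => ?_
    tauto

theorem holds_attemptExp (hs : IsSignMatrix s) (h : Codes σ s) {R M Q X : Finset (Fin n)}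
    (hR : IsSet σ 1 R) (hM : IsSet σ 2 M) (hQ : IsSet σ 3 Q) (hX : IsSet σ 4 X)
    (hY : IsSet σ 5 ((R \ M) \ Q)) {κ : Kind} :
    (attemptExp κ).Holds k σ 8 ρ ↔ Attempt s R M Q X κ (ρ 1) (ρ 2) (ρ 3) (ρ 5) := by
  have heven := holds_evenExp (k := k) (σ := σ) (d := 8) (ρ := ρ) (e := sum (flag (rd 3 9 9)))
    (m := Q.card) ((Finset.card_le_univ _).trans (Fintype.card_fin n).le) (ρ 0).pos (fun x =>
      eval_sum_flag fun v => by simp [holds_rd, (hQ v).symm])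
  simp only [attemptExp, holds_and, heven, holds_condExp hs h hR hQ, holds_all, holds_or, holds_not,
    holds_rd, holds_eq, holds_negExp hs h, eval_var, Function.update_apply, hQ _, hR _, hM _, hX _,
    hY _, Fin.val_inj, h.ne_zero, if_true]
  simp only [show ¬ (3 = 9) by omega, show ¬ (3 = 8) by omega, show ¬ (8 = 9) by omega, if_false,
    Nat.reduceAdd, ← imp_iff_not_or]
  constructor
  · rintro ⟨h1, h2, h3, h4, h5, h6, h7, h8⟩
    refine ⟨h1, h2, ⟨fun u hu => (h3 u hu).1, fun u hu v hv huv => ?_⟩, h4, fun u hu v hv huv => ?_,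
      h6, h7, h8⟩
    · exact ((h3 u hu).2 v hv).resolve_left huv
    · exact h5 u hu v hv huv
  · rintro ⟨h1, h2, h3, h4, h5, h6, h7, h8⟩
    refine ⟨h1, h2, fun u hu => ⟨h3.1 u hu, fun v hv => ?_⟩, h4, fun u hu v hv huv => ?_,
      h6, h7, h8⟩
    · exact or_iff_not_imp_left.2 (h3.2 u hu v hv)
    · exact h5 u hu v hv huv

end RAM

/-! ### The command for a single attempted reduction. -/

namespace RAM

open Exp Cmd SignMatrix

/-- Grows array `4` within array `5`. -/
def growCmd : Cmd :=
  .for_ (.asg 4 (or (rd 4 7 7) (and (rd 5 7 7) (sup (and (rd 4 9 9) (rd 0 9 7))))))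

/-- Searches in array `5` from the vertex in variable `i`. -/
def searchCmd (i : ℕ) : Cmd :=
  .seq (.asg 4 (and (rd 5 6 6) (eq (var 6) (var i)))) growCmd

/-- Only the last three assignments touch the record of the reductions, and they are guarded by the
test in array `6`, so a failed attempt does no harm. The new level is the size of the set in array
`5`, the vertices that remain. -/
def attemptCmd (κ : Kind) : Cmd :=
  .seq (.asg 2 (markExp κ))
  (.seq (.asg 5 (and (rd 1 6 6) (and (not (rd 2 6 6)) (not (eq (var 6) (var 3))))))
  (.seq (searchCmd 4)
  (.seq (.asg 3 (rd 4 6 6))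
  (.seq (.asg 5 (and (rd 1 6 6) (and (not (rd 2 6 6)) (not (rd 3 6 6)))))
  (.seq (searchCmd 5)
  (.seq (.asg 6 (attemptExp κ))
  (.seq (.asg 7 (ite (and (rd 6 6 6) (rd 3 6 6)) (sum (flag (rd 5 8 8))) (rd 7 6 6)))
  (.seq (.asg 8 (ite (and (rd 6 6 6) (rd 3 6 6)) (var 3) (rd 8 6 6)))
    (.asg 1 (ite (rd 6 6 6) (rd 5 6 6) (rd 1 6 6)))))))))))

variable {n k cap : ℕ} {σ : Arr n} {ρ : ℕ → Fin n} {s : Fin n → Fin n → ℤ}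

theorem isSet_asg (hcap : cap ≠ 0) {a : ℕ} {e : Exp} {d : ℕ} {X : Finset (Fin n)}
    (h : ∀ v, e.Holds k σ (d + 2) (Function.update (Function.update ρ d v) (d + 1) v) ↔ v ∈ X) :
    IsSet ((asg a e).denote k cap d ρ σ) a X := fun v =>
  (denote_asg_ne_zero hcap _ _ _ _ _ _ _).trans (h v)

theorem IsSet.congr {σ' : Arr n} {a : ℕ} {X : Finset (Fin n)} (h : IsSet σ a X)
    (h' : σ' a = σ a) : IsSet σ' a X := fun v => by rw [h']; exact h v

theorem Codes.congr {σ' : Arr n} (h : Codes σ s) (h' : σ' 0 = σ 0) : Codes σ' s :=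
  fun u v => by rw [h']; exact h u v

theorem searchCmd_keeps {a i : ℕ} (h : a ≠ 4) : (searchCmd i).Keeps a := ⟨h, h⟩

theorem isSet_searchCmd (hcap : cap ≠ 0) (h : Codes σ s) {Y : Finset (Fin n)} (hY : IsSet σ 5 Y)
    {i : ℕ} (hi : i < 6) : IsSet ((searchCmd i).denote k cap 6 ρ σ) 4
      ((grow s Y)^[n] (if ρ i ∈ Y then {ρ i} else ∅)) := by
  rw [searchCmd, denote_seq]
  set X : Finset (Fin n) := if ρ i ∈ Y then {ρ i} else ∅ with hX
  set σ₁ := (asg 4 (and (rd 5 6 6) (eq (var 6) (var i)))).denote k cap 6 ρ σ with hσ₁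
  have h1 : ∀ a, a ≠ 4 → σ₁ a = σ a := fun a ha => denote_asg_ne _ _ _ _ _ ha
  have hX1 : IsSet σ₁ 4 X := by
    refine isSet_asg hcap fun v => ?_
    simp only [holds_and, holds_rd, holds_eq, eval_var, Function.update_apply, Nat.reduceAdd,
      show ¬ (6 = 7) by omega, show ¬ (i = 7) by omega, show ¬ (i = 6) by omega, if_false, if_true,
      hY _, Fin.val_inj, hX]
    split_ifs with hm
    · rw [Finset.mem_singleton]
      exact ⟨fun h => h.2, fun h => ⟨h ▸ hm, h⟩⟩
    · simp only [Finset.notMem_empty, iff_false, not_and]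
      exact fun hv hvi => hm (hvi ▸ hv)
  have key := forDown_induction
    (f := fun x => (asg 4 (or (rd 4 7 7) (and (rd 5 7 7) (sup (and (rd 4 9 9) (rd 0 9 7)))))).denote
      k cap 7 (Function.update ρ 6 x))
    (fun m σ' => (∀ a, a ≠ 4 → σ' a = σ a) ∧ ∃ j, j + m = n ∧ IsSet σ' 4 ((grow s Y)^[j] X))
    ?_ n le_rfl σ₁ ⟨h1, 0, by omega, hX1⟩
  · obtain ⟨-, j, hj, h2⟩ := key
    rw [show j = n by omega] at h2
    exact h2
  · rintro x σ' ⟨h2, j, hj, h3⟩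
    refine ⟨fun a ha => (denote_asg_ne _ _ _ _ _ ha).trans (h2 a ha), j + 1, by omega, ?_⟩
    rw [Function.iterate_succ_apply', grow]
    refine isSet_asg hcap fun v => ?_
    simp only [holds_or, holds_and, holds_sup, holds_rd, Function.update_apply, Nat.reduceAdd,
      if_true, show ¬ (7 = 8) by omega, show ¬ (7 = 9) by omega, if_false, h3 _,
      (h.congr (h2 0 (by omega))).ne_zero, (hY.congr (h2 5 (by omega))) _, Finset.mem_union,
      Finset.mem_filter]

/-- The arrays hold a state of the reduction. -/
structure Alive (σ : Arr n) (s : Fin n → Fin n → ℤ) (R : Finset (Fin n)) (T : Fin n → ℕ)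
    (P : Fin n → Fin n) : Prop where
  reduced : Reduced s R T P
  codes : Codes σ s
  set : IsSet σ 1 R
  level : ∀ v, σ 7 v v = T v
  hub : ∀ v, σ 8 v v = P v

theorem attemptCmd_keeps {a : ℕ} {κ : Kind} (h : a = 0 ∨ 8 < a) : (attemptCmd κ).Keeps a := by
  have : a ≠ 1 ∧ a ≠ 2 ∧ a ≠ 3 ∧ a ≠ 4 ∧ a ≠ 5 ∧ a ≠ 6 ∧ a ≠ 7 ∧ a ≠ 8 := by omega
  simp [attemptCmd, searchCmd, growCmd, Cmd.Keeps, this]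

-- Whatever five vertices are tried, the arrays again hold a valid state: a passed test yields a
-- genuine reduction, to which `Reduced.step` applies, and a failed one preserves the old state.
open Classical in
theorem Alive.attempt (hs : IsSignMatrix s) (hcap : n + 1 ≤ cap) {R : Finset (Fin n)}
    {T : Fin n → ℕ} {P : Fin n → Fin n} (h : Alive σ s R T P) {κ : Kind} {M Q R' : Finset (Fin n)}
    (hM : M = κ.mark (ρ 1) (ρ 2) (ρ 3)) (hQ : Q = tryGroup s R M (ρ 3) (ρ 4) n)
    (hR' : R' = (R \ M) \ Q) : ∃ T' P',
      Alive ((attemptCmd κ).denote k cap 6 ρ σ) s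
        (if Attempt s R M Q (tryReach s R' (ρ 5) n) κ (ρ 1) (ρ 2) (ρ 3) (ρ 5) then R' else R)
        T' P' := by
  have hcap0 : cap ≠ 0 := by omega
  simp only [attemptCmd, denote_seq]
  set σ₁ := (asg 2 (markExp κ)).denote k cap 6 ρ σ with hσ₁
  have f1 : ∀ a, a ≠ 2 → σ₁ a = σ a := fun a ha => denote_asg_ne _ _ _ _ _ ha
  have g1 : IsSet σ₁ 2 M := by
    refine isSet_asg hcap0 fun v => ?_
    rw [holds_markExp, hM]
    simp
  set σ₂ := (asg 5 (and (rd 1 6 6) (and (not (rd 2 6 6)) (not (eq (var 6) (var 3)))))).denote k cap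
    6 ρ σ₁ with hσ₂
  have f2 : ∀ a, a ≠ 5 → σ₂ a = σ₁ a := fun a ha => denote_asg_ne _ _ _ _ _ ha
  have g2 : IsSet σ₂ 5 ((R \ M).erase (ρ 3)) := by
    refine isSet_asg hcap0 fun v => ?_
    simp only [holds_and, holds_not, holds_rd, holds_eq, eval_var, Function.update_apply,
      Nat.reduceAdd, show ¬ (6 = 7) by omega, show ¬ (3 = 7) by omega, show ¬ (3 = 6) by omega,
      if_false, if_true, (h.set.congr (f1 1 (by omega))) _, g1 _, Fin.val_inj, Finset.mem_erase,
      Finset.mem_sdiff]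
    tauto
  have c2 : Codes σ₂ s := (h.codes.congr (f1 0 (by omega))).congr (f2 0 (by omega))
  set σ₃ := (searchCmd 4).denote k cap 6 ρ σ₂ with hσ₃
  have f3 : ∀ a, a ≠ 4 → σ₃ a = σ₂ a := fun a ha => (searchCmd_keeps ha).denote_eq _ _ _
  have g3 : IsSet σ₃ 4 Q := by
    rw [hQ]
    exact isSet_searchCmd hcap0 c2 g2 (by omega)
  set σ₄ := (asg 3 (rd 4 6 6)).denote k cap 6 ρ σ₃ with hσ₄
  have f4 : ∀ a, a ≠ 3 → σ₄ a = σ₃ a := fun a ha => denote_asg_ne _ _ _ _ _ ha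
  have g4 : IsSet σ₄ 3 Q := by
    refine isSet_asg hcap0 fun v => ?_
    simp only [holds_rd, Function.update_apply, Nat.reduceAdd, show ¬ (6 = 7) by omega, if_false,
      if_true, g3 _]
  have f14 : ∀ a, a ≠ 2 → a ≠ 3 → a ≠ 4 → a ≠ 5 → σ₄ a = σ a := fun a h2 h3 h4 h5 =>
    (f4 a h3).trans ((f3 a h4).trans ((f2 a h5).trans (f1 a h2)))
  have m4 : IsSet σ₄ 2 M := g1.congr
    ((f4 2 (by omega)).trans ((f3 2 (by omega)).trans (f2 2 (by omega))))
  have r4 : IsSet σ₄ 1 R := h.set.congr (f14 1 (by omega) (by omega) (by omega) (by omega))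
  set σ₅ := (asg 5 (and (rd 1 6 6) (and (not (rd 2 6 6)) (not (rd 3 6 6))))).denote k cap 6 ρ σ₄
    with hσ₅
  have f5 : ∀ a, a ≠ 5 → σ₅ a = σ₄ a := fun a ha => denote_asg_ne _ _ _ _ _ ha
  have g5 : IsSet σ₅ 5 R' := by
    refine isSet_asg hcap0 fun v => ?_
    simp only [holds_and, holds_not, holds_rd, Function.update_apply, Nat.reduceAdd,
      show ¬ (6 = 7) by omega, if_false, if_true, r4 _, m4 _, g4 _, hR', Finset.mem_sdiff]
    tauto
  have c5 : Codes σ₅ s := h.codes.congr ((f5 0 (by omega)).trans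
    (f14 0 (by omega) (by omega) (by omega) (by omega)))
  set σ₆ := (searchCmd 5).denote k cap 6 ρ σ₅ with hσ₆
  have f6 : ∀ a, a ≠ 4 → σ₆ a = σ₅ a := fun a ha => (searchCmd_keeps ha).denote_eq _ _ _
  have g6 : IsSet σ₆ 4 (tryReach s R' (ρ 5) n) := isSet_searchCmd hcap0 c5 g5 (by omega)
  have y6 : IsSet σ₆ 5 R' := g5.congr (f6 5 (by omega))
  have q6 : IsSet σ₆ 3 Q := g4.congr ((f6 3 (by omega)).trans (f5 3 (by omega)))
  have f16 : ∀ a, a ≠ 2 → a ≠ 3 → a ≠ 4 → a ≠ 5 → σ₆ a = σ a := fun a h2 h3 h4 h5 =>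
    (f6 a h4).trans ((f5 a h5).trans (f14 a h2 h3 h4 h5))
  have r6 : IsSet σ₆ 1 R := h.set.congr (f16 1 (by omega) (by omega) (by omega) (by omega))
  have m6 : IsSet σ₆ 2 M := m4.congr ((f6 2 (by omega)).trans (f5 2 (by omega)))
  set A := Attempt s R M Q (tryReach s R' (ρ 5) n) κ (ρ 1) (ρ 2) (ρ 3) (ρ 5) with hA
  set σ₇ := (asg 6 (attemptExp κ)).denote k cap 6 ρ σ₆ with hσ₇
  have f7 : ∀ a, a ≠ 6 → σ₇ a = σ₆ a := fun a ha => denote_asg_ne _ _ _ _ _ ha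
  have g7 : ∀ v, σ₇ 6 v v ≠ 0 ↔ A := by
    intro v
    rw [hσ₇, denote_asg_ne_zero hcap0, holds_attemptExp hs (c5.congr (f6 0 (by omega))) r6 m6 q6 g6
      (hR' ▸ y6)]
    simp [hA]
  have y7 : IsSet σ₇ 5 R' := y6.congr (f7 5 (by omega))
  have q7 : IsSet σ₇ 3 Q := q6.congr (f7 3 (by omega))
  have f17 : ∀ a, a < 2 ∨ 6 < a → σ₇ a = σ a := fun a ha =>
    (f7 a (by omega)).trans (f16 a (by omega) (by omega) (by omega) (by omega))
  set σ₈ := (asg 7 (ite (and (rd 6 6 6) (rd 3 6 6)) (sum (flag (rd 5 8 8))) (rd 7 6 6))).denote k cap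
    6 ρ σ₇ with hσ₈
  have f8 : ∀ a, a ≠ 7 → σ₈ a = σ₇ a := fun a ha => denote_asg_ne _ _ _ _ _ ha
  set σ₉ := (asg 8 (ite (and (rd 6 6 6) (rd 3 6 6)) (var 3) (rd 8 6 6))).denote k cap 6 ρ σ₈ with hσ₉
  have f9 : ∀ a, a ≠ 8 → σ₉ a = σ₈ a := fun a ha => denote_asg_ne _ _ _ _ _ ha
  have hlt := h.reduced.lt
  simp only [Fintype.card_fin] at hlt
  have g8 : ∀ v, σ₈ 7 v v = if A ∧ v ∈ Q then R'.card else T v := by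
    intro v
    have hcard : (sum (flag (rd 5 8 8))).eval k σ₇ (6 + 2)
        (Function.update (Function.update ρ 6 v) (6 + 1) v) = R'.card :=
      eval_sum_flag fun u => by simp [holds_rd, (y7 u).symm]
    have hle : R'.card ≤ n := (Finset.card_le_univ R').trans (Fintype.card_fin n).le
    have hv := hlt v
    rw [hσ₈, denote_asg_self, eval_ite, hcard, holds_and, holds_rd, holds_rd, eval_rd]
    simp only [Function.update_apply, Nat.reduceAdd, show ¬ (6 = 7) by omega, if_false, if_true,
      g7, q7 _, f17 7 (by omega), h.level]
    split_ifs <;> exact min_eq_left (by omega)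
  have g9 : ∀ v, σ₉ 8 v v = ((if A ∧ v ∈ Q then ρ 3 else P v : Fin n) : ℕ) := by
    intro v
    have h1 := (ρ 3).isLt
    have h2 := (P v).isLt
    rw [hσ₉, denote_asg_self, eval_ite, holds_and, holds_rd, holds_rd, eval_rd, eval_var]
    simp only [Function.update_apply, Nat.reduceAdd, show ¬ (6 = 7) by omega, if_false, if_true,
      show ¬ (3 = 7) by omega, show ¬ (3 = 6) by omega, f8 6 (by omega), f8 3 (by omega),
      f8 8 (by omega), g7, q7 _, f17 8 (by omega), h.hub]
    split_ifs <;> exact min_eq_left (by omega)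
  set σ' := (asg 1 (ite (rd 6 6 6) (rd 5 6 6) (rd 1 6 6))).denote k cap 6 ρ σ₉ with hσ'
  have f' : ∀ a, a ≠ 1 → σ' a = σ₉ a := fun a ha => denote_asg_ne _ _ _ _ _ ha
  have g' : IsSet σ' 1 (if A then R' else R) := by
    refine isSet_asg hcap0 fun v => ?_
    simp only [holds_ite, holds_rd, Function.update_apply, Nat.reduceAdd, show ¬ (6 = 7) by omega,
      if_false, if_true, f9 6 (by omega), f8 6 (by omega), f9 5 (by omega), f8 5 (by omega),
      f9 1 (by omega), f8 1 (by omega), g7, y7 _, (h.set.congr (f17 1 (by omega))) _]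
    split_ifs with hAA <;> simp [hAA]
  have c' : Codes σ' s := h.codes.congr ((f' 0 (by omega)).trans ((f9 0 (by omega)).trans
    ((f8 0 (by omega)).trans (f17 0 (by omega)))))
  refine ⟨fun v => if A ∧ v ∈ Q then R'.card else T v, fun v => if A ∧ v ∈ Q then ρ 3 else P v,
    ?_, c', g', fun v => ?_, fun v => ?_⟩
  · by_cases hAA : A
    · simp only [hAA, true_and, if_true]
      subst hR'
      exact h.reduced.step hs (Attempt.reduction hs hM hQ hAA)
    · simp only [hAA, false_and, if_false]
      exact h.reduced
  · rw [f' 7 (by omega), f9 7 (by omega), g8]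
  · rw [f' 8 (by omega), g9]

end RAM

/-! ### Rounds of attempts and the end of the first phase. -/

namespace RAM

open Exp Cmd SignMatrix

/-- The four kinds of attempts. -/
def attemptsCmd : Cmd :=
  .seq (attemptCmd .none) (.seq (attemptCmd .triple) (.seq (attemptCmd .odd) (attemptCmd .twins)))

/-- All attempts with all choices of five vertices. -/
def roundCmd : Cmd := .for_ (.for_ (.for_ (.for_ (.for_ attemptsCmd))))

/-- The first phase. -/
def reduceCmd : Cmd := .seq (.asg 1 (const 1)) (.for_ roundCmd)

variable {n k cap : ℕ} {σ : Arr n} {ρ : ℕ → Fin n} {s : Fin n → Fin n → ℤ}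

theorem attemptsCmd_keeps {a : ℕ} (h : a = 0 ∨ 8 < a) : attemptsCmd.Keeps a :=
  ⟨attemptCmd_keeps h, attemptCmd_keeps h, attemptCmd_keeps h, attemptCmd_keeps h⟩

/-- The program has made progress from the vertex set `R₀`. -/
def Shrunk (s : Fin n → Fin n → ℤ) (R₀ : Finset (Fin n)) (σ : Arr n) : Prop :=
  ∃ R T P, Alive σ s R T P ∧ R.card < R₀.card

/-- The program has made progress from the vertex set `R₀`, or is still there. -/
def Waiting (s : Fin n → Fin n → ℤ) (R₀ : Finset (Fin n)) (σ : Arr n) : Prop :=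
  (∃ T P, Alive σ s R₀ T P) ∨ Shrunk s R₀ σ

theorem Shrunk.attempt (hs : IsSignMatrix s) (hcap : n + 1 ≤ cap) {R₀ : Finset (Fin n)}
    (h : Shrunk s R₀ σ) (κ : Kind) : Shrunk s R₀ ((attemptCmd κ).denote k cap 6 ρ σ) := by
  classical
  obtain ⟨R, T, P, h, hlt⟩ := h
  obtain ⟨T', P', h'⟩ := h.attempt (k := k) (ρ := ρ) hs hcap (κ := κ) rfl rfl rfl
  refine ⟨_, T', P', h', lt_of_le_of_lt (Finset.card_le_card ?_) hlt⟩
  split_ifs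
  · exact Finset.sdiff_subset.trans Finset.sdiff_subset
  · exact Finset.Subset.refl _

theorem Waiting.of_subset {R R₀ : Finset (Fin n)} {T : Fin n → ℕ} {P : Fin n → Fin n}
    (h : Alive σ s R T P) (hR : R ⊆ R₀) : Waiting s R₀ σ := by
  rcases hR.eq_or_ssubset with rfl | hlt
  · exact Or.inl ⟨T, P, h⟩
  · exact Or.inr ⟨R, T, P, h, Finset.card_lt_card hlt⟩

theorem Waiting.attempt (hs : IsSignMatrix s) (hcap : n + 1 ≤ cap) {R₀ : Finset (Fin n)}
    (h : Waiting s R₀ σ) (κ : Kind) : Waiting s R₀ ((attemptCmd κ).denote k cap 6 ρ σ) := by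
  classical
  rcases h with ⟨T, P, h⟩ | h
  · obtain ⟨T', P', h'⟩ := h.attempt (k := k) (ρ := ρ) hs hcap (κ := κ) rfl rfl rfl
    refine .of_subset h' ?_
    split_ifs
    · exact Finset.sdiff_subset.trans Finset.sdiff_subset
    · exact Finset.Subset.refl _
  · exact Or.inr (h.attempt hs hcap κ)

theorem Waiting.attempt_shrunk (hs : IsSignMatrix s) (hcap : n + 1 ≤ cap)
    {R₀ M Q : Finset (Fin n)} (h : Waiting s R₀ σ) {κ : Kind}
    (hr : Reduction s R₀ M Q (ρ 1) (ρ 2) (ρ 3)) (hMQ : (M ∪ Q).Nonempty)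
    (hM : M = κ.mark (ρ 1) (ρ 2) (ρ 3)) (hQ : Q = tryGroup s R₀ M (ρ 3) (ρ 4) n)
    (hA : Attempt s R₀ M Q (tryReach s ((R₀ \ M) \ Q) (ρ 5) n) κ (ρ 1) (ρ 2) (ρ 3) (ρ 5)) :
    Shrunk s R₀ ((attemptCmd κ).denote k cap 6 ρ σ) := by
  rcases h with ⟨T, P, h⟩ | h
  · obtain ⟨T', P', h'⟩ := h.attempt (k := k) (ρ := ρ) hs hcap hM hQ rfl
    rw [if_pos hA] at h'
    exact ⟨_, T', P', h', hr.card_lt hMQ⟩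
  · exact h.attempt hs hcap κ

theorem Shrunk.attempts (hs : IsSignMatrix s) (hcap : n + 1 ≤ cap) {R₀ : Finset (Fin n)}
    (ρ : ℕ → Fin n) (σ : Arr n) (h : Shrunk s R₀ σ) :
    Shrunk s R₀ (attemptsCmd.denote k cap 6 ρ σ) :=
  (((h.attempt hs hcap _).attempt hs hcap _).attempt hs hcap _).attempt hs hcap _

theorem Waiting.attempts (hs : IsSignMatrix s) (hcap : n + 1 ≤ cap) {R₀ : Finset (Fin n)}
    (ρ : ℕ → Fin n) (σ : Arr n) (h : Waiting s R₀ σ) :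
    Waiting s R₀ (attemptsCmd.denote k cap 6 ρ σ) :=
  (((h.attempt hs hcap _).attempt hs hcap _).attempt hs hcap _).attempt hs hcap _

theorem Waiting.attempts_shrunk (hs : IsSignMatrix s) (hcap : n + 1 ≤ cap)
    {R₀ M Q : Finset (Fin n)} {κ : Kind}
    (hr : Reduction s R₀ M Q (ρ 1) (ρ 2) (ρ 3)) (hMQ : (M ∪ Q).Nonempty)
    (hM : M = κ.mark (ρ 1) (ρ 2) (ρ 3)) (hQ : Q = tryGroup s R₀ M (ρ 3) (ρ 4) n)
    (hA : Attempt s R₀ M Q (tryReach s ((R₀ \ M) \ Q) (ρ 5) n) κ (ρ 1) (ρ 2) (ρ 3) (ρ 5))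
    (σ : Arr n) (h : Waiting s R₀ σ) : Shrunk s R₀ (attemptsCmd.denote k cap 6 ρ σ) := by
  have key : ∀ σ, Waiting s R₀ σ → Shrunk s R₀ ((attemptCmd κ).denote k cap 6 ρ σ) :=
    fun σ h => h.attempt_shrunk hs hcap hr hMQ hM hQ hA
  cases κ with
  | none => exact (((key _ h).attempt hs hcap _).attempt hs hcap _).attempt hs hcap _
  | triple => exact ((key _ (h.attempt hs hcap _)).attempt hs hcap _).attempt hs hcap _
  | odd => exact (key _ ((h.attempt hs hcap _).attempt hs hcap _)).attempt hs hcap _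
  | twins => exact key _ (((h.attempt hs hcap _).attempt hs hcap _).attempt hs hcap _)

theorem Cmd.for_preserves {I : Arr n → Prop} {c : Cmd} {d : ℕ}
    (hI : ∀ ρ σ, I σ → I (c.denote k cap (d + 1) ρ σ)) (ρ : ℕ → Fin n) (σ : Arr n) (h : I σ) :
    I ((for_ c).denote k cap d ρ σ) :=
  forDown_induction (fun _ σ => I σ) (fun _ σ h => hI _ σ h) n le_rfl σ h

/-- It is enough that one round turns `I` into `D`, when all rounds preserve both. Nested five
times, this singles out one good choice of vertices in a round of attempts. -/
theorem Cmd.for_progress {I D : Arr n → Prop} {c : Cmd} {d : ℕ} {ρ : ℕ → Fin n} (x₀ : Fin n)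
    (hI : ∀ ρ σ, I σ → I (c.denote k cap (d + 1) ρ σ))
    (hD : ∀ ρ σ, D σ → D (c.denote k cap (d + 1) ρ σ))
    (h₀ : ∀ σ, I σ → D (c.denote k cap (d + 1) (Function.update ρ d x₀) σ)) (σ : Arr n) (h : I σ) :
    D ((for_ c).denote k cap d ρ σ) := by
  refine (forDown_induction (f := fun x => c.denote k cap (d + 1) (Function.update ρ d x))
    (fun m σ => I σ ∧ (m ≤ x₀ → D σ)) (fun x σ h => ⟨hI _ σ h.1, fun hx => ?_⟩) n le_rfl σ
    ⟨h, fun hx => absurd x₀.isLt (not_lt.2 hx)⟩).2 (Nat.zero_le _)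
  rcases hx.eq_or_lt with hx | hx
  · rw [Fin.ext hx]
    exact h₀ σ h.1
  · exact hD _ σ (h.2 hx)

theorem Waiting.round (hs : IsSignMatrix s) (hcap : n + 1 ≤ cap) {R₀ : Finset (Fin n)}
    (ρ : ℕ → Fin n) (σ : Arr n) (h : Waiting s R₀ σ) :
    Waiting s R₀ (roundCmd.denote k cap 1 ρ σ) :=
  Cmd.for_preserves (Cmd.for_preserves (Cmd.for_preserves (Cmd.for_preserves (Cmd.for_preserves
    (Waiting.attempts hs hcap))))) ρ σ h

/-- Each round makes progress. -/
theorem Alive.round_shrunk (hs : IsSignMatrix s) (hcap : n + 1 ≤ cap) {R : Finset (Fin n)}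
    {T : Fin n → ℕ} {P : Fin n → Fin n} (h : Alive σ s R T P) (hR : 1 < R.card) :
    Shrunk s R (roundCmd.denote k cap 1 ρ σ) := by
  -- A reduction of `R` is fixed in advance. When the loops arrive at its vertices, either the set
  -- has already shrunk or it still is `R` and the attempt succeeds.
  obtain ⟨M, Q, a, b, c, hMQ, hr⟩ := reducible_of_one_lt_card hs h.reduced.conn hR
  obtain ⟨κ, d, e, hM, hQ, hA⟩ := hr.exists_attempt
    ((Finset.card_le_univ R).trans (Fintype.card_fin n).le)
  have p1 := Waiting.attempts (k := k) (R₀ := R) hs hcap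
  have q1 := Shrunk.attempts (k := k) (R₀ := R) hs hcap
  have p2 := Cmd.for_preserves (d := 5) p1
  have q2 := Cmd.for_preserves (d := 5) q1
  have p3 := Cmd.for_preserves (d := 4) p2
  have q3 := Cmd.for_preserves (d := 4) q2
  have p4 := Cmd.for_preserves (d := 3) p3
  have q4 := Cmd.for_preserves (d := 3) q3
  have p5 := Cmd.for_preserves (d := 2) p4
  have q5 := Cmd.for_preserves (d := 2) q4
  refine Cmd.for_progress a p5 q5 (Cmd.for_progress b p4 q4 (Cmd.for_progress c p3 q3
    (Cmd.for_progress d p2 q2 (Cmd.for_progress e p1 q1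
      (Waiting.attempts_shrunk (M := M) (Q := Q) (κ := κ) hs hcap ?_ hMQ ?_ ?_ ?_))))) σ
      (Or.inl ⟨T, P, h⟩)
  all_goals simpa [Function.update_apply]

theorem reduceCmd_keeps {a : ℕ} (h : 8 < a) : reduceCmd.Keeps a :=
  ⟨show a ≠ 1 by omega, attemptsCmd_keeps (Or.inr h)⟩

/-- The first phase reduces the graph to one vertex. -/
theorem denote_reduceCmd [NeZero n] (hs : IsSignMatrix s) (hcap : n + 1 ≤ cap)
    (hc : Conn s Finset.univ) (h : Codes σ s) (h7 : ∀ v, σ 7 v v = 0) (h8 : ∀ v, σ 8 v v = 0) :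
    ∃ R T P, Alive (reduceCmd.denote k cap 0 ρ σ) s R T P ∧ R.card = 1 := by
  rw [reduceCmd, denote_seq]
  set σ₁ := (asg 1 (const 1)).denote k cap 0 ρ σ with hσ₁
  have f1 : ∀ a, a ≠ 1 → σ₁ a = σ a := fun a ha => denote_asg_ne _ _ _ _ _ ha
  have start : Alive σ₁ s Finset.univ (fun _ => 0) (fun _ => 0) := by
    refine ⟨reduced_univ hc ⟨0, Finset.mem_univ _⟩ _, h.congr (f1 0 (by omega)),
      isSet_asg (by omega) fun v => ?_, fun v => ?_, fun v => ?_⟩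
    · simp [holds_const]
    · rw [f1 7 (by omega), h7]
    · rw [f1 8 (by omega), h8]; simp
  -- Every round on more than one vertex removes at least one, so `max m 1` bounds what is left when
  -- `m` rounds remain.
  have key := forDown_induction
    (f := fun x => roundCmd.denote k cap 1 (Function.update ρ 0 x))
    (fun m σ => ∃ R T P, Alive σ s R T P ∧ R.card ≤ max m 1) ?_ n le_rfl σ₁
    ⟨_, _, _, start, by simp⟩
  · obtain ⟨R, T, P, hR, hle⟩ := key
    refine ⟨R, T, P, hR, ?_⟩
    have := Finset.card_pos.2 hR.reduced.nonempty
    omega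
  · rintro x σ ⟨R, T, P, hR, hle⟩
    by_cases hcard : 1 < R.card
    · obtain ⟨R', T', P', hR', hlt⟩ := hR.round_shrunk (k := k) (ρ := Function.update ρ 0 x) hs hcap
        hcard
      exact ⟨R', T', P', hR', by omega⟩
    · rcases Waiting.round (k := k) hs hcap (Function.update ρ 0 x) σ
        (Or.inl ⟨T, P, hR⟩ : Waiting s R σ) with ⟨T', P', hR'⟩ | ⟨R', T', P', hR', hlt⟩
      · exact ⟨R, T', P', hR', by omega⟩
      · exact ⟨R', T', P', hR', by omega⟩

end RAM

/-! ### The program applied to the input. -/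

open SignMatrix in
/-- The program for Signed Max Cut ATLB. -/
theorem SignedGraph.exists_program : ∃ (p : RAM.Prog) (c : ℕ),
    p.SolvesSignedMaxCutATLBInTime (fun n k => c * 8 ^ k * (n + k + 1) ^ c) := by
  obtain ⟨C, hC⟩ := RAM.run_assemble RAM.reduceCmd RAM.sweepCmd RAM.answerExp
  refine ⟨RAM.assemble RAM.reduceCmd RAM.sweepCmd RAM.answerExp, C, fun n k G hG => ?_⟩
  have hn : NeZero n := ⟨by rintro rfl; exact hG.nonempty.elim fun v => v.elim0⟩
  have hnpos := NeZero.pos n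
  have hs := G.isSignMatrix_sign
  have hnn : n ≤ n * n := Nat.le_mul_self n
  have hcap : n * n + 1 ≤ n * (n * 8) := by
    rw [← mul_assoc]; omega
  -- Memory beyond the matrix is zero, so levels, hubs, colours and the best value all start at
  -- zero.
  set σ : RAM.Arr n := fun a u v => if a = 0 then G.signCode u v else 0 with hσ
  have hcode : ∀ u v, G.signCode u v ≤ 2 := fun u v => by
    unfold signCode; split_ifs <;> omega
  have hcodes : RAM.Codes σ G.sign := by
    intro u v
    simp only [hσ, if_true]
    unfold signCode sign
    split_ifs <;> simp
  have hmem : RAM.MemRep σ (G.inputState k).mem := by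
    intro a x y
    have hx := x.isLt
    have hy := y.isLt
    simp only [inputState, hσ, RAM.blk]
    by_cases ha : a = 0
    · have hlt : (0 * n + (x : ℕ)) * n + y < n * n := by nlinarith
      rw [if_pos ha, if_pos ha, dif_pos hlt]
      congr 1
      · refine Fin.ext ?_
        rw [Fin.coe_divNat]
        simp only
        rw [zero_mul, zero_add, add_comm, Nat.add_mul_div_right _ _ hnpos, Nat.div_eq_of_lt hy,
          zero_add]
      · refine Fin.ext ?_
        rw [Fin.coe_modNat]
        simp only
        rw [zero_mul, zero_add, add_comm, Nat.add_mul_mod_self_right, Nat.mod_eq_of_lt hy]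
    · rw [if_neg ha, if_neg ha, dif_neg]
      rw [not_lt]
      calc n * n = (1 * n + 0) * n + 0 := by ring
        _ ≤ _ := by gcongr <;> omega
  obtain ⟨s', t, hrun, ht, hres⟩ := hC n k σ (fun a x y => by
    simp only [hσ]; split_ifs <;> simp [hcode]) (G.inputState k) rfl rfl (fun r hr => by
      simp only [inputState]; rw [if_neg (by omega), if_neg (by omega)]) hmem
  refine ⟨s', t, hrun, ht, ?_⟩
  obtain ⟨R, T, P, hA, hR⟩ := RAM.denote_reduceCmd (k := k) (cap := n * (n * 8))
    (ρ := fun _ => 0) hs (by omega) (G.conn_univ hG) hcodes (fun v => rfl) (fun v => rfl)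
  have hk := fun h => hA.reduced.card_le hs hR (k := k) h
  obtain ⟨r, rfl⟩ := Finset.card_eq_one.1 hR
  have hlt := hA.reduced.lt
  simp only [Fintype.card_fin] at hlt
  have hhold : RAM.Holding (RAM.reduceCmd.denote k (n * (n * 8)) 0 (fun _ => 0) σ) G.sign T P
      fun _ => false := by
    refine ⟨hA.codes, hA.level, hA.hub, fun v => ?_⟩
    rw [(RAM.reduceCmd_keeps (by omega : 8 < 9)).denote_eq]
    simp [hσ]
  have key := RAM.eval_answerExp (k := k) (ρ := fun _ => 0) hs hA.reduced.scheme hlt hhold hcap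
    (fun v => by rw [(RAM.reduceCmd_keeps (by omega : 8 < 15)).denote_eq]; rfl) hk
  rw [hres, G.isYesInstance_iff]
  exact key

theorem mainTheorem2 :
    (∃ (p : RAM.Prog) (c : ℕ),
      p.SolvesSignedMaxCutATLBInTime (fun n k => c * 8 ^ k * (n + k + 1) ^ c)) ∧
    (∀ (V : Type*) [Finite V] (G : SignedGraph V) (k : ℕ), G.graph.Connected →
      G.IsYesInstance k ∨
      ∃ S : Set V, S.ncard ≤ 3 * k ∧
        (G.induce Sᶜ).graph.IsForestOfCliques ∧
        ¬ (G.induce Sᶜ).HasPositiveTriangle ∧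
        ∃ W : Set V, W ⊆ Sᶜ ∧ ((G.switch W).induce Sᶜ).pos = ⊥) := by
  refine ⟨SignedGraph.exists_program, fun V _ G k hG => ?_⟩
  by_cases hk : G.IsYesInstance k
  · exact Or.inl hk
  · exact Or.inr (G.exists_deletion_set k hG hk)
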